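/- **Lemma (Relevant mixed-integer points).** For $P\subseteq\mathbb R^{n+d}$ let $P_{MI}=\operatorname{conv}(P\cap(\mathbb Z^n\times\mathbb R^d))$ be its mixed-integer hull and $\operatorname{rec}(P)=\{y : x+ty\in P \text{ for all } x\in P,\ t\ge 0\}$ its recession cone. Input sizes are binary encoding lengths, where the dimensions $n$ and $d$ are part of the input and are counted in unary; a rational polytope is the convex hull of finitely many rational points. (a) There is a polynomial-time algorithm which, given $n,d\ge 0$ and finite sets $V\subseteq\mathbb Q^{n+d}$, $W\subseteq\mathbb Z^{n+d}$ such that the polyhedron $P=\operatorname{conv}(V)+\operatorname{cone}(W)$ satisfies $P\cap(\mathbb Z^n\times\mathbb R^d)\ne\emptyset$, computes a vertex description (a finite set $V'\subseteq\mathbb Q^{n+d}$ with $Q=\operatorname{conv}(V')$) of a rational polytope $Q$, such that $$P=Q+\operatorname{rec}(P)\qquad\text{and}\qquad P_{MI}=\operatorname{conv}\bigl(Q\cap(\mathbb Z^n\times\mathbb R^d)\bigr)+\operatorname{rec}(P).$$ (b) There is a polynomial-time algorithm which, given $n,d,m\ge 0$, $A\in\mathbb Q^{m\times(n+d)}$ and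 $b\in\mathbb Q^m$ such that the polyhedron $P=\{x\in\mathbb R^{n+d}: Ax\le b\}$ satisfies $P\cap(\mathbb Z^n\times\mathbb R^d)\ne\emptyset$, computes an inequality description $Q=\{x\in\mathbb R^{n+d}: A'x\le b'\}$, with $A'$ and $b'$ rational, of a rational polytope $Q$ with the same two properties. In both cases the encoding length of the computed description of $Q$ is bounded by a polynomial in the encoding length of the input. The algorithms and polynomials do not depend on $n$, $d$ or $P$. -/

import Mathlib

open scoped Pointwise

noncomputable section

namespace MixedInteger

/-! ### Polyhedra and their descriptions -/

/-- The real vector with the given rational entries. -/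
def ratVec {k : ℕ} (v : Fin k → ℚ) : Fin k → ℝ := fun i => (v i : ℝ)

/-- The real vector with the given integer entries. -/
def intVec {k : ℕ} (w : Fin k → ℤ) : Fin k → ℝ := fun i => (w i : ℝ)

/-- The convex cone generated by `S`: all finite nonnegative combinations of elements of `S`
(in particular `cone ∅ = {0}`). -/
def cone {k : ℕ} (S : Set (Fin k → ℝ)) : Set (Fin k → ℝ) :=
  (PointedCone.hull ℝ S : Set (Fin k → ℝ))

/-- The data of an inner description in dimension `k`: finitely many rational points and
finitely many integral directions. -/
structure InnerDescription (k : ℕ) where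
  /-- the points -/
  V : List (Fin k → ℚ)
  /-- the directions -/
  W : List (Fin k → ℤ)

/-- The polyhedron `conv(V) + cone(W)`. -/
def InnerDescription.toSet {k : ℕ} (D : InnerDescription k) : Set (Fin k → ℝ) :=
  convexHull ℝ {x | ∃ v ∈ D.V, x = ratVec v} + cone {x | ∃ w ∈ D.W, x = intVec w}

/-- The data of a vertex description in dimension `k`: finitely many rational points. -/
structure VertexDescription (k : ℕ) where
  /-- the points -/
  V : List (Fin k → ℚ)

/-- The polytope `conv(V)`. -/
def VertexDescription.toSet {k : ℕ} (D : VertexDescription k) : Set (Fin k → ℝ) :=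
  convexHull ℝ {x | ∃ v ∈ D.V, x = ratVec v}

/-- The data of an inequality description in dimension `k`: a rational system `A x ≤ b`
with `m` rows. -/
structure IneqDescription (k : ℕ) where
  /-- the number of inequalities -/
  m : ℕ
  /-- the coefficient matrix -/
  A : Matrix (Fin m) (Fin k) ℚ
  /-- the right-hand side -/
  b : Fin m → ℚ

/-- The polyhedron `{x ∈ ℝᵏ : A x ≤ b}`. -/
def IneqDescription.toSet {k : ℕ} (D : IneqDescription k) : Set (Fin k → ℝ) :=
  {x | ∀ i, ∑ j, (D.A i j : ℝ) * x j ≤ (D.b i : ℝ)}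

/-- A rational polytope: the convex hull of finitely many rational points. -/
def IsRationalPolytope {k : ℕ} (Q : Set (Fin k → ℝ)) : Prop :=
  ∃ S : Finset (Fin k → ℚ), Q = convexHull ℝ (ratVec '' (S : Set (Fin k → ℚ)))

/-- The recession cone of `P`: the directions in which one can move indefinitely from every
point of `P`. -/
def recCone {k : ℕ} (P : Set (Fin k → ℝ)) : Set (Fin k → ℝ) :=
  {y | ∀ x ∈ P, ∀ t : ℝ, 0 ≤ t → x + t • y ∈ P}

/-- The mixed-integer lattice `ℤⁿ × ℝᵈ` inside `ℝⁿ⁺ᵈ`. -/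
def mixedLattice (n d : ℕ) : Set (Fin (n + d) → ℝ) :=
  {x | ∀ i : Fin n, ∃ z : ℤ, x (Fin.castAdd d i) = (z : ℝ)}

/-- The mixed-integer hull `conv(P ∩ (ℤⁿ × ℝᵈ))`. -/
def mixedHull (n d : ℕ) (P : Set (Fin (n + d) → ℝ)) : Set (Fin (n + d) → ℝ) :=
  convexHull ℝ (P ∩ mixedLattice n d)

/-! ### Binary encodings

Integers are written in binary with a sign bit, rationals as a reduced fraction, vectors and
lists between brackets. The dimensions `n` and `d` are written in unary, so that the size of an
input is at least the number of its variables. -/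

open Computability (Γ')

/-- Binary digits of a natural number (least significant digit first). -/
def encNat (a : ℕ) : List Γ' := (Computability.encodeNat a).map Γ'.bit

/-- Sign bit and binary digits of the absolute value. -/
def encInt (z : ℤ) : List Γ' := Γ'.bit (decide (z < 0)) :: encNat z.natAbs

/-- An integer as an entry of a vector. -/
def encIntEntry (z : ℤ) : List Γ' := Γ'.bra :: (encInt z ++ [Γ'.ket])

/-- A rational as an entry of a vector: numerator and denominator in lowest terms. -/
def encRatEntry (q : ℚ) : List Γ' :=
  Γ'.bra :: (encInt q.num ++ Γ'.comma :: (encNat q.den ++ [Γ'.ket]))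

/-- A list between brackets, the entries being written by `e`. -/
def encList {α : Type} (e : α → List Γ') (l : List α) : List Γ' :=
  Γ'.bra :: (l.flatMap e ++ [Γ'.ket])

/-- A vector as the list of its entries. -/
def encVec {α : Type} {k : ℕ} (e : α → List Γ') (x : Fin k → α) : List Γ' :=
  encList e (List.ofFn x)

/-- Encoding of the lists `V` and `W`. -/
def InnerDescription.encode {k : ℕ} (D : InnerDescription k) : List Γ' :=
  encList (encVec encRatEntry) D.V ++ encList (encVec encIntEntry) D.W

/-- Encoding of the list `V`. -/
def VertexDescription.encode {k : ℕ} (D : VertexDescription k) : List Γ' :=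
  encList (encVec encRatEntry) D.V

/-- Encoding of the list of the rows of `(A, b)`. -/
def IneqDescription.encode {k : ℕ} (D : IneqDescription k) : List Γ' :=
  encList (fun i : Fin D.m => encVec encRatEntry (D.A i) ++ encRatEntry (D.b i))
    (List.finRange D.m)

/-- Encoding of a description `D` in dimension `n + d`, together with `n` and `d` in unary. -/
def encWithDims {E : ℕ → Type} (enc : ∀ k : ℕ, E k → List Γ') (n d : ℕ) (D : E (n + d)) :
    List Γ' :=
  List.replicate n (Γ'.bit true) ++ Γ'.comma ::
    (List.replicate d (Γ'.bit true) ++ Γ'.comma :: enc (n + d) D)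

/-- A family of maps from descriptions (of kind `E`) to descriptions (of kind `F`) in the same
dimensions is computable in polynomial time: one multi-tape Turing machine, which receives
`n`, `d` and the description as its input, computes all of them, within a number of steps
bounded by one polynomial in the length of the input. -/
def PolyTimeComputable {E F : ℕ → Type} (encE : ∀ k : ℕ, E k → List Γ')
    (encF : ∀ k : ℕ, F k → List Γ') (f : ∀ n d : ℕ, E (n + d) → F (n + d)) : Prop :=
  Nonempty (Turing.TM2ComputableInPolyTime
    (fun I : (p : ℕ × ℕ) × E (p.1 + p.2) => encWithDims encE I.1.1 I.1.2 I.2)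
    (fun J : (p : ℕ × ℕ) × F (p.1 + p.2) => encWithDims encF J.1.1 J.1.2 J.2)
    (fun I => ⟨I.1, f I.1.1 I.1.2 I.2⟩))

/-- The encoding length of a description in dimension `n + d`. -/
def encSize {E : ℕ → Type} (enc : ∀ k : ℕ, E k → List Γ') (n d : ℕ) (D : E (n + d)) : ℕ :=
  (encWithDims enc n d D).length

end MixedInteger

end

open MixedInteger

/-! Both parts rest on one observation, `relevant_points`. Let Q lie in P, let rec(P) be generated
by integral vectors, and suppose that every point of P enters Q after subtraction of some integral
vector of rec(P). Then P = Q + rec(P). Such a subtraction preserves the mixed-integer lattice, which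
gives the inclusion of the mixed-integer hull in conv(Q ∩ lattice) + rec(P). Conversely, if p is a
lattice point of P and w an integral recession direction, then p + c w lies on the segment from p to
the lattice point p + N w for any integer N > c.

For an inner description, Q is the hull of all v and v + |W| w (`InnerDescription.truncate`).
Rounding down the coefficients of the directions leaves a remainder with coefficients in [0,1], and
v plus this remainder is an average of points on the segments [v, v + |W| w].

For a system of inequalities, Q is P intersected with the box of radius R = 2^(L^8), where L is the
input length (`IneqDescription.addBox`). The homogenized cone is generated by integer vectors of
polynomial bit length: inside each orthant it is pointed, and Siegel's lemma puts a small integer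
vector on each extreme ray (`mem_hull_small_int`). Writing (x, 1) in these generators and removing
the integer parts of the coefficients of recession generators leaves a vector bounded by the number
of generators times their size (`exists_sub_intVec_mem`). That number is exponential, but only its
logarithm enters the bit length of R.

For the complexity claims, structured programs on four stacks are compiled to Turing machines
(`Prog.Runs.steps`). Data are binary trees with a self-delimiting code, and the class `PT` of
polynomial-time functions is closed under composition, case distinction and folds whose states stay
polynomially small (`PT.foldl`). Arithmetic and parsing are built from these. Neither algorithm
solves a linear program or computes a gcd: one adds integers to reduced fractions, the other appends
rows to the input string. -/

noncomputable section

namespace MixedInteger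

open Computability (Γ')

/-! ### Structured stack programs and their compilation to `TM2` machines -/

/-- The four stacks: main, auxiliary, counter, reversal. -/
inductive Stk
  | main | aux | cnt | rev
  deriving DecidableEq

instance : Fintype Stk :=
  ⟨{Stk.main, Stk.aux, Stk.cnt, Stk.rev}, fun k => by cases k <;> decide⟩

/-- Structured programs over the four stacks, with one register holding the last popped symbol. -/
inductive Prog
  | push (k : Stk) (g : Option Γ' → Γ')
  | pop (k : Stk)
  | seq (p q : Prog)
  | ite (f : Option Γ' → Bool) (p q : Prog)
  | loop (f : Option Γ' → Bool) (p : Prog)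

namespace Prog

/-- Configurations: the register and the stacks. -/
abbrev Conf := Option Γ' × (Stk → List Γ')

/-- Big-step semantics, with the exact number of machine steps. -/
inductive Runs : Prog → Conf → Conf → ℕ → Prop
  | push (k g v S) : Runs (push k g) (v, S) (v, Function.update S k (g v :: S k)) 1
  | pop (k v S) : Runs (pop k) (v, S) ((S k).head?, Function.update S k (S k).tail) 1
  | seq {p q c₁ c₂ c₃ s t} : Runs p c₁ c₂ s → Runs q c₂ c₃ t → Runs (seq p q) c₁ c₃ (s + t)
  | ite_true {f p q v S c t} : f v = true → Runs p (v, S) c t → Runs (ite f p q) (v, S) c (1 + t)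
  | ite_false {f p q v S c t} : f v = false → Runs q (v, S) c t → Runs (ite f p q) (v, S) c (1 + t)
  | loop_true {f p v S c₁ c₂ s t} : f v = true → Runs p (v, S) c₁ s → Runs (loop f p) c₁ c₂ t →
      Runs (loop f p) (v, S) c₂ (1 + s + t)
  | loop_false {f p v S} : f v = false → Runs (loop f p) (v, S) (v, S) 1

/-- The labels of the machine compiled from a program. -/
def Lab : Prog → Type
  | push _ _ => Unit
  | pop _ => Unit
  | seq p q => Lab p ⊕ Lab q
  | ite _ p q => Unit ⊕ (Lab p ⊕ Lab q)
  | loop _ p => Unit ⊕ Lab p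

instance instFintypeLab : (p : Prog) → Fintype (Lab p)
  | push _ _ => inferInstanceAs (Fintype Unit)
  | pop _ => inferInstanceAs (Fintype Unit)
  | seq p q =>
    letI := instFintypeLab p; letI := instFintypeLab q
    inferInstanceAs (Fintype (Lab p ⊕ Lab q))
  | ite _ p q =>
    letI := instFintypeLab p; letI := instFintypeLab q
    inferInstanceAs (Fintype (Unit ⊕ (Lab p ⊕ Lab q)))
  | loop _ p =>
    letI := instFintypeLab p
    inferInstanceAs (Fintype (Unit ⊕ Lab p))

/-- The label at which the execution of a program starts. -/
def entry : (p : Prog) → Lab p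
  | push _ _ => ()
  | pop _ => ()
  | seq p _ => Sum.inl (entry p)
  | ite _ _ _ => Sum.inl ()
  | loop _ _ => Sum.inl ()

/-- Machine statements with labels in `Λ`. -/
abbrev Stm (Λ : Type) := Turing.TM2.Stmt (fun _ : Stk => Γ') Λ (Option Γ')

open Turing.TM2 (Stmt) in
/-- The machine code of a program whose labels are embedded by `e` and which continues at `x`. -/
def code : (p : Prog) → {Λ : Type} → (Lab p → Λ) → Λ → Lab p → Stm Λ
  | push k g, _, _, x, _ => Stmt.push k g (Stmt.goto fun _ => x)
  | pop k, _, _, x, _ => Stmt.pop k (fun _ o => o) (Stmt.goto fun _ => x)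
  | seq p q, _, e, x, l => match l with
    | Sum.inl l => code p (fun l => e (Sum.inl l)) (e (Sum.inr (entry q))) l
    | Sum.inr l => code q (fun l => e (Sum.inr l)) x l
  | ite f p q, _, e, x, l => match l with
    | Sum.inl _ => Stmt.branch f (Stmt.goto fun _ => e (Sum.inr (Sum.inl (entry p))))
        (Stmt.goto fun _ => e (Sum.inr (Sum.inr (entry q))))
    | Sum.inr (Sum.inl l) => code p (fun l => e (Sum.inr (Sum.inl l))) x l
    | Sum.inr (Sum.inr l) => code q (fun l => e (Sum.inr (Sum.inr l))) x l
  | loop f p, _, e, x, l => match l with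
    | Sum.inl _ => Stmt.branch f (Stmt.goto fun _ => e (Sum.inr (entry p))) (Stmt.goto fun _ => x)
    | Sum.inr l => code p (fun l => e (Sum.inr l)) (e (Sum.inl ())) l

/-- Machine configurations with labels in `Λ`. -/
abbrev MCfg (Λ : Type) := Turing.TM2.Cfg (fun _ : Stk => Γ') Λ (Option Γ')

/-- `M` goes from `a` to `b` in exactly `t` steps. -/
def Steps {Λ : Type} (M : Λ → Stm Λ) (t : ℕ) (a b : MCfg Λ) : Prop :=
  (flip bind (Turing.TM2.step M))^[t] (some a) = some b

theorem Steps.trans {Λ : Type} {M : Λ → Stm Λ} {s t : ℕ} {a b c : MCfg Λ}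
    (h₁ : Steps M s a b) (h₂ : Steps M t b c) : Steps M (s + t) a c := by
  unfold Steps at *
  rw [Nat.add_comm, Function.iterate_add_apply, h₁, h₂]

/-- Correctness of the compiler. The ambient label type, the embedding and the exit label are
universally quantified after the run, so that the induction can place each subprogram inside the
machine of the whole program with its own continuation. -/
theorem Runs.steps {p : Prog} {c c' : Conf} {t : ℕ} (h : Runs p c c' t) :
    ∀ {Λ : Type} (M : Λ → Stm Λ) (e : Lab p → Λ) (x : Λ), (∀ l, M (e l) = code p e x l) →
      Steps M t ⟨some (e (entry p)), c.1, c.2⟩ ⟨some x, c'.1, c'.2⟩ := by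
  induction h with
  | push k g v S =>
    intro Λ M e x hM
    simp [Steps, flip, Turing.TM2.step, hM, code]
  | pop k v S =>
    intro Λ M e x hM
    simp [Steps, flip, Turing.TM2.step, hM, code]
  | @seq p q c₁ c₂ c₃ s t _ _ ih₁ ih₂ =>
    intro Λ M e x hM
    exact (ih₁ M (fun l => e (Sum.inl l)) (e (Sum.inr (entry q))) fun l => hM (Sum.inl l)).trans
      (ih₂ M (fun l => e (Sum.inr l)) x fun l => hM (Sum.inr l))
  | @ite_true f p q v S c t hf _ ih =>
    intro Λ M e x hM
    refine Steps.trans (b := ⟨some (e (Sum.inr (Sum.inl (entry p)))), v, S⟩) ?_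
      (ih M (fun l => e (Sum.inr (Sum.inl l))) x fun l => hM (Sum.inr (Sum.inl l)))
    have := hM (Sum.inl ())
    simp [Steps, flip, Turing.TM2.step, this, code, entry, hf]
  | @ite_false f p q v S c t hf _ ih =>
    intro Λ M e x hM
    refine Steps.trans (b := ⟨some (e (Sum.inr (Sum.inr (entry q)))), v, S⟩) ?_
      (ih M (fun l => e (Sum.inr (Sum.inr l))) x fun l => hM (Sum.inr (Sum.inr l)))
    have := hM (Sum.inl ())
    simp [Steps, flip, Turing.TM2.step, this, code, entry, hf]
  | @loop_true f p v S c₁ c₂ s t hf _ _ ih₁ ih₂ =>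
    intro Λ M e x hM
    refine Steps.trans (Steps.trans (b := ⟨some (e (Sum.inr (entry p))), v, S⟩) ?_
      (ih₁ M (fun l => e (Sum.inr l)) (e (Sum.inl ())) fun l => hM (Sum.inr l))) (ih₂ M e x hM)
    have := hM (Sum.inl ())
    simp [Steps, flip, Turing.TM2.step, this, code, entry, hf]
  | loop_false hf =>
    intro Λ M e x hM
    have := hM (Sum.inl ())
    simp [Steps, flip, Turing.TM2.step, this, code, entry, hf]

/-- The machine of a program: run it on the main stack, then clear the register and halt. -/
def machine (p : Prog) : Turing.FinTM2 where
  K := Stk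
  k₀ := Stk.main
  k₁ := Stk.main
  Γ _ := Γ'
  Λ := Option (Lab p)
  main := some (entry p)
  σ := Option Γ'
  initialState := none
  Γk₀Fin := inferInstanceAs (Fintype Γ')
  m
    | none => Turing.TM2.Stmt.load (fun _ => none) Turing.TM2.Stmt.halt
    | some l => code p some none l

/-- The stacks with given contents. -/
def stk4 (m a c r : List Γ') : Stk → List Γ'
  | Stk.main => m
  | Stk.aux => a
  | Stk.cnt => c
  | Stk.rev => r

/-- The additional step is the exit label `none`, which resets the register to its initial value and
halts. -/
theorem Runs.outputs {p : Prog} {l l' : List Γ'} {v : Option Γ'} {t : ℕ}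
    (h : Runs p (none, stk4 l [] [] []) (v, stk4 l' [] [] []) t) :
    Nonempty (Turing.TM2OutputsInTime (machine p) l (some l') (t + 1)) := by
  have h₁ := h.steps (machine p).m some none fun l => rfl
  have h₂ : Steps (machine p).m (t + 1) ⟨some (some (entry p)), none, stk4 l [] [] []⟩
      ⟨none, none, stk4 l' [] [] []⟩ := by
    refine h₁.trans ?_
    simp [Steps, flip, Turing.TM2.step, machine]
  -- The machine model describes its initial and final stacks by a case distinction on the stack
  -- index; this identifies that form with `stk4`.
  have e : ∀ (l : List Γ') (q : Option (machine p).Λ),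
      (⟨q, none, stk4 l [] [] []⟩ : MCfg (machine p).Λ) = ⟨q, none, fun k =>
        @dite (List Γ') (k = Stk.main) ((machine p).kDecidableEq k Stk.main)
          (fun h => by exact l) fun _ => []⟩ := by
    intro l q
    congr 1
    funext k
    cases k <;> simp [stk4]
  refine ⟨⟨⟨t + 1, ?_⟩, le_rfl⟩⟩
  rw [e, e] at h₂
  exact h₂

end Prog

end MixedInteger

end

noncomputable section

namespace MixedInteger

open Computability (Γ')

/-! ### Stacks of binary trees -/

/-- Binary trees, the universal data type of the programs. -/
inductive BTree
  | nil
  | cons (a b : BTree)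

namespace BTree

/-- Preorder code of a tree. -/
def code : BTree → List Γ'
  | nil => [Γ'.bit false]
  | cons a b => Γ'.bit true :: (code a ++ code b)

/-- Number of nodes and leaves. -/
def size : BTree → ℕ
  | nil => 1
  | cons a b => size a + size b + 1

theorem length_code (x : BTree) : x.code.length = x.size := by
  induction x with
  | nil => rfl
  | cons a b iha ihb => simp [code, size, iha, ihb]

theorem one_le_size (x : BTree) : 1 ≤ x.size := by cases x <;> simp [size]

end BTree

namespace Prog

@[simp] theorem stk4_main (m a c r : List Γ') : stk4 m a c r Stk.main = m := rfl
@[simp] theorem stk4_aux (m a c r : List Γ') : stk4 m a c r Stk.aux = a := rfl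
@[simp] theorem stk4_cnt (m a c r : List Γ') : stk4 m a c r Stk.cnt = c := rfl
@[simp] theorem stk4_rev (m a c r : List Γ') : stk4 m a c r Stk.rev = r := rfl

@[simp] theorem update_main (m a c r l : List Γ') :
    Function.update (stk4 m a c r) Stk.main l = stk4 l a c r := by
  funext k; cases k <;> rfl
@[simp] theorem update_aux (m a c r l : List Γ') :
    Function.update (stk4 m a c r) Stk.aux l = stk4 m l c r := by
  funext k; cases k <;> rfl
@[simp] theorem update_cnt (m a c r l : List Γ') :
    Function.update (stk4 m a c r) Stk.cnt l = stk4 m a l r := by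
  funext k; cases k <;> rfl
@[simp] theorem update_rev (m a c r l : List Γ') :
    Function.update (stk4 m a c r) Stk.rev l = stk4 m a c l := by
  funext k; cases k <;> rfl

/-! ### Moving trees between stacks -/

/-- The main stack or the auxiliary stack. -/
def loc : Bool → Stk
  | true => Stk.main
  | false => Stk.aux

/-- The stacks with contents `l` of the stack `loc b` and `o` of the other one. -/
def stkAt (b : Bool) (l o c r : List Γ') : Stk → List Γ' :=
  match b with
  | true => stk4 l o c r
  | false => stk4 o l c r

theorem runs_push {k : Stk} {g : Option Γ' → Γ'} {v : Option Γ'} {S S' : Stk → List Γ'}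
    (h : Function.update S k (g v :: S k) = S') : Runs (push k g) (v, S) (v, S') 1 := by
  subst h; exact Runs.push ..

theorem runs_pop {k : Stk} {v v' : Option Γ'} {S S' : Stk → List Γ'}
    (h' : (S k).head? = v') (h : Function.update S k (S k).tail = S') :
    Runs (pop k) (v, S) (v', S') 1 := by
  subst h h'; exact Runs.pop ..

/-- Push a fixed symbol. -/
def put (k : Stk) (γ : Γ') : Prog := push k fun _ => γ

/-- Push the register. -/
def putReg (k : Stk) : Prog := push k fun v => v.getD Γ'.blank

/-- Is the register the bit `1`? -/
def isOne (v : Option Γ') : Bool := decide (v = some (Γ'.bit true))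

/-- Move a tree from the top of `loc b` to the reversal stack, by counting open subtrees. -/
def scanBody (b : Bool) : Prog :=
  seq (pop (loc b)) <| seq
    (ite isOne
      (seq (put Stk.rev (Γ'.bit true)) <| seq (put Stk.cnt Γ'.blank) (put Stk.cnt Γ'.blank))
      (put Stk.rev (Γ'.bit false)))
    (pop Stk.cnt)

/-- The register together with the counter stack is a unary count of the subtrees still to be read:
each symbol uses up one, and each `1` opens two more. The statement has continuation form (a run
after `x` extends to a run before `x`), so that the two subtrees of a node can be chained. -/
theorem runs_scan_loop {b : Bool} (x : BTree) :
    ∀ {s o c r : List Γ'} {F : Conf} {t : ℕ} (y : Γ'),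
      Runs (loop Option.isSome (scanBody b)) (c.head?, stkAt b s o c.tail (x.code.reverse ++ r)) F t →
      ∃ t' ≤ t + 7 * x.size,
        Runs (loop Option.isSome (scanBody b)) (some y, stkAt b (x.code ++ s) o c r) F t' := by
  induction x with
  | nil =>
    intro s o c r F t y h
    refine ⟨_, ?_, Runs.loop_true rfl (Runs.seq (runs_pop (v' := some (Γ'.bit false))
      (S' := stkAt b s o c r) ?_ ?_) (Runs.seq (Runs.ite_false ?_ (runs_push rfl))
        (runs_pop (v' := c.head?) (S' := stkAt b s o c.tail (Γ'.bit false :: r)) ?_ ?_))) h⟩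
    · simp [BTree.size]; omega
    · cases b <;> simp [loc, stkAt, BTree.code]
    · cases b <;> simp [loc, stkAt, BTree.code]
    · simp [isOne]
    · cases b <;> simp [stkAt]
    · cases b <;> simp [stkAt]
  | cons x₁ x₂ ih₁ ih₂ =>
    intro s o c r F t y h
    obtain ⟨t₂, ht₂, h₂⟩ := ih₂ (r := x₁.code.reverse ++ (Γ'.bit true :: r)) Γ'.blank
      (by simpa [BTree.code] using h)
    obtain ⟨t₁, ht₁, h₁⟩ := ih₁ (c := Γ'.blank :: c) Γ'.blank h₂
    refine ⟨_, ?_, Runs.loop_true rfl (Runs.seq (runs_pop (v' := some (Γ'.bit true))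
      (S' := stkAt b (x₁.code ++ (x₂.code ++ s)) o c r) ?_ ?_) (Runs.seq (Runs.ite_true ?_
        (Runs.seq (runs_push rfl) (Runs.seq (runs_push rfl) (runs_push rfl))))
        (runs_pop ?_ ?_))) h₁⟩
    · simp only [BTree.size]; omega
    · cases b <;> simp [loc, stkAt, BTree.code]
    · cases b <;> simp [loc, stkAt, BTree.code]
    · simp [isOne]
    · cases b <;> simp [stkAt]
    · cases b <;> simp [stkAt]

/-- Empty the reversal stack onto the chosen ones of the main and the auxiliary stack. -/
def spillBody (p q : Bool) : Prog :=
  seq (seq (putReg Stk.main) (putReg Stk.aux)) <|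
    match p, q with
    | true, true => pop Stk.rev
    | true, false => seq (pop Stk.aux) (pop Stk.rev)
    | false, true => seq (pop Stk.main) (pop Stk.rev)
    | false, false => seq (pop Stk.main) (seq (pop Stk.aux) (pop Stk.rev))

/-- Each symbol is pushed on both targets and popped again from the unwanted ones. Reading reversed
the tree once; this second reversal restores its order. -/
theorem runs_spill_loop (p q : Bool) (r : List Γ') :
    ∀ m a : List Γ', ∃ t ≤ 6 * r.length + 1,
      Runs (loop Option.isSome (spillBody p q)) (r.head?, stk4 m a [] r.tail)
        (none, stk4 (if p then r.reverse ++ m else m) (if q then r.reverse ++ a else a) [] []) t := by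
  induction r with
  | nil =>
    intro m a
    refine ⟨1, by simp, ?_⟩
    cases p <;> cases q <;> exact Runs.loop_false rfl
  | cons γ r ih =>
    intro m a
    obtain ⟨t, ht, h⟩ := ih (if p then γ :: m else m) (if q then γ :: a else a)
    have hb : ∃ s ≤ 5, Runs (spillBody p q) (some γ, stk4 m a [] r)
        (r.head?, stk4 (if p then γ :: m else m) (if q then γ :: a else a) [] r.tail) s := by
      have h₀ : Runs (seq (putReg Stk.main) (putReg Stk.aux)) (some γ, stk4 m a [] r)
          (some γ, stk4 (γ :: m) (γ :: a) [] r) 2 :=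
        Runs.seq (runs_push (S' := stk4 (γ :: m) a [] r) (by simp)) (runs_push (by simp))
      have h₁ := fun m a => runs_pop (k := Stk.main) (v := some γ) (S := stk4 (γ :: m) a [] r)
        rfl (update_main ..)
      have h₂ := fun m a => runs_pop (k := Stk.aux) (v := some γ) (S := stk4 m (γ :: a) [] r)
        rfl (update_aux ..)
      have h₃ := fun m a => runs_pop (k := Stk.rev) (v := some γ) (S := stk4 m a [] r)
        rfl (update_rev ..)
      cases p <;> cases q
      · exact ⟨_, le_rfl, h₀.seq ((h₁ _ _).seq ((h₂ _ _).seq (h₃ _ _)))⟩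
      · exact ⟨_, by norm_num, h₀.seq ((h₁ _ _).seq (h₃ _ _))⟩
      · exact ⟨_, by norm_num, h₀.seq ((h₂ _ _).seq (h₃ _ _))⟩
      · exact ⟨_, by norm_num, h₀.seq (h₃ _ _)⟩
    obtain ⟨s, hs, hb⟩ := hb
    refine ⟨1 + s + t, by simp; omega, Runs.loop_true rfl hb ?_⟩
    convert h using 3
    · cases p <;> simp
    · cases q <;> simp

/-- The program `p` leads from contents `m`, `a` of the main and the auxiliary stack to `m'`, `a'`
within `t` steps, the other two stacks being empty. -/
def Exec (p : Prog) (m a m' a' : List Γ') (t : ℕ) : Prop :=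
  ∀ v, ∃ v', ∃ t' ≤ t, Runs p (v, stk4 m a [] []) (v', stk4 m' a' [] []) t'

theorem Exec.seq {p q : Prog} {m a m' a' m'' a'' : List Γ'} {s t : ℕ} (h₁ : Exec p m a m' a' s)
    (h₂ : Exec q m' a' m'' a'' t) : Exec (seq p q) m a m'' a'' (s + t) := by
  intro v
  obtain ⟨v', s', hs, h₁⟩ := h₁ v
  obtain ⟨v'', t', ht, h₂⟩ := h₂ v'
  exact ⟨v'', s' + t', by omega, Runs.seq h₁ h₂⟩

theorem Exec.mono {p : Prog} {m a m' a' : List Γ'} {s t : ℕ} (h : Exec p m a m' a' s)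
    (hst : s ≤ t) : Exec p m a m' a' t := by
  intro v
  obtain ⟨v', s', hs, h⟩ := h v
  exact ⟨v', s', hs.trans hst, h⟩

/-- Move the tree on top of `loc b` to the chosen ones of the main and the auxiliary stack. -/
def transfer (b p q : Bool) : Prog :=
  seq (seq (put Stk.cnt Γ'.blank) (seq (pop Stk.cnt) (loop Option.isSome (scanBody b))))
    (seq (pop Stk.rev) (loop Option.isSome (spillBody p q)))

theorem exec_transfer (b p q : Bool) (x : BTree) (m a : List Γ') :
    Exec (transfer b p q) (if b then x.code ++ m else m) (if b then a else x.code ++ a)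
      (if p then x.code ++ m else m) (if q then x.code ++ a else a) (20 * x.size) := by
  intro v
  obtain ⟨t₁, ht₁, h₁⟩ := runs_scan_loop (b := b) x (s := if b then m else a)
    (o := if b then a else m) (c := []) (r := []) Γ'.blank (Runs.loop_false rfl)
  obtain ⟨t₂, ht₂, h₂⟩ := runs_spill_loop p q x.code.reverse m a
  refine ⟨none, 1 + (1 + t₁) + (1 + t₂), ?_,
    Runs.seq (c₂ := (none, stk4 m a [] x.code.reverse))
      (Runs.seq (runs_push rfl) (Runs.seq (runs_pop rfl rfl) ?_))
      (Runs.seq (runs_pop (v' := x.code.reverse.head?) (S' := stk4 m a [] x.code.reverse.tail)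
        (by simp) (by simp)) ?_)⟩
  · simp only [BTree.length_code, List.length_reverse] at ht₂
    have := x.one_le_size
    omega
  · cases b <;> simpa [stkAt] using h₁
  · simpa using h₂

/-- Move a tree from the main stack to the auxiliary stack. -/
def stash : Prog := transfer true false true

/-- Move a tree from the auxiliary stack to the main stack. -/
def fetch : Prog := transfer false true false

/-- Copy a tree from the main stack to the auxiliary stack. -/
def save : Prog := transfer true true true

/-- Delete a tree from the main stack. -/
def drop : Prog := transfer true false false

theorem exec_stash (x : BTree) (m a : List Γ') :
    Exec stash (x.code ++ m) a m (x.code ++ a) (20 * x.size) :=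
  exec_transfer true false true x m a

theorem exec_fetch (x : BTree) (m a : List Γ') :
    Exec fetch m (x.code ++ a) (x.code ++ m) a (20 * x.size) :=
  exec_transfer false true false x m a

theorem exec_save (x : BTree) (m a : List Γ') :
    Exec save (x.code ++ m) a (x.code ++ m) (x.code ++ a) (20 * x.size) :=
  exec_transfer true true true x m a

theorem exec_drop (x : BTree) (m a : List Γ') :
    Exec drop (x.code ++ m) a m a (20 * x.size) :=
  exec_transfer true false false x m a

theorem exec_put (γ : Γ') (m a : List Γ') : Exec (put Stk.main γ) m a (γ :: m) a 1 :=
  fun v => ⟨v, 1, le_rfl, runs_push (by simp)⟩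

theorem exec_pop (γ : Γ') (m a : List Γ') : Exec (pop Stk.main) (γ :: m) a m a 1 :=
  fun v => ⟨some γ, 1, le_rfl, runs_pop (by simp) (by simp)⟩

/-- The program doing nothing. -/
def skip : Prog := seq (put Stk.main Γ'.blank) (pop Stk.main)

theorem exec_skip (m a : List Γ') : Exec skip m a m a 2 :=
  Exec.seq (exec_put _ m a) (exec_pop _ m a)

/-- Pop the constructor of the tree on the main stack and branch on it. -/
def caseTop (p q : Prog) : Prog := seq (pop Stk.main) (ite isOne p q)

theorem exec_caseTop_cons {p q : Prog} {m a m' a' : List Γ'} {t : ℕ} (h : Exec p m a m' a' t) :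
    Exec (caseTop p q) (Γ'.bit true :: m) a m' a' (2 + t) := by
  intro v
  obtain ⟨v', t', ht, h⟩ := h (some (Γ'.bit true))
  exact ⟨v', 1 + (1 + t'), by omega, Runs.seq (runs_pop (by simp) (by simp))
    (Runs.ite_true (by simp [isOne]) h)⟩

theorem exec_caseTop_nil {p q : Prog} {m a m' a' : List Γ'} {t : ℕ} (h : Exec q m a m' a' t) :
    Exec (caseTop p q) (Γ'.bit false :: m) a m' a' (2 + t) := by
  intro v
  obtain ⟨v', t', ht, h⟩ := h (some (Γ'.bit false))
  exact ⟨v', 1 + (1 + t'), by omega, Runs.seq (runs_pop (by simp) (by simp))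
    (Runs.ite_false (by simp [isOne]) h)⟩

/-- Pop constructors from the main stack, executing `p` after each `1`, until a `0` appears. -/
def whileCons (p : Prog) : Prog :=
  seq (pop Stk.main) (loop isOne (seq p (pop Stk.main)))

theorem exec_whileCons_nil (p : Prog) (m a : List Γ') :
    Exec (whileCons p) (Γ'.bit false :: m) a m a 2 := fun v =>
  ⟨some (Γ'.bit false), 2, le_rfl, Runs.seq (runs_pop (by simp) (by simp))
    (Runs.loop_false (by simp [isOne]))⟩

theorem exec_whileCons_cons {p : Prog} {m a m' a' m'' a'' : List Γ'} {s t : ℕ}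
    (h₁ : Exec p m a m' a' s) (h₂ : Exec (whileCons p) m' a' m'' a'' t) :
    Exec (whileCons p) (Γ'.bit true :: m) a m'' a'' (2 + s + t) := by
  intro v
  obtain ⟨v', s', hs, h₁⟩ := h₁ (some (Γ'.bit true))
  obtain ⟨v'', t', ht, h₂⟩ := h₂ v'
  -- Inversion of the remaining run: its opening `pop` is reused as the `pop` that ends the current
  -- loop body.
  rw [whileCons] at h₂
  cases h₂ with
  | @seq _ _ _ c _ t₁ t₂ h₃ h₄ =>
    refine ⟨v'', 1 + (1 + (s' + t₁) + t₂), by omega, Runs.seq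
      (runs_pop (v' := some (Γ'.bit true)) (by simp) rfl)
      (Runs.loop_true (by simp [isOne]) (Runs.seq ?_ h₃) h₄)⟩
    simpa using h₁

end Prog

end MixedInteger

end

noncomputable section

namespace MixedInteger

open Computability (Γ')
open Prog

/-! ### Functions computable in polynomial time on data encoded by binary trees -/

/-- Types whose elements are encoded by binary trees. -/
class Enc (α : Type) where
  /-- the encoding -/
  toTree : α → BTree

/-- The encoding of a value by a tree. -/
abbrev enc {α : Type} [Enc α] (x : α) : BTree := Enc.toTree x

/-- The size of the encoding. -/
def sz {α : Type} [Enc α] (x : α) : ℕ := (enc x).size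

instance : Enc BTree := ⟨id⟩
instance : Enc Unit := ⟨fun _ => BTree.nil⟩
instance : Enc Bool := ⟨fun b => if b then BTree.cons (BTree.cons BTree.nil BTree.nil) BTree.nil
  else BTree.cons BTree.nil (BTree.cons BTree.nil BTree.nil)⟩
instance {α β : Type} [Enc α] [Enc β] : Enc (α × β) := ⟨fun x => BTree.cons (enc x.1) (enc x.2)⟩
instance {α : Type} [Enc α] : Enc (List α) := ⟨List.foldr (fun a t => BTree.cons (enc a) t) BTree.nil⟩

variable {α β γ δ σ : Type} [Enc α] [Enc β] [Enc γ] [Enc δ] [Enc σ]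

theorem enc_pair (x : α × β) : enc x = BTree.cons (enc x.1) (enc x.2) := rfl
theorem enc_nil : enc ([] : List α) = BTree.nil := rfl
theorem enc_cons (a : α) (l : List α) : enc (a :: l) = BTree.cons (enc a) (enc l) := rfl

theorem sz_pair (x : α × β) : sz x = sz x.1 + sz x.2 + 1 := rfl
theorem sz_mk (a : α) (b : β) : sz (a, b) = sz a + sz b + 1 := rfl
@[simp] theorem sz_nil : sz ([] : List α) = 1 := rfl
@[simp] theorem sz_cons (a : α) (l : List α) : sz (a :: l) = sz a + sz l + 1 := rfl
theorem one_le_sz (x : α) : 1 ≤ sz x := BTree.one_le_size _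

theorem sz_bool (b : Bool) : sz b = 5 := by cases b <;> decide

theorem length_le_sz (l : List α) : l.length ≤ sz l := by
  induction l with
  | nil => simp
  | cons a l ih => simp; omega

theorem sz_le_of_mem {l : List α} {a : α} (h : a ∈ l) : sz a ≤ sz l := by
  induction l with
  | nil => simp at h
  | cons b l ih =>
    rcases List.mem_cons.1 h with rfl | h
    · simp; omega
    · have := ih h; simp; omega

theorem sz_append (l l' : List α) : sz (l ++ l') + 1 = sz l + sz l' := by
  induction l with
  | nil => simp; omega
  | cons b l ih => simp; omega

theorem sz_list_le {l : List α} {B : ℕ} (h : ∀ a ∈ l, sz a ≤ B) : sz l ≤ l.length * (B + 1) + 1 := by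
  induction l with
  | nil => simp
  | cons a l ih =>
    have h₁ := h a (by simp)
    have h₂ := ih fun b hb => h b (by simp [hb])
    simp only [sz_cons, List.length_cons, add_mul, one_mul]
    omega

theorem eval_mono (p : Polynomial ℕ) : Monotone fun n => p.eval n := by
  intro m n h
  simp only [Polynomial.eval_eq_sum, Polynomial.sum_def]
  exact Finset.sum_le_sum fun i _ => Nat.mul_le_mul_left _ (Nat.pow_le_pow_left h i)

/-- `f` is computed in polynomial time by a program acting on the top of the main stack, and the
size of its values is polynomially bounded. -/
@[fun_prop]
def PT (f : α → β) : Prop :=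
  ∃ (p : Prog) (q : Polynomial ℕ), ∀ x, sz (f x) ≤ q.eval (sz x) ∧
    ∀ m a, Exec p ((enc x).code ++ m) a ((enc (f x)).code ++ m) a (q.eval (sz x))

namespace PT

theorem sz_le {f : α → β} (h : PT f) : ∃ q : Polynomial ℕ, ∀ x, sz (f x) ≤ q.eval (sz x) := by
  obtain ⟨p, q, h⟩ := h
  exact ⟨q, fun x => (h x).1⟩

/-- `PT` depends only on the trees of the values. This allows both the replacement of a function by
an equal one and the reinterpretation of a tree at another type. -/
theorem of_enc_eq {f : α → β} {g : α → γ} (hf : PT f) (h : ∀ x, enc (g x) = enc (f x)) : PT g := by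
  obtain ⟨p, q, hp⟩ := hf
  refine ⟨p, q, fun x => ?_⟩
  rw [sz, h x]
  exact hp x

@[fun_prop]
theorem id : PT (fun x : α => x) :=
  ⟨skip, Polynomial.X + 2, fun x => by
    simp only [Polynomial.eval_add, Polynomial.eval_X, Polynomial.eval_ofNat]
    exact ⟨by omega, fun m a => (exec_skip _ _).mono (by omega)⟩⟩

/-- A function which does not change the encoding. -/
theorem cast {f : α → β} (h : ∀ x, enc (f x) = enc x) : PT f := of_enc_eq id h

-- The size bound inside `PT` is needed here: the running time of the outer program is evaluated at
-- the size of the inner value.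
@[fun_prop]
theorem comp {f : β → γ} {g : α → β} (hf : PT f) (hg : PT g) : PT (fun x => f (g x)) := by
  obtain ⟨p, q, hf⟩ := hf
  obtain ⟨p', q', hg⟩ := hg
  refine ⟨seq p' p, q' + q.comp q', fun x => ?_⟩
  simp only [Polynomial.eval_add, Polynomial.eval_comp]
  have h := eval_mono q (hg x).1
  simp only at h
  refine ⟨?_, fun m a => ?_⟩
  · have := (hf (g x)).1
    omega
  · exact (((hg x).2 m a).seq ((hf (g x)).2 m a)).mono (by omega)

/-- Write a fixed tree. -/
def build : BTree → Prog
  | BTree.nil => put Stk.main (Γ'.bit false)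
  | BTree.cons a b => seq (build b) (seq (build a) (put Stk.main (Γ'.bit true)))

theorem exec_build (x : BTree) : ∀ m a, Exec (build x) m a (x.code ++ m) a x.size := by
  induction x with
  | nil => exact fun m a => exec_put _ _ _
  | cons x y ihx ihy =>
    intro m a
    refine Exec.mono ((ihy m a).seq ((ihx _ a).seq ?_)) (t := y.size + (x.size + 1)) le_rfl |>.mono ?_
    · simpa [BTree.code] using exec_put _ _ _
    · simp only [BTree.size]; omega

@[fun_prop]
theorem const (c : β) : PT (fun _ : α => c) := by
  refine ⟨seq drop (build (enc c)), 20 * Polynomial.X + Polynomial.C (sz c), fun x => ?_⟩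
  simp only [Polynomial.eval_add, Polynomial.eval_mul, Polynomial.eval_X, Polynomial.eval_C,
    Polynomial.eval_ofNat]
  exact ⟨by omega, fun m a => (exec_drop _ m a).seq (exec_build _ _ _)⟩

@[fun_prop]
theorem prodMk {f : α → β} {g : α → γ} (hf : PT f) (hg : PT g) : PT (fun x => (f x, g x)) := by
  obtain ⟨p, q, hf⟩ := hf
  obtain ⟨p', q', hg⟩ := hg
  refine ⟨seq save (seq p' (seq fetch (seq p (put Stk.main (Γ'.bit true))))),
    40 * Polynomial.X + q + q' + 1, fun x => ?_⟩
  simp only [Polynomial.eval_add, Polynomial.eval_mul, Polynomial.eval_X, Polynomial.eval_one,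
    Polynomial.eval_ofNat]
  refine ⟨?_, fun m a => ?_⟩
  · have h₁ := (hf x).1
    have h₂ := (hg x).1
    rw [sz_mk]
    omega
  · have h := (exec_save (enc x) m a).seq (((hg x).2 _ _).seq ((exec_fetch (enc x) _ a).seq
      (((hf x).2 _ _).seq (exec_put (Γ'.bit true) _ _))))
    rw [enc_pair]
    simp only [BTree.code, List.cons_append, List.append_assoc]
    refine h.mono ?_
    have : (enc x).size = sz x := rfl
    omega

theorem fst' : PT (fun x : α × β => x.1) := by
  refine ⟨seq (pop Stk.main) (seq stash (seq drop fetch)), 60 * Polynomial.X + 1, fun x => ?_⟩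
  simp only [Polynomial.eval_add, Polynomial.eval_mul, Polynomial.eval_X, Polynomial.eval_one,
    Polynomial.eval_ofNat]
  rw [sz_pair]
  refine ⟨by omega, fun m a => ?_⟩
  rw [enc_pair]
  simp only [BTree.code, List.cons_append, List.append_assoc]
  refine ((exec_pop _ _ _).seq ((exec_stash _ _ _).seq ((exec_drop _ _ _).seq
    (exec_fetch _ _ _)))).mono ?_
  simp only [sz]
  omega

theorem snd' : PT (fun x : α × β => x.2) := by
  refine ⟨seq (pop Stk.main) drop, 20 * Polynomial.X + 1, fun x => ?_⟩
  simp only [Polynomial.eval_add, Polynomial.eval_mul, Polynomial.eval_X, Polynomial.eval_one,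
    Polynomial.eval_ofNat]
  rw [sz_pair]
  refine ⟨by omega, fun m a => ?_⟩
  rw [enc_pair]
  simp only [BTree.code, List.cons_append, List.append_assoc]
  refine ((exec_pop _ _ _).seq (exec_drop _ _ _)).mono ?_
  simp only [sz]
  omega

@[fun_prop]
theorem fst {f : α → β × γ} (hf : PT f) : PT (fun x => (f x).1) := comp fst' hf

@[fun_prop]
theorem snd {f : α → β × γ} (hf : PT f) : PT (fun x => (f x).2) := comp snd' hf

@[fun_prop]
theorem cond {c : α → Bool} {f g : α → β} (hc : PT c) (hf : PT f) (hg : PT g) :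
    PT (fun x => bif c x then f x else g x) := by
  obtain ⟨p, q, hc⟩ := hc
  obtain ⟨p₁, q₁, hf⟩ := hf
  obtain ⟨p₂, q₂, hg⟩ := hg
  -- The codes of `true` and `false` are 11000 and 10100. The first symbol is dropped, the second
  -- decides, and three more remain to be discarded in either case.
  let pop3 := seq (pop Stk.main) (seq (pop Stk.main) (pop Stk.main))
  refine ⟨seq save (seq p (seq (pop Stk.main) (caseTop (seq pop3 (seq fetch p₁))
    (seq pop3 (seq fetch p₂))))), 40 * Polynomial.X + q + q₁ + q₂ + 6, fun x => ?_⟩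
  simp only [Polynomial.eval_add, Polynomial.eval_mul, Polynomial.eval_X, Polynomial.eval_ofNat]
  have e : (enc x).size = sz x := rfl
  have h₀ := fun m a => (exec_save (enc x) m a).seq ((hc x).2 m _)
  have hp : ∀ (γ₁ γ₂ γ₃ : Γ') (m a : List Γ'), Exec pop3 (γ₁ :: γ₂ :: γ₃ :: m) a m a 3 :=
    fun γ₁ γ₂ γ₃ m a => (exec_pop _ _ _).seq ((exec_pop _ _ _).seq (exec_pop _ _ _))
  cases hcx : c x
  · refine ⟨?_, fun m a => ?_⟩
    · have := (hg x).1
      simp only [cond_false]; omega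
    · refine (Exec.seq (exec_save (enc x) m a) (((hc x).2 m _).seq ?_)).mono (t :=
        20 * (enc x).size + (q.eval (sz x) + (1 + (2 + (3 + (20 * (enc x).size +
          q₂.eval (sz x))))))) le_rfl |>.mono (by omega)
      rw [hcx]
      exact (exec_pop _ _ _).seq (exec_caseTop_nil ((hp _ _ _ _ _).seq
        ((exec_fetch (enc x) _ a).seq ((hg x).2 _ _))))
  · refine ⟨?_, fun m a => ?_⟩
    · have := (hf x).1
      simp only [cond_true]; omega
    · refine (Exec.seq (exec_save (enc x) m a) (((hc x).2 m _).seq ?_)).mono (t :=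
        20 * (enc x).size + (q.eval (sz x) + (1 + (2 + (3 + (20 * (enc x).size +
          q₁.eval (sz x))))))) le_rfl |>.mono (by omega)
      rw [hcx]
      exact (exec_pop _ _ _).seq (exec_caseTop_cons ((hp _ _ _ _ _).seq
        ((exec_fetch (enc x) _ a).seq ((hf x).2 _ _))))

/-- Case distinction on a list. -/
def _root_.MixedInteger.listCase {α β : Type} (l : List α) (u : β) (g : α → List α → β) : β :=
  match l with
  | [] => u
  | a :: t => g a t

/-- Nodes of lists and of pairs have the same code. Once the constructor is popped, the head and the
tail on the stack become a pair by pushing one symbol, and then a triple with the saved input. -/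
theorem listCase {l : α → List β} {f : α → γ} {g : α → β → List β → γ} (hl : PT l) (hf : PT f)
    (hg : PT (fun p : α × β × List β => g p.1 p.2.1 p.2.2)) :
    PT (fun x => listCase (l x) (f x) (g x)) := by
  obtain ⟨p, q, hl⟩ := hl
  obtain ⟨p₁, q₁, hf⟩ := hf
  obtain ⟨p₂, q₂, hg⟩ := hg
  refine ⟨seq save (seq p (caseTop (seq (put Stk.main (Γ'.bit true)) (seq fetch
    (seq (put Stk.main (Γ'.bit true)) p₂))) (seq fetch p₁))),
    40 * Polynomial.X + q + q₁ + q₂.comp (Polynomial.X + q + 1) + 4, fun x => ?_⟩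
  simp only [Polynomial.eval_add, Polynomial.eval_mul, Polynomial.eval_X, Polynomial.eval_ofNat,
    Polynomial.eval_comp, Polynomial.eval_one]
  have e : (enc x).size = sz x := rfl
  have hlx := (hl x).1
  cases h : l x with
  | nil =>
    refine ⟨?_, fun m a => ?_⟩
    · have := (hf x).1
      simp only [MixedInteger.listCase]; omega
    · refine (Exec.seq (exec_save (enc x) m a) (((hl x).2 m _).seq ?_)).mono (t :=
        20 * (enc x).size + (q.eval (sz x) + (2 + (20 * (enc x).size + q₁.eval (sz x))))) le_rfl
          |>.mono (by omega)
      rw [h]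
      exact exec_caseTop_nil ((exec_fetch (enc x) _ a).seq ((hf x).2 _ _))
  | cons b t =>
    have hm := eval_mono q₂ (a := sz (x, b, t)) (b := sz x + q.eval (sz x) + 1) (by
      rw [h, sz_cons] at hlx
      rw [sz_mk, sz_mk]; omega)
    simp only at hm
    refine ⟨?_, fun m a => ?_⟩
    · have := (hg (x, b, t)).1
      simp only at this
      simp only [MixedInteger.listCase]
      omega
    · have h₂ := (hg (x, b, t)).2 m a
      rw [enc_pair, enc_pair] at h₂
      simp only [BTree.code, List.cons_append, List.append_assoc] at h₂
      refine (Exec.seq (exec_save (enc x) m a) (((hl x).2 m _).seq ?_)).mono (t :=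
        20 * (enc x).size + (q.eval (sz x) + (2 + (1 + (20 * (enc x).size +
          (1 + q₂.eval (sz (x, b, t)))))))) le_rfl |>.mono (by omega)
      rw [h, enc_cons]
      simp only [BTree.code, List.cons_append, List.append_assoc]
      exact exec_caseTop_cons ((exec_put _ _ _).seq ((exec_fetch (enc x) _ a).seq
        ((exec_put _ _ _).seq h₂)))

/-! ### Folds over lists -/

/-- The body of the loop of a fold. -/
def foldBody (p : Prog) : Prog :=
  seq fetch (seq (put Stk.main (Γ'.bit true)) (seq fetch (seq save
    (seq (put Stk.main (Γ'.bit true)) (seq p stash)))))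

/-- The main stack holds the unread rest of the list; the auxiliary stack holds the state above the
parameter. Each round assembles the triple of parameter, state and entry on the main stack, keeping
a copy of the parameter. -/
theorem exec_fold {g : α → σ → β → σ} {p : Prog} {q : Polynomial ℕ}
    (hg : ∀ y : α × σ × β, sz (g y.1 y.2.1 y.2.2) ≤ q.eval (sz y) ∧
      ∀ m a, Exec p ((enc y).code ++ m) a ((enc (g y.1 y.2.1 y.2.2)).code ++ m) a (q.eval (sz y)))
    (x : α) (B N : ℕ) (m a : List Γ') :
    ∀ (l : List β) (s : σ), (∀ l', l' <+: l → sz (l'.foldl (g x) s) ≤ B) → (∀ b ∈ l, sz b ≤ N) →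
      Exec (whileCons (foldBody p)) ((enc l).code ++ m) ((enc s).code ++ ((enc x).code ++ a))
        m ((enc (l.foldl (g x) s)).code ++ ((enc x).code ++ a))
        (l.length * (4 + 40 * B + 40 * sz x + q.eval (sz x + B + N + 2)) + 2) := by
  intro l
  induction l with
  | nil =>
    intro s _ _
    exact (exec_whileCons_nil _ _ _).mono (by omega)
  | cons b l ih =>
    intro s hs hN
    have h₁ := ih (g x s b) (fun l' hl' => hs (b :: l') (by simpa using hl'))
      fun b' hb' => hN b' (by simp [hb'])
    have h₂ := (hg (x, s, b)).2 ((enc l).code ++ m) ((enc x).code ++ a)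
    simp only [enc_pair (x, s, b), enc_pair (s, b), BTree.code, List.cons_append,
      List.append_assoc] at h₂
    have hs₀ : sz s ≤ B := hs [] (by simp)
    have hs₁ : sz (g x s b) ≤ B := hs [b] (by simp)
    have hb : sz b ≤ N := hN b (by simp)
    have hq := eval_mono q (a := sz (x, s, b)) (b := sz x + B + N + 2) (by
      rw [sz_mk, sz_mk]; omega)
    simp only at hq
    have h₃ := (exec_fetch (enc s) ((enc b).code ++ ((enc l).code ++ m)) ((enc x).code ++ a)).seq
      ((exec_put (Γ'.bit true) _ _).seq ((exec_fetch (enc x) _ a).seq ((exec_save (enc x) _ a).seq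
        ((exec_put (Γ'.bit true) _ _).seq (h₂.seq (exec_stash (enc (g x s b)) _ _))))))
    have h₄ := exec_whileCons_cons h₃ h₁
    rw [enc_cons]
    simp only [BTree.code, List.cons_append, List.append_assoc, List.foldl_cons]
    refine h₄.mono ?_
    simp only [List.length_cons, add_mul, one_mul]
    have e₁ : (enc s).size = sz s := rfl
    have e₂ : (enc x).size = sz x := rfl
    have e₃ : (enc (g x s b)).size = sz (g x s b) := rfl
    omega

/-- A polynomial-time step can square the size of its argument, so its iterates need not stay
polynomial. The bound on the states at all prefixes is therefore a separate hypothesis. -/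
theorem foldl {f : α → σ} {l : α → List β} {g : α → σ → β → σ} (hf : PT f) (hl : PT l)
    (hg : PT (fun y : α × σ × β => g y.1 y.2.1 y.2.2))
    (hb : ∃ q : Polynomial ℕ, ∀ x l', l' <+: l x → sz (l'.foldl (g x) (f x)) ≤ q.eval (sz x)) :
    PT (fun x => (l x).foldl (g x) (f x)) := by
  obtain ⟨p₁, q₁, hfl⟩ := prodMk hf hl
  obtain ⟨p, q, hg⟩ := hg
  obtain ⟨r, hr⟩ := hb
  refine ⟨seq save (seq p₁ (seq (pop Stk.main) (seq stash (seq (whileCons (foldBody p))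
    (seq fetch (seq fetch drop)))))),
    60 * Polynomial.X + q₁ + 40 * r + q₁ * (4 + 40 * r + 40 * Polynomial.X +
      q.comp (Polynomial.X + r + q₁ + 2)) + 3, fun x => ?_⟩
  simp only [Polynomial.eval_add, Polynomial.eval_mul, Polynomial.eval_X, Polynomial.eval_ofNat,
    Polynomial.eval_comp]
  have h₀ := (hfl x).1
  rw [sz_mk] at h₀
  have hx := hr x (l x) (List.prefix_refl _)
  have hx₀ : sz (f x) ≤ r.eval (sz x) := hr x [] (by simp)
  refine ⟨by omega, fun m a => ?_⟩
  have h₁ := (hfl x).2 m ((enc x).code ++ a)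
  simp only [enc_pair (f x, l x), BTree.code, List.cons_append, List.append_assoc] at h₁
  have h₂ := exec_fold hg x (r.eval (sz x)) (q₁.eval (sz x)) m a (l x) (f x) (hr x)
    fun b hb => by have := sz_le_of_mem hb; omega
  refine ((exec_save (enc x) m a).seq (h₁.seq ((exec_pop _ _ _).seq ((exec_stash _ _ _).seq (h₂.seq
    ((exec_fetch _ _ _).seq ((exec_fetch _ _ _).seq (exec_drop _ _ _)))))))).mono ?_
  have e₁ : (enc (f x)).size = sz (f x) := rfl
  have e₂ : (enc x).size = sz x := rfl
  have e₃ : (enc ((l x).foldl (g x) (f x))).size = sz ((l x).foldl (g x) (f x)) := rfl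
  have hle : (l x).length ≤ q₁.eval (sz x) := (length_le_sz _).trans (by omega)
  have := Nat.mul_le_mul_right (4 + 40 * r.eval (sz x) + 40 * sz x +
    q.eval (sz x + r.eval (sz x) + q₁.eval (sz x) + 2)) hle
  omega

/-- A fold whose steps increase the size of the state by a bounded amount. -/
theorem foldl_of_growth {f : α → σ} {l : α → List β} {g : α → σ → β → σ} (hf : PT f) (hl : PT l)
    (hg : PT (fun y : α × σ × β => g y.1 y.2.1 y.2.2))
    (hb : ∃ q : Polynomial ℕ, ∀ x s, ∀ b ∈ l x, sz (g x s b) ≤ sz s + q.eval (sz x)) :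
    PT (fun x => (l x).foldl (g x) (f x)) := by
  obtain ⟨q, hq⟩ := hb
  obtain ⟨q₁, h₁⟩ := hf.sz_le
  obtain ⟨q₂, h₂⟩ := hl.sz_le
  refine foldl hf hl hg ⟨q₁ + q₂ * q, fun x l' hl' => ?_⟩
  simp only [Polynomial.eval_add, Polynomial.eval_mul]
  have key : ∀ (l' : List β) (s : σ), (∀ b ∈ l', b ∈ l x) →
      sz (l'.foldl (g x) s) ≤ sz s + l'.length * q.eval (sz x) := by
    intro l'
    induction l' with
    | nil => intro s _; simp
    | cons b l' ih =>
      intro s hs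
      have h₃ := ih (g x s b) fun b' hb' => hs b' (by simp [hb'])
      have h₄ := hq x s b (hs b (by simp))
      simp only [List.foldl_cons, List.length_cons, add_mul, one_mul]
      omega
  have h₃ := key l' (f x) fun b hb => hl'.subset hb
  have h₄ : l'.length ≤ q₂.eval (sz x) :=
    hl'.length_le.trans ((length_le_sz _).trans (h₂ x))
  have := Nat.mul_le_mul_right (q.eval (sz x)) h₄
  have := h₁ x
  omega

@[fun_prop]
theorem cons {f : α → β} {g : α → List β} (hf : PT f) (hg : PT g) : PT (fun x => f x :: g x) :=
  of_enc_eq (prodMk hf hg) fun _ => rfl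

end PT

end MixedInteger

end

noncomputable section

namespace MixedInteger

open Computability (Γ')
open Prog

/-! ### From programs on trees to machines on strings -/

/-- The symbols of the alphabet. -/
def syms : List Γ' := [Γ'.blank, Γ'.bit false, Γ'.bit true, Γ'.bra, Γ'.ket, Γ'.comma]

/-- The position of a symbol, in unary. -/
def symIdx (γ : Γ') : List Unit := List.replicate (syms.idxOf γ) ()

instance : Enc Γ' := ⟨fun γ => enc (symIdx γ)⟩

theorem mem_syms (γ : Γ') : γ ∈ syms := by
  rcases γ with _ | b | _ | _ | _
  · decide
  · cases b <;> decide
  all_goals decide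

theorem sz_sym (γ : Γ') : sz γ ≤ 11 := by
  rcases γ with _ | b | _ | _ | _
  · decide
  · cases b <;> decide
  all_goals decide

/-- The alphabet is finite and its symbols are coded in unary, so a function on it is a table lookup
by nested case distinctions. -/
theorem PT.sym {β : Type} [Enc β] (f : Γ' → β) : PT f := by
  have key : ∀ (l : List Γ') (d : β), PT fun u : List Unit => (l.map f).getD u.length d := by
    intro l
    induction l with
    | nil => intro d; simpa using PT.const d
    | cons γ l ih =>
      intro d
      have h := PT.listCase (α := List Unit) (l := fun u => u) (f := fun _ => f γ)
        (g := fun _ _ t => (l.map f).getD t.length d) PT.id (PT.const _)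
        (PT.comp (f := fun t : List Unit => (l.map f).getD t.length d)
          (g := fun p : List Unit × Unit × List Unit => p.2.2) (ih d) (by fun_prop))
      refine h.of_enc_eq fun u => ?_
      cases u <;> rfl
  have h := PT.comp (key syms (f Γ'.blank)) (g := symIdx) (PT.cast fun _ => rfl)
  refine h.of_enc_eq fun γ => ?_
  rcases γ with _ | b | _ | _ | _
  · rfl
  · cases b <;> rfl
  all_goals rfl

theorem sz_string_le (l : List Γ') : sz l ≤ 12 * l.length + 1 := by
  have := sz_list_le (l := l) (B := 11) fun γ _ => sz_sym γ
  omega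

/-- Branch on the symbol in the register. -/
def switch (P : Γ' → Prog) : List Γ' → Prog
  | [] => skip
  | γ :: l => ite (fun v => decide (v = some γ)) (P γ) (switch P l)

theorem runs_switch {P : Γ' → Prog} {γ : Γ'} {S : Stk → List Γ'} {c : Conf} {t : ℕ}
    (h : Runs (P γ) (some γ, S) c t) : ∀ l : List Γ', γ ∈ l →
      ∃ t' ≤ t + l.length, Runs (switch P l) (some γ, S) c t' := by
  intro l
  induction l with
  | nil => simp
  | cons δ l ih =>
    intro hγ
    by_cases hδ : γ = δ
    · subst hδ
      exact ⟨1 + t, by simp; omega, Runs.ite_true (by simp) h⟩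
    · obtain ⟨t', ht, h'⟩ := ih (by simpa [hδ] using hγ)
      exact ⟨1 + t', by simp; omega, Runs.ite_false (by simpa using hδ) h'⟩

/-- Pop all of `loc b` and push it on the other one of the main and the auxiliary stack. -/
def pour (b : Bool) : Prog :=
  seq (pop (loc b)) (loop Option.isSome (seq (putReg (loc !b)) (pop (loc b))))

theorem runs_pour (b : Bool) (l o : List Γ') (v : Option Γ') :
    Runs (pour b) (v, stkAt b l o [] []) (none, stkAt b [] (l.reverse ++ o) [] [])
      (3 * l.length + 2) := by
  have key : ∀ l o : List Γ', Runs (loop Option.isSome (seq (putReg (loc !b)) (pop (loc b))))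
      (l.head?, stkAt b l.tail o [] []) (none, stkAt b [] (l.reverse ++ o) [] [])
      (3 * l.length + 1) := by
    intro l
    induction l with
    | nil => exact fun o => Runs.loop_false rfl
    | cons γ l ih =>
      intro o
      have h : Runs (seq (putReg (loc !b)) (pop (loc b))) (some γ, stkAt b l o [] [])
          (l.head?, stkAt b l.tail (γ :: o) [] []) (1 + 1) :=
        Runs.seq (c₂ := (some γ, stkAt b l (γ :: o) [] []))
          (runs_push (by cases b <;> simp [loc, stkAt]))
          (runs_pop (by cases b <;> simp [loc, stkAt]) (by cases b <;> simp [loc, stkAt]))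
      have := Runs.loop_true rfl h (ih (γ :: o))
      have e : 1 + (1 + 1) + (3 * l.length + 1) = 3 * (γ :: l).length + 1 := by simp; omega
      rw [e] at this
      simpa using this
  have h : Runs (pop (loc b)) (v, stkAt b l o [] []) (l.head?, stkAt b l.tail o [] []) 1 :=
    runs_pop (by cases b <;> simp [loc, stkAt]) (by cases b <;> simp [loc, stkAt])
  have := Runs.seq h (key l o)
  rwa [show 1 + (3 * l.length + 1) = 3 * l.length + 2 by omega] at this

/-- Write the list constructor and the code of a symbol. -/
def writeSym (γ : Γ') : Prog := seq (PT.build (enc γ)) (put Stk.main (Γ'.bit true))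

/-- Replace the string on the main stack by its code. -/
def readInput : Prog :=
  seq (pour true) (seq (put Stk.main (Γ'.bit false))
    (seq (pop Stk.aux) (loop Option.isSome (seq (switch writeSym syms) (pop Stk.aux)))))

/-- Pouring the input onto the auxiliary stack exposes its last symbol first, which is the order in
which a list is built from its empty tail. -/
theorem runs_readInput (l : List Γ') (v : Option Γ') :
    ∃ t ≤ 30 * l.length + 10, Runs readInput (v, stk4 l [] [] [])
      (none, stk4 (enc l).code [] [] []) t := by
  have key : ∀ l s : List Γ', ∃ t ≤ 20 * l.length + 1,
      Runs (loop Option.isSome (seq (switch writeSym syms) (pop Stk.aux)))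
        (l.head?, stk4 (enc s).code l.tail [] [])
        (none, stk4 (enc (l.reverse ++ s)).code [] [] []) t := by
    intro l
    induction l with
    | nil => exact fun s => ⟨1, by simp, Runs.loop_false rfl⟩
    | cons γ l ih =>
      intro s
      obtain ⟨t, ht, h⟩ := ih (γ :: s)
      have h₀ : Exec (writeSym γ) (enc s).code l (enc (γ :: s)).code l 12 := by
        have := (PT.exec_build (enc γ) (enc s).code l).seq (exec_put (Γ'.bit true) _ _)
        rw [enc_cons]
        simp only [BTree.code]
        exact this.mono (by have := sz_sym γ; unfold sz at this; omega)
      obtain ⟨v, t₁, ht₁, h₁⟩ := h₀ (some γ)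
      obtain ⟨t₂, ht₂, h₂⟩ := runs_switch h₁ syms (mem_syms γ)
      have h₃ := Runs.loop_true (f := Option.isSome) rfl
        (h₂.seq (runs_pop (k := Stk.aux) rfl (update_aux ..))) h
      refine ⟨_, ?_, by simpa using h₃⟩
      have : syms.length = 6 := rfl
      simp only [List.length_cons]
      omega
  obtain ⟨t, ht, h⟩ := key l.reverse []
  have h₁ := runs_pour true l [] v
  refine ⟨3 * l.length + 2 + (1 + (1 + t)), ?_, h₁.seq (Runs.seq (c₂ := (none, stk4 (enc ([] : List Γ')).code l.reverse [] []))
    (runs_push ?_) (Runs.seq (runs_pop (v' := l.reverse.head?) rfl (update_aux ..)) ?_))⟩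
  · simp at ht; omega
  · simp [stkAt, enc_nil, BTree.code]
  · simpa using h

/-- Read the code of a symbol among the given ones and push the symbol on the auxiliary stack. -/
def readSym : List Γ' → Prog
  | [] => skip
  | γ :: l => caseTop (seq (pop Stk.main) (readSym l)) (put Stk.aux γ)

/-- The index i is coded as i copies of 10 followed by 0. Each 1 is consumed by the branch and the
following 0 by `pop`. -/
theorem exec_readSym {γ : Γ'} (m a : List Γ') : ∀ l : List Γ', γ ∈ l →
    Exec (readSym l) ((enc (List.replicate (l.idxOf γ) ())).code ++ m) a m (γ :: a)
      (3 * l.length) := by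
  intro l
  induction l with
  | nil => simp
  | cons δ l ih =>
    intro hγ
    by_cases hδ : γ = δ
    · subst hδ
      have : Exec (put Stk.aux γ) m a m (γ :: a) 1 :=
        fun v => ⟨v, 1, le_rfl, runs_push (by simp)⟩
      have := exec_caseTop_nil (p := seq (pop Stk.main) (readSym l)) this
      simpa [readSym, enc_nil, BTree.code] using this.mono (t := 3 * (l.length + 1)) (by omega)
    · have h := ih (by simpa [hδ] using hγ)
      rw [List.idxOf_cons_ne _ (Ne.symm hδ), List.replicate_succ, enc_cons]
      simp only [BTree.code, List.cons_append, List.append_assoc]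
      refine (exec_caseTop_cons ((exec_pop _ _ _).seq h)).mono ?_
      simp; omega

/-- Replace the code of a string on the main stack by the string. -/
def writeOutput : Prog := seq (whileCons (readSym syms)) (pour false)

theorem exec_writeOutput (l : List Γ') :
    Exec writeOutput (enc l).code [] l [] (30 * l.length + 10) := by
  have key : ∀ (l a : List Γ'), Exec (whileCons (readSym syms)) (enc l).code a [] (l.reverse ++ a)
      (20 * l.length + 2) := by
    intro l
    induction l with
    | nil => exact fun a => exec_whileCons_nil _ _ _
    | cons γ l ih =>
      intro a
      have h := exec_whileCons_cons (exec_readSym (enc l).code a syms (mem_syms γ)) (ih (γ :: a))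
      rw [List.reverse_cons, List.append_assoc]
      refine h.mono ?_
      have : syms.length = 6 := rfl
      simp only [List.length_cons]
      omega
  refine Exec.mono ((key l []).seq (t := 3 * l.length + 2) fun v => ⟨none, _, le_rfl, ?_⟩) (by omega)
  have := runs_pour false l.reverse [] v
  simpa [stkAt] using this

/-- The machine converts the string to a tree, runs the program and converts back. The hypothesis
`hα` makes the tree of an input carry exactly its string, so that decoding the string is part of the
work of the program. -/
theorem TM2ComputableInPolyTime_of_PT {α β : Type} [Enc α] {ea : α → List Γ'} {eb : β → List Γ'}
    {f : α → β} (hα : ∀ x, enc x = enc (ea x)) (h : PT fun x => eb (f x)) :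
    Nonempty (Turing.TM2ComputableInPolyTime ea eb f) := by
  obtain ⟨p, q, hp⟩ := h
  have hq : ∀ x, q.eval (sz x) ≤ q.eval (12 * (ea x).length + 1) := fun x =>
    eval_mono q (by
      have : sz x = sz (ea x) := congrArg BTree.size (hα x)
      rw [this]; exact sz_string_le _)
  have key : ∀ x, ∃ v, ∃ t ≤ 30 * (ea x).length + 10 + (q.eval (12 * (ea x).length + 1) +
      (30 * q.eval (12 * (ea x).length + 1) + 10)),
      Runs (seq readInput (seq p writeOutput)) (none, stk4 (ea x) [] [] [])
        (v, stk4 (eb (f x)) [] [] []) t := by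
    intro x
    have h₁ := (hp x).2 [] []
    simp only [List.append_nil] at h₁
    rw [hα x] at h₁
    have hx := (length_le_sz (eb (f x))).trans ((hp x).1.trans (hq x))
    have h₂ := (h₁.mono (hq x)).seq ((exec_writeOutput (eb (f x))).mono
      (t := 30 * q.eval (12 * (ea x).length + 1) + 10) (by omega))
    obtain ⟨s, hs, hr⟩ := runs_readInput (ea x) none
    obtain ⟨v, t, ht, h₃⟩ := h₂ none
    exact ⟨v, s + t, by omega, hr.seq h₃⟩
  choose v t ht hr using key
  refine ⟨⟨⟨machine (seq readInput (seq p writeOutput)), Equiv.refl Γ', Equiv.refl Γ'⟩,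
    30 * Polynomial.X + 21 + 31 * q.comp (12 * Polynomial.X + 1), fun x => ?_⟩⟩
  have h := (hr x).outputs
  have e : ∀ l : List Γ', List.map (Equiv.refl Γ').invFun l = l := fun l => by
    induction l with
    | nil => rfl
    | cons a l ih => rw [List.map_cons, ih]; rfl
  have h' : ∀ l l' : List Γ', l = ea x → l' = eb (f x) →
      Nonempty (Turing.TM2OutputsInTime (machine (seq readInput (seq p writeOutput)))
        l (some l') (t x + 1)) := by
    rintro _ _ rfl rfl
    exact h
  have h'' := (h' _ _ (e (ea x)) (e (eb (f x)))).some
  refine { h'' with steps_le_m := h''.steps_le_m.trans ?_ }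
  have := ht x
  simp only [Polynomial.eval_add, Polynomial.eval_mul, Polynomial.eval_X, Polynomial.eval_one,
    Polynomial.eval_ofNat, Polynomial.eval_comp]
  omega

theorem length_le_of_PT {α : Type} [Enc α] {ea : α → List Γ'} {f : α → List Γ'}
    (hα : ∀ x, enc x = enc (ea x)) (h : PT f) :
    ∃ p : Polynomial ℕ, ∀ x, (f x).length ≤ p.eval (ea x).length := by
  obtain ⟨q, hq⟩ := h.sz_le
  refine ⟨q.comp (12 * Polynomial.X + 1), fun x => (length_le_sz _).trans ((hq x).trans ?_)⟩
  simp only [Polynomial.eval_add, Polynomial.eval_mul, Polynomial.eval_X, Polynomial.eval_one,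
    Polynomial.eval_ofNat, Polynomial.eval_comp]
  refine eval_mono q ?_
  have : sz x = sz (ea x) := congrArg BTree.size (hα x)
  rw [this]; exact sz_string_le _

end MixedInteger

end

noncomputable section

namespace MixedInteger

open Computability (Γ')

variable {α β γ δ σ : Type} [Enc α] [Enc β] [Enc γ] [Enc δ] [Enc σ]

/-! ### Polynomial-time operations on lists -/

namespace PT

theorem exists_sz_mem_le {l : α → List β} (hl : PT l) :
    ∃ q : Polynomial ℕ, ∀ x, ∀ b ∈ l x, sz b ≤ q.eval (sz x) := by
  obtain ⟨q, hq⟩ := hl.sz_le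
  exact ⟨q, fun x b hb => (sz_le_of_mem hb).trans (hq x)⟩

theorem exists_sz_apply_le {l : α → List β} (hl : PT l) {h : α → β → γ}
    (hh : PT (fun y : α × β => h y.1 y.2)) :
    ∃ q : Polynomial ℕ, ∀ x, ∀ b ∈ l x, sz (h x b) ≤ q.eval (sz x) := by
  obtain ⟨q, hq⟩ := hl.exists_sz_mem_le
  obtain ⟨r, hr⟩ := hh.sz_le
  refine ⟨r.comp (Polynomial.X + q + 1), fun x b hb => ?_⟩
  simp only [Polynomial.eval_comp, Polynomial.eval_add, Polynomial.eval_X, Polynomial.eval_one]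
  refine (hr (x, b)).trans (eval_mono r ?_)
  have := hq x b hb
  rw [sz_mk]
  omega

@[fun_prop]
theorem reverse {l : α → List β} (hl : PT l) : PT (fun x => (l x).reverse) := by
  have h := foldl_of_growth (f := fun _ => ([] : List β)) (g := fun _ s b => b :: s) (const _) hl
    (by fun_prop) (by
      obtain ⟨q, hq⟩ := hl.exists_sz_mem_le
      refine ⟨q + 1, fun x s b hb => ?_⟩
      have := hq x b hb
      simp
      omega)
  simpa using h

theorem foldr_of_growth {f : α → σ} {l : α → List β} {g : α → β → σ → σ} (hf : PT f) (hl : PT l)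
    (hg : PT (fun y : α × σ × β => g y.1 y.2.2 y.2.1))
    (hb : ∃ q : Polynomial ℕ, ∀ x s, ∀ b ∈ l x, sz (g x b s) ≤ sz s + q.eval (sz x)) :
    PT (fun x => (l x).foldr (g x) (f x)) := by
  have h := foldl_of_growth (g := fun x s b => g x b s) hf hl.reverse hg (by
    obtain ⟨q, hq⟩ := hb
    exact ⟨q, fun x s b hb => hq x s b (by simpa using hb)⟩)
  simpa using h

@[fun_prop]
theorem append {l l' : α → List β} (hl : PT l) (hl' : PT l') : PT (fun x => l x ++ l' x) := by
  have h := foldr_of_growth (g := fun _ b s => b :: s) hl' hl (by fun_prop) (by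
      obtain ⟨q, hq⟩ := hl.exists_sz_mem_le
      refine ⟨q + 1, fun x s b hb => ?_⟩
      have := hq x b hb
      simp
      omega)
  simpa using h

theorem map {l : α → List β} {h : α → β → γ} (hl : PT l) (hh : PT (fun y : α × β => h y.1 y.2)) :
    PT (fun x => (l x).map (h x)) := by
  have h := foldr_of_growth (f := fun _ => ([] : List γ)) (g := fun x b s => h x b :: s) (const _) hl
    (PT.cons (PT.comp (f := fun y : α × β => h y.1 y.2) (g := fun y : α × List γ × β => (y.1, y.2.2))
      hh (by fun_prop)) (by fun_prop)) (by
      obtain ⟨q, hq⟩ := hl.exists_sz_apply_le hh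
      refine ⟨q + 1, fun x s b hb => ?_⟩
      have := hq x b hb
      simp
      omega)
  refine h.of_enc_eq fun x => ?_
  rw [List.map_eq_foldr]

theorem flatMap {l : α → List β} {h : α → β → List γ} (hl : PT l)
    (hh : PT (fun y : α × β => h y.1 y.2)) : PT (fun x => (l x).flatMap (h x)) := by
  have h := foldr_of_growth (f := fun _ => ([] : List γ)) (g := fun x b s => h x b ++ s) (const _) hl
    (PT.append (PT.comp (f := fun y : α × β => h y.1 y.2)
      (g := fun y : α × List γ × β => (y.1, y.2.2)) hh (by fun_prop)) (by fun_prop)) (by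
      obtain ⟨q, hq⟩ := hl.exists_sz_apply_le hh
      refine ⟨q, fun x s b hb => ?_⟩
      have := hq x b hb
      have := sz_append (h x b) s
      omega)
  refine h.of_enc_eq fun x => ?_
  congr 1
  induction l x with
  | nil => rfl
  | cons b l ih => simp [ih]

@[fun_prop]
theorem tail {l : α → List β} (hl : PT l) : PT (fun x => (l x).tail) := by
  have h := listCase (f := fun _ => ([] : List β)) (g := fun _ _ t => t) hl (const _) (by fun_prop)
  refine h.of_enc_eq fun x => ?_
  cases l x <;> rfl

theorem headD {l : α → List β} (hl : PT l) (d : β) : PT (fun x => (l x).headD d) := by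
  have h := listCase (f := fun _ => d) (g := fun _ b _ => b) hl (const _) (by fun_prop)
  refine h.of_enc_eq fun x => ?_
  cases l x <;> rfl

@[fun_prop]
theorem isEmpty {l : α → List β} (hl : PT l) : PT (fun x => (l x).isEmpty) := by
  have h := listCase (f := fun _ => true) (g := fun _ _ _ => false) hl (const _) (const _)
  refine h.of_enc_eq fun x => ?_
  cases l x <;> rfl

@[fun_prop]
theorem zip {l : α → List β} {l' : α → List γ} (hl : PT l) (hl' : PT l') :
    PT (fun x => (l x).zip (l' x)) := by
  have h := foldl_of_growth (f := fun x => (([] : List (β × γ)), l' x))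
    (g := fun _ s b => MixedInteger.listCase s.2 s fun c t => ((b, c) :: s.1, t)) (by fun_prop) hl
    (listCase (l := fun y : α × (List (β × γ) × List γ) × β => y.2.1.2) (f := fun y => y.2.1)
      (g := fun y c t => ((y.2.2, c) :: y.2.1.1, t)) (by fun_prop) (by fun_prop) (by fun_prop)) (by
      obtain ⟨q, hq⟩ := hl.exists_sz_mem_le
      refine ⟨q + 1, fun x s b hb => ?_⟩
      have := hq x b hb
      obtain ⟨s₁, s₂⟩ := s
      cases s₂ with
      | nil => simp [MixedInteger.listCase]
      | cons c t => simp [MixedInteger.listCase, sz_mk]; omega)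
  refine h.fst.reverse.of_enc_eq fun x => ?_
  have key : ∀ (l : List β) (l' : List γ) (acc : List (β × γ)),
      (l.foldl (fun s b => MixedInteger.listCase s.2 s fun c t => ((b, c) :: s.1, t)) (acc, l')).1
        = (l.zip l').reverse ++ acc := by
    intro l
    induction l with
    | nil => intro l' acc; simp
    | cons b l ih =>
      intro l' acc
      cases l' with
      | nil => simpa [MixedInteger.listCase] using ih [] acc
      | cons c t => simpa [MixedInteger.listCase] using ih t ((b, c) :: acc)
  simp only [key, List.append_nil, List.reverse_reverse]

/-! ### Polynomial-time operations on Booleans -/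

@[fun_prop]
theorem not {f : α → Bool} (hf : PT f) : PT (fun x => !f x) := by
  refine (cond (f := fun _ => false) (g := fun _ => true) hf (const _) (const _)).of_enc_eq
    fun x => ?_
  cases f x <;> rfl

@[fun_prop]
theorem and {f g : α → Bool} (hf : PT f) (hg : PT g) : PT (fun x => f x && g x) := by
  refine (cond (g := fun _ => false) hf hg (const _)).of_enc_eq fun x => ?_
  cases f x <;> rfl

@[fun_prop]
theorem or {f g : α → Bool} (hf : PT f) (hg : PT g) : PT (fun x => f x || g x) := by
  refine (cond (f := fun _ => true) hf (const _) hg).of_enc_eq fun x => ?_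
  cases f x <;> rfl

@[fun_prop]
theorem xor {f g : α → Bool} (hf : PT f) (hg : PT g) : PT (fun x => f x ^^ g x) := by
  refine (cond (f := fun x => !g x) hf hg.not hg).of_enc_eq fun x => ?_
  cases f x <;> simp

end PT

/-! ### Polynomial-time arithmetic -/

instance : Enc ℕ := ⟨fun n => enc n.bits⟩

theorem bits_eq (n : ℕ) : n.bits = if n = 0 then [] else n.bodd :: n.div2.bits := by
  split_ifs with h
  · simp [h]
  · conv_lhs => rw [← Nat.bit_bodd_div2 n]
    refine Nat.bits_append_bit _ _ fun h' => ?_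
    by_contra hb
    rw [← Nat.bit_bodd_div2 n, h'] at h
    simp [hb] at h

theorem sz_nat (n : ℕ) : sz n = 6 * n.size + 1 := by
  have : ∀ l : List Bool, sz l = 6 * l.length + 1 := by
    intro l
    induction l with
    | nil => rfl
    | cons b l ih => simp [ih, sz_bool]; omega
  have h := this n.bits
  rw [Nat.size_eq_bits_len] at h
  exact h

namespace PT

@[fun_prop]
theorem bits {f : α → ℕ} (hf : PT f) : PT (fun x => (f x).bits) := hf.of_enc_eq fun _ => rfl

@[fun_prop]
theorem bodd {f : α → ℕ} (hf : PT f) : PT (fun x => (f x).bodd) := by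
  refine (headD hf.bits false).of_enc_eq fun x => ?_
  rw [bits_eq]
  split_ifs with h <;> simp [h]

@[fun_prop]
theorem div2 {f : α → ℕ} (hf : PT f) : PT (fun x => (f x).div2) := by
  refine (tail hf.bits).of_enc_eq fun x => ?_
  rw [bits_eq]
  split_ifs with h
  · simp [h]; rfl
  · rfl

@[fun_prop]
theorem isZero {f : α → ℕ} (hf : PT f) : PT (fun x => decide (f x = 0)) := by
  refine (isEmpty hf.bits).of_enc_eq fun x => ?_
  rw [bits_eq]
  split_ifs with h <;> simp [h]

@[fun_prop]
theorem bit {b : α → Bool} {f : α → ℕ} (hb : PT b) (hf : PT f) :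
    PT (fun x => Nat.bit (b x) (f x)) := by
  have h : PT (fun x => bif (!b x && decide (f x = 0)) then (0 : ℕ).bits else b x :: (f x).bits) :=
    by fun_prop
  refine h.of_enc_eq fun x => ?_
  by_cases h' : f x = 0 → b x = true
  · rw [show enc (Nat.bit (b x) (f x)) = enc (Nat.bit (b x) (f x)).bits from rfl,
      Nat.bits_append_bit _ _ h']
    cases hb : b x <;> simp_all
  · push Not at h'
    rw [h'.1]
    have : b x = false := by simpa using h'.2
    simp [this, Nat.bit]
    rfl

end PT

/-- The number with the given binary digits, the most significant one first. -/
def ofDigits (l : List Bool) (n : ℕ) : ℕ := l.foldl (fun n b => Nat.bit b n) n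

theorem ofDigits_reverse_bits (n : ℕ) : ofDigits n.bits.reverse 0 = n := by
  induction n using Nat.strong_induction_on with
  | _ n ih =>
    rw [bits_eq]
    split_ifs with h
    · simp [ofDigits, h]
    · have : n.div2 < n := by rw [Nat.div2_val]; omega
      have h' := ih _ this
      simp only [ofDigits, List.reverse_cons, List.foldl_append, List.foldl_cons, List.foldl_nil]
        at h' ⊢
      rw [h', Nat.bit_bodd_div2]

theorem sz_bit (b : Bool) (n : ℕ) : sz (Nat.bit b n) ≤ sz n + 6 := by
  rw [sz_nat, sz_nat]
  by_cases h : Nat.bit b n = 0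
  · simp [h]
  · rw [Nat.size_bit h]; omega

@[fun_prop]
theorem PT.ofDigits {l : α → List Bool} {f : α → ℕ} (hl : PT l) (hf : PT f) :
    PT (fun x => ofDigits (l x) (f x)) := by
  refine PT.foldl_of_growth hf hl (by fun_prop) ⟨6, fun x s b _ => ?_⟩
  simpa using sz_bit b s

/-! ### Addition and subtraction by propagation of carries -/

/-- One step of a ripple of carries: `c` is the carry, `acc` are the digits found so far. -/
def rippleStep (carry : Bool → Bool → Bool → Bool) (s : (Bool × List Bool) × ℕ × ℕ) :
    (Bool × List Bool) × ℕ × ℕ :=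
  ((carry s.1.1 s.2.1.bodd s.2.2.bodd, (s.1.1 ^^ (s.2.1.bodd ^^ s.2.2.bodd)) :: s.1.2),
    s.2.1.div2, s.2.2.div2)

/-- The final carry and the digits, the most significant one first, of a ripple. -/
def ripple (carry : Bool → Bool → Bool → Bool) (m n : ℕ) : Bool × List Bool :=
  ((m.bits ++ (n.bits ++ [false])).foldl (fun s _ => rippleStep carry s) ((false, []), m, n)).1

theorem sz_div2 (n : ℕ) : sz n.div2 ≤ sz n := by
  rw [sz_nat, sz_nat, Nat.div2_val]
  have := Nat.size_le_size (m := n / 2) (n := n) (Nat.div_le_self _ _)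
  omega

theorem PT.ripple {carry : Bool → Bool → Bool → Bool}
    (hc : PT fun y : Bool × Bool × Bool => carry y.1 y.2.1 y.2.2) {f g : α → ℕ} (hf : PT f)
    (hg : PT g) : PT (fun x => ripple carry (f x) (g x)) := by
  unfold MixedInteger.ripple
  refine PT.fst (PT.foldl_of_growth (by fun_prop) (by fun_prop) ?_ ⟨6, fun x s b _ => ?_⟩)
  · unfold rippleStep
    have : PT fun y : α × ((Bool × List Bool) × ℕ × ℕ) × Bool =>
      carry y.2.1.1.1 y.2.1.2.1.bodd y.2.1.2.2.bodd :=
      PT.comp (f := fun y : Bool × Bool × Bool => carry y.1 y.2.1 y.2.2)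
        (g := fun y : α × ((Bool × List Bool) × ℕ × ℕ) × Bool =>
          (y.2.1.1.1, y.2.1.2.1.bodd, y.2.1.2.2.bodd)) hc (by fun_prop)
    fun_prop
  · have h₁ := sz_div2 s.2.1
    have h₂ := sz_div2 s.2.2
    simp only [rippleStep, sz_pair, sz_bool, sz_cons, Polynomial.eval_ofNat]
    omega

/-- Here `val` is the value of the carry and the unread operands, and `V` that of a leading part
followed by digits. One step moves the lowest digit of `val` to the digits found, without changing
the total. -/
theorem ripple_invariant {carry : Bool → Bool → Bool → Bool} {val : Bool → ℕ → ℕ → ℤ}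
    (hv : ∀ c m n, val c m n = 2 * val (carry c m.bodd n.bodd) m.div2 n.div2 +
      (c ^^ (m.bodd ^^ n.bodd)).toNat)
    {V : List Bool → ℤ → ℤ} (hV : ∀ b l z, V (b :: l) z = V l (2 * z + b.toNat))
    (l : List Bool) (s : (Bool × List Bool) × ℕ × ℕ) :
    V (l.foldl (fun s _ => rippleStep carry s) s).1.2
      (val (l.foldl (fun s _ => rippleStep carry s) s).1.1
        (l.foldl (fun s _ => rippleStep carry s) s).2.1
        (l.foldl (fun s _ => rippleStep carry s) s).2.2) = V s.1.2 (val s.1.1 s.2.1 s.2.2) := by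
  induction l generalizing s with
  | nil => rfl
  | cons b l ih =>
    rw [List.foldl_cons, ih]
    simp only [rippleStep]
    rw [hV, ← hv]

theorem ripple_snd (carry : Bool → Bool → Bool → Bool) :
    ∀ (l : List Bool) (s : (Bool × List Bool) × ℕ × ℕ),
      (l.foldl (fun s _ => rippleStep carry s) s).2 =
        (s.2.1 / 2 ^ l.length, s.2.2 / 2 ^ l.length) := by
  intro l
  induction l with
  | nil => intro s; simp
  | cons b l ih =>
    intro s
    rw [List.foldl_cons, ih]
    simp [rippleStep, Nat.div2_val, Nat.div_div_eq_div_mul, pow_succ, mul_comm]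

/-- The integer with leading part `z` followed by the digits `l`. -/
def digitsVal (l : List Bool) (z : ℤ) : ℤ := l.foldl (fun z b => 2 * z + b.toNat) z

theorem digitsVal_natCast (l : List Bool) (n : ℕ) : digitsVal l n = ofDigits l n := by
  induction l generalizing n with
  | nil => rfl
  | cons b l ih =>
    have := ih (Nat.bit b n)
    rw [Nat.bit_val] at this
    simp only [digitsVal, ofDigits, List.foldl_cons, Nat.bit_val] at this ⊢
    push_cast at this
    exact this

/-- The list driving the fold matters only through its length, which exceeds both digit counts.
Hence both operands are exhausted and only the final carry is left as leading part. -/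
theorem ripple_spec {carry : Bool → Bool → Bool → Bool} {val : Bool → ℕ → ℕ → ℤ}
    (hv : ∀ c m n, val c m n = 2 * val (carry c m.bodd n.bodd) m.div2 n.div2 +
      (c ^^ (m.bodd ^^ n.bodd)).toNat) (m n : ℕ) :
    digitsVal (ripple carry m n).2 (val (ripple carry m n).1 0 0) = val false m n := by
  have h := ripple_invariant hv (V := digitsVal) (fun _ _ _ => rfl) (m.bits ++ (n.bits ++ [false]))
    ((false, []), m, n)
  have h₂ := ripple_snd carry (m.bits ++ (n.bits ++ [false])) ((false, []), m, n)
  have e₁ : m / 2 ^ (m.bits ++ (n.bits ++ [false])).length = 0 := by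
    refine Nat.div_eq_of_lt ((Nat.lt_size_self m).trans_le (Nat.pow_le_pow_right (by norm_num) ?_))
    simp [Nat.size_eq_bits_len]
  have e₂ : n / 2 ^ (m.bits ++ (n.bits ++ [false])).length = 0 := by
    refine Nat.div_eq_of_lt ((Nat.lt_size_self n).trans_le (Nat.pow_le_pow_right (by norm_num) ?_))
    simp [Nat.size_eq_bits_len]; omega
  simp only [e₁, e₂] at h₂
  rw [h₂] at h
  exact h

/-- The carry of an addition. -/
def addCarry (c a b : Bool) : Bool := (a && b) || (c && (a ^^ b))

/-- The borrow of a subtraction. -/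
def subCarry (c a b : Bool) : Bool := (!a && (b || c)) || (b && c)

theorem add_eq_ripple (m n : ℕ) :
    m + n = ofDigits (ripple addCarry m n).2 (bif (ripple addCarry m n).1 then 1 else 0) := by
  have h := ripple_spec (carry := addCarry) (val := fun c m n => ((m + n + c.toNat : ℕ) : ℤ)) ?_ m n
  · have e : (0 + 0 + (ripple addCarry m n).1.toNat) = bif (ripple addCarry m n).1 then 1 else 0 := by
      cases (ripple addCarry m n).1 <;> rfl
    rw [digitsVal_natCast, e] at h
    simpa using (Int.ofNat_inj.1 h).symm
  · intro c m n
    have hm := Nat.bodd_add_div2 m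
    have hn := Nat.bodd_add_div2 n
    generalize m.bodd = a at *
    generalize n.bodd = b at *
    cases a <;> cases b <;> cases c <;> simp [addCarry] at * <;> omega

theorem sub_eq_ripple (m n : ℕ) :
    ((ripple subCarry m n).1 = decide (m < n)) ∧
    m - n = bif (ripple subCarry m n).1 then 0 else ofDigits (ripple subCarry m n).2 0 := by
  have h := ripple_spec (carry := subCarry)
    (val := fun c m n => (m : ℤ) - (n : ℤ) - (c.toNat : ℤ)) ?_ m n
  · simp only [Nat.cast_zero, sub_self, zero_sub, Bool.toNat_false, sub_zero] at h
    cases hc : (ripple subCarry m n).1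
    · rw [hc] at h
      have h' := digitsVal_natCast (ripple subCarry m n).2 0
      simp only [Bool.toNat_false, Nat.cast_zero, neg_zero] at h h'
      rw [h'] at h
      simp only [cond_false]
      constructor
      · simp; omega
      · omega
    · rw [hc] at h
      -- A final borrow is the leading part -1. Since z < 0 implies 2z + 1 < 0, no digits can make
      -- the total nonnegative, and so m < n.
      have key : ∀ (l : List Bool) (z : ℤ), z < 0 → digitsVal l z < 0 := by
        intro l
        induction l with
        | nil => exact fun z hz => hz
        | cons b l ih =>
          intro z hz
          refine ih _ ?_
          cases b <;> simp <;> omega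
      have := key (ripple subCarry m n).2 (-1) (by norm_num)
      simp only [Bool.toNat_true, Nat.cast_one] at h
      rw [h] at this
      simp only [cond_true]
      constructor
      · simp; omega
      · omega
  · intro c m n
    have hm := Nat.bodd_add_div2 m
    have hn := Nat.bodd_add_div2 n
    generalize m.bodd = a at *
    generalize n.bodd = b at *
    cases a <;> cases b <;> cases c <;> simp [subCarry] at * <;> omega

namespace PT

@[fun_prop]
theorem natAdd {f g : α → ℕ} (hf : PT f) (hg : PT g) : PT (fun x => f x + g x) := by
  have h : PT fun x => MixedInteger.ripple addCarry (f x) (g x) :=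
    PT.ripple (by unfold addCarry; fun_prop) hf hg
  have h' : PT fun x => MixedInteger.ofDigits (MixedInteger.ripple addCarry (f x) (g x)).2
    (bif (MixedInteger.ripple addCarry (f x) (g x)).1 then 1 else 0) := by fun_prop
  exact h'.of_enc_eq fun x => congrArg enc (add_eq_ripple _ _)

theorem subRipple {f g : α → ℕ} (hf : PT f) (hg : PT g) :
    PT (fun x => MixedInteger.ripple subCarry (f x) (g x)) :=
  PT.ripple (by unfold subCarry; fun_prop) hf hg

@[fun_prop]
theorem natLt {f g : α → ℕ} (hf : PT f) (hg : PT g) : PT (fun x => decide (f x < g x)) :=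
  (subRipple hf hg).fst.of_enc_eq fun _ => congrArg enc (sub_eq_ripple _ _).1.symm

@[fun_prop]
theorem natSub {f g : α → ℕ} (hf : PT f) (hg : PT g) : PT (fun x => f x - g x) := by
  have h := subRipple hf hg
  have h' : PT fun x => bif (MixedInteger.ripple subCarry (f x) (g x)).1 then 0 else
    MixedInteger.ofDigits (MixedInteger.ripple subCarry (f x) (g x)).2 0 := by fun_prop
  exact h'.of_enc_eq fun x => congrArg enc (sub_eq_ripple _ _).2

end PT

theorem size_add_le (m n : ℕ) : (m + n).size ≤ m.size + n.size + 1 := by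
  rw [Nat.size_le]
  have h₁ := Nat.lt_size_self m
  have h₂ := Nat.lt_size_self n
  have h₃ : 2 ^ m.size ≤ 2 ^ (m.size + n.size) := Nat.pow_le_pow_right (by norm_num) (by omega)
  have h₄ : 2 ^ n.size ≤ 2 ^ (m.size + n.size) := Nat.pow_le_pow_right (by norm_num) (by omega)
  rw [pow_succ]
  omega

theorem sz_natAdd_le (m n : ℕ) : sz (m + n) ≤ sz m + sz n + 6 := by
  have := size_add_le m n
  rw [sz_nat, sz_nat, sz_nat]
  omega

/-- Horner's rule. Doubling the state adds only a constant to its size, so the fold falls under the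
additive growth criterion. -/
theorem mul_eq_foldr (m n : ℕ) :
    m * n = m.bits.foldr (fun b s => Nat.bit false s + bif b then n else 0) 0 := by
  induction m using Nat.strong_induction_on with
  | _ m ih =>
    rw [bits_eq]
    split_ifs with h
    · simp [h]
    · have : m.div2 < m := by rw [Nat.div2_val]; omega
      rw [List.foldr_cons, ← ih _ this, Nat.bit_val]
      conv_lhs => rw [← Nat.bodd_add_div2 m]
      cases m.bodd <;> simp <;> ring

@[fun_prop]
theorem PT.natMul {f g : α → ℕ} (hf : PT f) (hg : PT g) : PT (fun x => f x * g x) := by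
  have h := PT.foldr_of_growth (f := fun _ => 0) (l := fun x => (f x).bits)
    (g := fun x b s => Nat.bit false s + bif b then g x else 0) (PT.const _) (by fun_prop)
    (by fun_prop) (by
      obtain ⟨q, hq⟩ := hg.sz_le
      refine ⟨q + 13, fun x s b _ => ?_⟩
      have h₁ := sz_natAdd_le (Nat.bit false s) (bif b then g x else 0)
      have h₂ := sz_bit false s
      have h₃ := hq x
      have h₄ : sz (bif b then g x else 0) ≤ sz (g x) := by
        cases b
        · exact one_le_sz _
        · exact le_rfl
      simp only [Polynomial.eval_add, Polynomial.eval_ofNat]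
      omega)
  exact h.of_enc_eq fun x => congrArg enc (mul_eq_foldr _ _)

@[fun_prop]
theorem PT.length {l : α → List β} (hl : PT l) : PT (fun x => (l x).length) := by
  have h := PT.foldr_of_growth (f := fun _ => 0) (g := fun _ _ s => s + 1) (PT.const _) hl
    (by fun_prop) ⟨13, fun x s b _ => by
      have h₁ := sz_natAdd_le s 1
      have h₂ : sz 1 = 7 := by rw [sz_nat, Nat.size_one]
      rw [Polynomial.eval_ofNat]
      omega⟩
  refine h.of_enc_eq fun x => congrArg enc ?_
  induction l x with
  | nil => rfl
  | cons b l ih => rw [List.foldr_cons, ← ih, List.length_cons]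

/-! ### Integers and rationals -/

instance : Enc ℤ := ⟨fun z => enc (decide (z < 0), z.natAbs)⟩
instance : Enc ℚ := ⟨fun q => enc (q.num, q.den)⟩

/-- The integer with given sign and absolute value. -/
def ofSignAbs (s : Bool) (n : ℕ) : ℤ := bif s then -n else n

theorem ofSignAbs_natAbs (z : ℤ) : ofSignAbs (decide (z < 0)) z.natAbs = z := by
  by_cases h : z < 0 <;> simp only [ofSignAbs, h, decide_true, decide_false, cond_true, cond_false]
    <;> omega

/-- The sign of zero has to be normalized, because -0 is stored as nonnegative. -/
theorem enc_ofSignAbs (s : Bool) (n : ℕ) :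
    enc (ofSignAbs s n) = enc (s && !decide (n = 0), n) := by
  have h : ∀ z : ℤ, enc z = enc (decide (z < 0), z.natAbs) := fun _ => rfl
  rw [h]
  cases s
  · have : ¬ (n : ℤ) < 0 := by omega
    simp [ofSignAbs, this]
  · simp [ofSignAbs, Nat.pos_iff_ne_zero]

namespace PT

@[fun_prop]
theorem isNeg {f : α → ℤ} (hf : PT f) : PT (fun x => decide (f x < 0)) :=
  (PT.fst (f := fun x => (decide (f x < 0), (f x).natAbs)) (hf.of_enc_eq fun _ => rfl))

@[fun_prop]
theorem natAbs {f : α → ℤ} (hf : PT f) : PT (fun x => (f x).natAbs) :=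
  (PT.snd (f := fun x => (decide (f x < 0), (f x).natAbs)) (hf.of_enc_eq fun _ => rfl))

@[fun_prop]
theorem ofSignAbs {s : α → Bool} {n : α → ℕ} (hs : PT s) (hn : PT n) :
    PT (fun x => ofSignAbs (s x) (n x)) := by
  have h : PT fun x => (s x && !decide (n x = 0), n x) := by fun_prop
  exact h.of_enc_eq fun x => enc_ofSignAbs _ _

@[fun_prop]
theorem natCast {f : α → ℕ} (hf : PT f) : PT (fun x => (f x : ℤ)) := by
  have h : PT fun x => MixedInteger.ofSignAbs false (f x) := by fun_prop
  exact h

@[fun_prop]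
theorem intAdd {f g : α → ℤ} (hf : PT f) (hg : PT g) : PT (fun x => f x + g x) := by
  have h : PT fun x => bif decide (f x < 0) ^^ decide (g x < 0) then
      bif decide ((f x).natAbs < (g x).natAbs) then
        MixedInteger.ofSignAbs (decide (g x < 0)) ((g x).natAbs - (f x).natAbs)
      else MixedInteger.ofSignAbs (decide (f x < 0)) ((f x).natAbs - (g x).natAbs)
    else MixedInteger.ofSignAbs (decide (f x < 0)) ((f x).natAbs + (g x).natAbs) := by fun_prop
  refine h.of_enc_eq fun x => congrArg enc ?_
  by_cases h₁ : f x < 0 <;> by_cases h₂ : g x < 0 <;>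
    by_cases h₃ : (f x).natAbs < (g x).natAbs <;>
    simp only [h₁, h₂, h₃, MixedInteger.ofSignAbs, decide_true, decide_false, cond_true, cond_false,
      Bool.xor_true, Bool.xor_false, Bool.not_true, Bool.not_false] <;> omega

@[fun_prop]
theorem intMul {f g : α → ℤ} (hf : PT f) (hg : PT g) : PT (fun x => f x * g x) := by
  have h : PT fun x => MixedInteger.ofSignAbs (decide (f x < 0) ^^ decide (g x < 0))
    ((f x).natAbs * (g x).natAbs) := by fun_prop
  refine h.of_enc_eq fun x => congrArg enc ?_
  conv_lhs => rw [← ofSignAbs_natAbs (f x), ← ofSignAbs_natAbs (g x)]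
  cases decide (f x < 0) <;> cases decide (g x < 0) <;> simp [MixedInteger.ofSignAbs]

@[fun_prop]
theorem num {f : α → ℚ} (hf : PT f) : PT (fun x => (f x).num) :=
  (PT.fst (f := fun x => ((f x).num, (f x).den)) (hf.of_enc_eq fun _ => rfl))

@[fun_prop]
theorem den {f : α → ℚ} (hf : PT f) : PT (fun x => (f x).den) :=
  (PT.snd (f := fun x => ((f x).num, (f x).den)) (hf.of_enc_eq fun _ => rfl))

@[fun_prop]
theorem intCastRat {f : α → ℤ} (hf : PT f) : PT (fun x => (f x : ℚ)) := by
  have h : PT fun x => (f x, 1) := by fun_prop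
  exact h.of_enc_eq fun x => rfl

/-- Adding an integer keeps the denominator and the coprimality, so the result is already in lowest
terms and no gcd has to be computed. This is the only rational arithmetic that the algorithms use.
-/
theorem ratAddInt {f : α → ℚ} {g : α → ℤ} (hf : PT f) (hg : PT g) :
    PT (fun x => f x + (g x : ℚ)) := by
  have h : PT fun x => ((f x).num + g x * (f x).den, (f x).den) := by fun_prop
  refine h.of_enc_eq fun x => ?_
  have e : ∀ q : ℚ, enc q = enc (q.num, q.den) := fun _ => rfl
  have h₁ : ((f x).num + g x * (f x).den).natAbs.Coprime (f x).den := by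
    have := (f x).reduced
    rw [← Int.natAbs_natCast (f x).den, ← Int.isCoprime_iff_nat_coprime] at this ⊢
    exact this.add_mul_right_left _
  have h₂ : f x + (g x : ℚ) = ⟨(f x).num + g x * (f x).den, (f x).den, (f x).den_nz, h₁⟩ := by
    rw [Rat.mk_eq_divInt, Rat.divInt_eq_div]
    have := (f x).den_nz
    push_cast
    field_simp
    rw [add_mul, Rat.mul_den_eq_num]
  rw [h₂, e]

end PT

end MixedInteger

end

noncomputable section

namespace MixedInteger

open Computability (Γ')

variable {α β γ δ σ : Type} [Enc α] [Enc β] [Enc γ] [Enc δ] [Enc σ]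

/-! ### Writing and reading the encodings of the descriptions -/

theorem encNat_eq (n : ℕ) : encNat n = n.bits.map Γ'.bit := by
  have hp : ∀ p : PosNum, Computability.encodePosNum p = (p : ℕ).bits := by
    intro p
    induction p with
    | one => simp [Computability.encodePosNum]
    | bit0 p ih =>
      have h := Nat.bits_append_bit (p : ℕ) false fun h => absurd h (PosNum.cast_pos ..).ne'
      rw [Computability.encodePosNum, ih, ← h, Nat.bit_val, PosNum.cast_bit0]
      simp [two_mul]
    | bit1 p ih =>
      have h := Nat.bits_append_bit (p : ℕ) true fun _ => rfl
      rw [Computability.encodePosNum, ih, ← h, Nat.bit_val, PosNum.cast_bit1]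
      simp [two_mul]
  have hn : ∀ m : Num, Computability.encodeNum m = (m : ℕ).bits := by
    intro m
    cases m with
    | zero => simp [Computability.encodeNum]
    | pos p => exact hp p
  rw [encNat, Computability.encodeNat, hn]
  simp

namespace PT

@[fun_prop]
theorem bitSym {f : α → Bool} (hf : PT f) : PT (fun x => Γ'.bit (f x)) := by
  refine (cond (f := fun _ => Γ'.bit true) (g := fun _ => Γ'.bit false) hf (const _)
    (const _)).of_enc_eq fun x => ?_
  cases f x <;> rfl

@[fun_prop]
theorem encNat {f : α → ℕ} (hf : PT f) : PT (fun x => encNat (f x)) := by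
  simp only [encNat_eq]
  exact PT.map hf.bits (by fun_prop)

@[fun_prop]
theorem encInt {f : α → ℤ} (hf : PT f) : PT (fun x => encInt (f x)) := by
  unfold MixedInteger.encInt
  fun_prop

@[fun_prop]
theorem encRatEntry {f : α → ℚ} (hf : PT f) : PT (fun x => encRatEntry (f x)) := by
  unfold MixedInteger.encRatEntry
  fun_prop

theorem encList {l : α → List β} {e : β → List Γ'} (hl : PT l) (he : PT e) :
    PT (fun x => encList e (l x)) := by
  unfold MixedInteger.encList
  have := PT.flatMap (h := fun _ b => e b) hl (by fun_prop)
  fun_prop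

end PT

/-! ### A bracket parser and the reading of numbers -/

/-- Is the symbol an opening bracket? -/
def isBra (γ : Γ') : Bool := decide (γ = Γ'.bra)
/-- Is the symbol a closing bracket? -/
def isKet (γ : Γ') : Bool := decide (γ = Γ'.ket)
/-- Is the symbol a comma? -/
def isComma (γ : Γ') : Bool := decide (γ = Γ'.comma)
/-- The value of a bit. -/
def bitVal (γ : Γ') : Bool := decide (γ = Γ'.bit true)

@[fun_prop]
theorem PT.isBra {f : α → Γ'} (hf : PT f) : PT (fun x => isBra (f x)) := (PT.sym _).comp hf
@[fun_prop]
theorem PT.isKet {f : α → Γ'} (hf : PT f) : PT (fun x => isKet (f x)) := (PT.sym _).comp hf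
@[fun_prop]
theorem PT.isComma {f : α → Γ'} (hf : PT f) : PT (fun x => isComma (f x)) := (PT.sym _).comp hf
@[fun_prop]
theorem PT.bitVal {f : α → Γ'} (hf : PT f) : PT (fun x => bitVal (f x)) := (PT.sym _).comp hf

@[fun_prop]
theorem PT.toTree {f : α → β} (hf : PT f) : PT (fun x => Enc.toTree (f x)) :=
  hf.of_enc_eq fun _ => rfl

/-- One step of the bracket parser, which reads from the right and keeps the lists of trees of the
open brackets. -/
def parseStep (c : Γ') (st : List (List BTree)) : List (List BTree) :=
  bif isKet c then [] :: st
  else bif isBra c then listCase st st fun a t => listCase t st fun b r => (enc a :: b) :: r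
  else listCase st st fun a r => (enc c :: a) :: r

/-- The list of the trees of the symbols and bracketed parts of a string. -/
def parse (l : List Γ') : List BTree := (l.foldr parseStep [[]]).headD []

@[fun_prop]
theorem PT.parse_comp {f : α → List Γ'} (hf : PT f) : PT (fun x => parse (f x)) := by
  -- A symbol adds its tree of size at most 11 and one node, a closing bracket adds an empty list,
  -- and an opening bracket only rearranges nodes; so 13 suffices.
  refine PT.headD (PT.foldr_of_growth (f := fun _ => [[]]) (g := fun _ => parseStep) (PT.const _)
    hf ?_ ⟨13, fun x s c _ => ?_⟩) []
  · unfold parseStep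
    have h₁ : PT fun y : α × List (List BTree) × Γ' => MixedInteger.listCase y.2.1 y.2.1 fun a t =>
        MixedInteger.listCase t y.2.1 fun b r => (enc a :: b) :: r :=
      PT.listCase (g := fun y a t => MixedInteger.listCase t y.2.1 fun b r => (enc a :: b) :: r)
        (by fun_prop) (by fun_prop)
        (PT.listCase (g := fun (y : (α × List (List BTree) × Γ') × List BTree × List (List BTree)) b r =>
          (enc y.2.1 :: b) :: r) (by fun_prop) (by fun_prop) (by fun_prop))
    have h₂ : PT fun y : α × List (List BTree) × Γ' => MixedInteger.listCase y.2.1 y.2.1 fun a r =>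
        (enc y.2.2 :: a) :: r :=
      PT.listCase (g := fun (y : α × List (List BTree) × Γ') a r =>
        (enc y.2.2 :: a) :: r) (by fun_prop)
        (by fun_prop) (by fun_prop)
    fun_prop
  · have hc := sz_sym c
    have e : ∀ a : List BTree, sz (enc a) = sz a := fun _ => rfl
    have e' : sz (enc c) = sz c := rfl
    simp only [Polynomial.eval_ofNat, parseStep]
    cases MixedInteger.isKet c
    · cases MixedInteger.isBra c
      · rcases s with _ | ⟨a, s⟩
        · simp [MixedInteger.listCase]
        · simp only [cond_false, MixedInteger.listCase, sz_cons, e']; omega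
      · rcases s with _ | ⟨a, _ | ⟨b, s⟩⟩
        · simp [MixedInteger.listCase]
        · simp [MixedInteger.listCase]
        · simp only [cond_false, cond_true, MixedInteger.listCase, sz_cons, e]; omega
    · simp only [cond_true, sz_cons, sz_nil]; omega

/-- This is how the untyped output of the parser is recognized as typed data: a list of trees of
values is coded like the list of the values. -/
theorem enc_map_enc (l : List α) : enc (l.map enc) = enc l := by
  induction l with
  | nil => rfl
  | cons a l ih => rw [List.map_cons, enc_cons, ih]; rfl

/-- The string `s` is read by the parser as the list `t` of trees. -/
def Parses (s : List Γ') (t : List BTree) : Prop :=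
  ∀ a r, s.foldr parseStep (a :: r) = (t ++ a) :: r

namespace Parses

theorem parse_eq {s : List Γ'} {t : List BTree} (h : Parses s t) : parse s = t := by
  simp [parse, h [] []]

theorem nil : Parses [] [] := fun _ _ => rfl

theorem append {s s' : List Γ'} {t t' : List BTree} (h : Parses s t) (h' : Parses s' t') :
    Parses (s ++ s') (t ++ t') := by
  intro a r
  rw [List.foldr_append, h', h, List.append_assoc]

theorem node {s : List Γ'} {t : List BTree} (h : Parses s t) :
    Parses (Γ'.bra :: (s ++ [Γ'.ket])) [enc t] := by
  intro a r
  have h₁ : [Γ'.ket].foldr parseStep (a :: r) = [] :: a :: r := by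
    simp [parseStep, isKet]
  rw [List.foldr_cons, List.foldr_append, h₁, h]
  simp [parseStep, isKet, isBra, listCase]

theorem sym {c : Γ'} (h₁ : c ≠ Γ'.bra) (h₂ : c ≠ Γ'.ket) : Parses [c] [enc c] := by
  intro a r
  simp [parseStep, isKet, isBra, h₁, h₂, listCase]

theorem string {s : List Γ'} (h : ∀ c ∈ s, c ≠ Γ'.bra ∧ c ≠ Γ'.ket) : Parses s (s.map enc) := by
  induction s with
  | nil => exact nil
  | cons c s ih =>
    exact (sym (h c (by simp)).1 (h c (by simp)).2).append (ih fun c hc => h c (by simp [hc]))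

theorem flatMap {ι : Type} {l : List ι} {e : ι → List Γ'} {t : ι → List BTree}
    (h : ∀ i, Parses (e i) (t i)) : Parses (l.flatMap e) (l.flatMap t) := by
  induction l with
  | nil => exact nil
  | cons i l ih => exact (h i).append ih

theorem encList {ι : Type} {l : List ι} {e : ι → List Γ'} {t : ι → BTree}
    (h : ∀ i, Parses (e i) [t i]) : Parses (encList e l) [enc (l.map t)] := by
  have := (flatMap (l := l) h).node
  rwa [← List.map_eq_flatMap] at this

end Parses

theorem enc_map_congr {ι κ : Type} [Enc ι] [Enc κ] {ζ : Type} {f : ζ → ι} {g : ζ → κ}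
    (h : ∀ a, enc (f a) = enc (g a)) (l : List ζ) : enc (l.map f) = enc (l.map g) := by
  induction l with
  | nil => rfl
  | cons a l ih => rw [List.map_cons, List.map_cons, enc_cons, enc_cons, ih, h]

theorem encNat_noBracket (n : ℕ) : ∀ c ∈ encNat n, c ≠ Γ'.bra ∧ c ≠ Γ'.ket ∧ c ≠ Γ'.comma := by
  intro c hc
  rw [encNat_eq, List.mem_map] at hc
  obtain ⟨b, -, rfl⟩ := hc
  simp

theorem encInt_noBracket (z : ℤ) : ∀ c ∈ encInt z, c ≠ Γ'.bra ∧ c ≠ Γ'.ket ∧ c ≠ Γ'.comma := by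
  intro c hc
  rcases List.mem_cons.1 hc with rfl | hc
  · simp
  · exact encNat_noBracket _ c hc

theorem parses_encIntEntry (z : ℤ) : Parses (encIntEntry z) [enc (encInt z)] := by
  have := (Parses.string fun c hc => ⟨(encInt_noBracket z c hc).1,
    (encInt_noBracket z c hc).2.1⟩).node
  rwa [enc_map_enc] at this

/-- The symbols between the brackets of a rational entry. -/
def ratStr (q : ℚ) : List Γ' := encInt q.num ++ Γ'.comma :: encNat q.den

theorem parses_encRatEntry (q : ℚ) : Parses (encRatEntry q) [enc (ratStr q)] := by
  have h : ∀ c ∈ ratStr q, c ≠ Γ'.bra ∧ c ≠ Γ'.ket := by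
    intro c hc
    rcases List.mem_append.1 hc with hc | hc
    · exact ⟨(encInt_noBracket _ c hc).1, (encInt_noBracket _ c hc).2.1⟩
    · rcases List.mem_cons.1 hc with rfl | hc
      · simp
      · exact ⟨(encNat_noBracket _ c hc).1, (encNat_noBracket _ c hc).2.1⟩
  have := (Parses.string h).node
  rw [enc_map_enc] at this
  simpa [ratStr, encRatEntry] using this

/-- The parts of a string before and after its first comma. -/
def splitComma (s : List Γ') : List Γ' × List Γ' :=
  s.foldr (fun c st => bif isComma c then ([], st.1) else (c :: st.1, st.2)) ([], [])

/-- The natural number with the given binary digits. -/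
def readNat (s : List Γ') : ℕ := ofDigits (s.map bitVal).reverse 0

/-- The integer with the given sign bit and binary digits. -/
def readInt (s : List Γ') : ℤ := ofSignAbs (bitVal (s.headD Γ'.blank)) (readNat s.tail)

theorem readNat_encNat (n : ℕ) : readNat (encNat n) = n := by
  have : (n.bits.map Γ'.bit).map bitVal = n.bits := by
    rw [List.map_map]
    convert List.map_id _
    funext b
    cases b <;> simp [bitVal]
  rw [readNat, encNat_eq, this, ofDigits_reverse_bits]

theorem readInt_encInt (z : ℤ) : readInt (encInt z) = z := by
  simp only [readInt, encInt, List.headD_cons, List.tail_cons, readNat_encNat]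
  have : bitVal (Γ'.bit (decide (z < 0))) = decide (z < 0) := by
    cases decide (z < 0) <;> simp [bitVal]
  rw [this, ofSignAbs_natAbs]

theorem splitComma_ratStr (q : ℚ) : splitComma (ratStr q) = (encInt q.num, encNat q.den) := by
  have key : ∀ (s : List Γ') (st : List Γ' × List Γ'), (∀ c ∈ s, c ≠ Γ'.comma) →
      s.foldr (fun c st => bif isComma c then ([], st.1) else (c :: st.1, st.2)) st =
        (s ++ st.1, st.2) := by
    intro s st hs
    induction s with
    | nil => rfl
    | cons c s ih =>
      rw [List.foldr_cons, ih fun c hc => hs c (by simp [hc])]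
      have := hs c (by simp)
      simp [isComma, this]
  rw [splitComma, ratStr, List.foldr_append, List.foldr_cons,
    key _ _ fun c hc => (encNat_noBracket _ c hc).2.2,
    key _ _ fun c hc => (encInt_noBracket _ c hc).2.2]
  simp [isComma]

/-- Numerator and denominator of the rational number between the brackets of an entry. -/
def readRat (s : List Γ') : ℤ × ℕ := (readInt (splitComma s).1, readNat (splitComma s).2)

theorem readRat_ratStr (q : ℚ) : readRat (ratStr q) = (q.num, q.den) := by
  rw [readRat, splitComma_ratStr, readInt_encInt, readNat_encNat]

namespace PT

@[fun_prop]
theorem splitComma {f : α → List Γ'} (hf : PT f) : PT (fun x => splitComma (f x)) := by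
  unfold MixedInteger.splitComma
  refine PT.foldr_of_growth (f := fun _ => ([], [])) (PT.const _) hf (by fun_prop)
    ⟨12, fun x s c _ => ?_⟩
  have := sz_sym c
  simp only [Polynomial.eval_ofNat]
  cases MixedInteger.isComma c <;> simp [sz_pair] <;> omega

@[fun_prop]
theorem readNat {f : α → List Γ'} (hf : PT f) : PT (fun x => readNat (f x)) := by
  unfold MixedInteger.readNat
  have := PT.map (h := fun _ c => MixedInteger.bitVal c) hf (by fun_prop)
  fun_prop

@[fun_prop]
theorem readInt {f : α → List Γ'} (hf : PT f) : PT (fun x => readInt (f x)) := by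
  unfold MixedInteger.readInt
  have := PT.headD hf Γ'.blank
  fun_prop

@[fun_prop]
theorem readRat {f : α → List Γ'} (hf : PT f) : PT (fun x => readRat (f x)) := by
  unfold MixedInteger.readRat
  fun_prop

end PT

/-- The unary dimensions at the beginning of an encoding. -/
def dimStr (n d : ℕ) : List Γ' :=
  List.replicate n (Γ'.bit true) ++ Γ'.comma :: (List.replicate d (Γ'.bit true) ++ [Γ'.comma])

theorem parses_dimStr (n d : ℕ) : Parses (dimStr n d) ((dimStr n d).map enc) := by
  refine Parses.string fun c hc => ?_
  simp only [dimStr, List.mem_append, List.mem_cons, List.mem_replicate] at hc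
  rcases hc with ⟨_, rfl⟩ | rfl | ⟨_, rfl⟩ | rfl | hc <;> simp_all

theorem encWithDims_eq {E : ℕ → Type} (enc : ∀ k : ℕ, E k → List Γ') (n d : ℕ) (D : E (n + d)) :
    encWithDims enc n d D = dimStr n d ++ enc (n + d) D := by
  simp [encWithDims, dimStr]

/-! ### The algorithm for inner descriptions -/

/-- Inner descriptions together with their dimensions. -/
abbrev InnerInput := (p : ℕ × ℕ) × InnerDescription (p.1 + p.2)

/-- The encoding of an inner description together with its dimensions. -/
def innerStr (I : InnerInput) : List Γ' :=
  encWithDims @InnerDescription.encode I.1.1 I.1.2 I.2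

/-- An input is represented by the tree of its own string, as `TM2ComputableInPolyTime_of_PT`
requires; its components become available only through parsing. -/
instance : Enc InnerInput := ⟨fun I => enc (innerStr I)⟩

theorem PT.of_innerStr : PT innerStr := PT.cast fun _ => rfl

theorem parse_innerStr (I : InnerInput) : parse (innerStr I) = (dimStr I.1.1 I.1.2).map enc ++
    [enc (I.2.V.map fun v => enc ((List.ofFn v).map fun q => enc (ratStr q))),
      enc (I.2.W.map fun w => enc ((List.ofFn w).map fun z => enc (encInt z)))] := by
  rw [innerStr, encWithDims_eq]
  refine ((parses_dimStr _ _).append ((Parses.encList fun v => ?_).append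
    (Parses.encList fun w => ?_))).parse_eq
  · exact Parses.encList parses_encRatEntry
  · exact Parses.encList parses_encIntEntry

theorem PT.inner_dims : PT fun I : InnerInput => dimStr I.1.1 I.1.2 := by
  have h : PT fun I : InnerInput => (parse (MixedInteger.innerStr I)).reverse.tail.tail.reverse := by
    have := PT.of_innerStr
    fun_prop
  refine h.of_enc_eq fun I => ?_
  rw [parse_innerStr]
  simp only [List.reverse_append, List.reverse_cons, List.reverse_nil, List.nil_append,
    List.cons_append, List.tail_cons, List.reverse_reverse]
  exact (enc_map_enc _).symm

theorem PT.inner_V : PT fun I : InnerInput => I.2.V.map fun v => List.ofFn v := by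
  have h : PT fun I : InnerInput => (parse (innerStr I)).reverse.tail.headD BTree.nil := by
    have := PT.of_innerStr
    exact PT.headD (l := fun I : InnerInput => (parse (innerStr I)).reverse.tail) (by fun_prop) _
  have h₁ : PT fun I : InnerInput => I.2.V.map fun v => (List.ofFn v).map ratStr := by
    refine h.of_enc_eq fun I => ?_
    simp only [parse_innerStr]
    simp only [List.reverse_append, List.reverse_cons, List.reverse_nil, List.nil_append,
      List.cons_append, List.tail_cons, List.headD_cons]
    change _ = enc (I.2.V.map fun v => enc ((List.ofFn v).map fun q => enc (ratStr q)))
    exact enc_map_congr (g := fun v => enc ((List.ofFn v).map fun q => enc (ratStr q)))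
      (fun v => enc_map_congr (f := ratStr) (g := fun q => enc (ratStr q))
      (fun q => rfl) (List.ofFn v)) _
  have h₂ : PT fun I : InnerInput => (I.2.V.map fun v => (List.ofFn v).map ratStr).map fun v =>
      v.map MixedInteger.readRat :=
    PT.map (h := fun _ v => v.map MixedInteger.readRat) h₁ (PT.map (h := fun _ s => MixedInteger.readRat s) PT.snd'
      (by fun_prop))
  refine h₂.of_enc_eq fun I => ?_
  rw [List.map_map]
  refine enc_map_congr (fun v => ?_) _
  rw [Function.comp_apply, List.map_map]
  conv_lhs => rw [← List.map_id (List.ofFn v)]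
  refine enc_map_congr (fun q => ?_) _
  -- A rational has the same tree as the pair of its numerator and denominator, so reading that pair
  -- already yields the rational.
  rw [Function.comp_apply, readRat_ratStr]
  rfl

theorem PT.inner_W : PT fun I : InnerInput => I.2.W.map fun w => List.ofFn w := by
  have h : PT fun I : InnerInput => (parse (innerStr I)).reverse.headD BTree.nil := by
    have := PT.of_innerStr
    exact PT.headD (l := fun I : InnerInput => (parse (innerStr I)).reverse) (by fun_prop) _
  have h₁ : PT fun I : InnerInput => I.2.W.map fun v => (List.ofFn v).map MixedInteger.encInt := by
    refine h.of_enc_eq fun I => ?_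
    simp only [parse_innerStr]
    simp only [List.reverse_append, List.reverse_cons, List.reverse_nil, List.nil_append,
      List.cons_append, List.headD_cons]
    change _ = enc (I.2.W.map fun w => enc ((List.ofFn w).map fun z => enc (MixedInteger.encInt z)))
    exact enc_map_congr (g := fun w => enc ((List.ofFn w).map fun z =>
      enc (MixedInteger.encInt z))) (fun w => enc_map_congr (f := MixedInteger.encInt)
      (g := fun z => enc (MixedInteger.encInt z)) (fun q => rfl) (List.ofFn w)) _
  have h₂ : PT fun I : InnerInput => (I.2.W.map fun v => (List.ofFn v).map MixedInteger.encInt).map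
      fun v => v.map MixedInteger.readInt :=
    PT.map (h := fun _ v => v.map MixedInteger.readInt) h₁ (PT.map (h := fun _ s => MixedInteger.readInt s) PT.snd'
      (by fun_prop))
  refine h₂.of_enc_eq fun I => ?_
  rw [List.map_map]
  refine enc_map_congr (fun v => ?_) _
  rw [Function.comp_apply, List.map_map]
  conv_lhs => rw [← List.map_id (List.ofFn v)]
  refine enc_map_congr (fun q => ?_) _
  rw [Function.comp_apply, readInt_encInt]
  rfl

/-- The row `v + M w`. -/
def shiftRow (M : ℤ) (v : List ℚ) (w : List ℤ) : List ℚ :=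
  (v.zip w).map fun p => p.1 + ((M * p.2 : ℤ) : ℚ)

@[fun_prop]
theorem PT.shiftRow {M : α → ℤ} {v : α → List ℚ} {w : α → List ℤ} (hM : PT M) (hv : PT v)
    (hw : PT w) : PT (fun x => shiftRow (M x) (v x) (w x)) :=
  PT.map (h := fun x (p : ℚ × ℤ) => p.1 + ((M x * p.2 : ℤ) : ℚ)) (hv.zip hw)
    (PT.ratAddInt (by fun_prop) (by fun_prop))

theorem encList_encVec {k : ℕ} (l : List (Fin k → ℚ)) : encList (encVec encRatEntry) l =
    encList (encList encRatEntry) (l.map fun v => List.ofFn v) := by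
  simp only [encList, List.flatMap_map]
  rfl

/-- The points `v` and `v + |W| w`. -/
def InnerDescription.truncate {k : ℕ} (D : InnerDescription k) : VertexDescription k where
  V := D.V ++ D.V.flatMap fun v => D.W.map fun w => fun i => v i + ((D.W.length * w i : ℤ) : ℚ)

theorem PT.inner_truncate : PT fun I : InnerInput =>
    encWithDims @VertexDescription.encode I.1.1 I.1.2 I.2.truncate := by
  have hV := PT.inner_V
  have hW := PT.inner_W
  have hM : PT fun I : InnerInput => ((I.2.W.map fun w => List.ofFn w).length : ℤ) := by fun_prop
  have h₀ : PT fun y : InnerInput × List ℚ => (y.1.2.W.map fun w => List.ofFn w).map fun w =>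
      MixedInteger.shiftRow ((y.1.2.W.map fun w => List.ofFn w).length : ℤ) y.2 w :=
    PT.map (h := fun (y : InnerInput × List ℚ) w =>
      MixedInteger.shiftRow ((y.1.2.W.map fun w => List.ofFn w).length : ℤ) y.2 w)
      (hW.comp PT.fst') (PT.shiftRow (hM.comp (PT.fst PT.fst')) (by fun_prop) (by fun_prop))
  have h : PT fun I : InnerInput => (I.2.V.map fun v => List.ofFn v) ++
      (I.2.V.map fun v => List.ofFn v).flatMap fun v => (I.2.W.map fun w => List.ofFn w).map fun w =>
        MixedInteger.shiftRow ((I.2.W.map fun w => List.ofFn w).length : ℤ) v w :=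
    PT.append hV (PT.flatMap hV h₀)
  have h' := PT.append PT.inner_dims (PT.encList
    (e := MixedInteger.encList MixedInteger.encRatEntry) h
    (PT.encList PT.id (PT.encRatEntry PT.id)))
  refine h'.of_enc_eq fun I => congrArg enc ?_
  rw [encWithDims_eq]
  congr 1
  rw [VertexDescription.encode, InnerDescription.truncate]
  rw [encList_encVec]
  congr 1
  rw [List.map_append, List.map_flatMap, List.flatMap_map]
  congr 1
  congr 1
  funext v
  rw [List.map_map, List.map_map]
  refine List.map_congr_left fun w _ => ?_
  simp only [Function.comp_apply, List.length_map]
  refine List.ext_getElem (by simp [MixedInteger.shiftRow]) fun i h₁ h₂ => ?_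
  simp [MixedInteger.shiftRow]

end MixedInteger

end

noncomputable section

namespace MixedInteger

open Computability (Γ')

variable {α β γ δ σ : Type} [Enc α] [Enc β] [Enc γ] [Enc δ] [Enc σ]

/-! ### The algorithm for inequality descriptions -/

/-- Inequality descriptions together with their dimensions. -/
abbrev IneqInput := (p : ℕ × ℕ) × IneqDescription (p.1 + p.2)

/-- The encoding of an inequality description together with its dimensions. -/
def ineqStr (I : IneqInput) : List Γ' :=
  encWithDims @IneqDescription.encode I.1.1 I.1.2 I.2

instance : Enc IneqInput := ⟨fun I => enc (ineqStr I)⟩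

theorem PT.of_ineqStr : PT ineqStr := PT.cast fun _ => rfl

/-- The encodings of the rows of a system. -/
def IneqDescription.rowsStr {k : ℕ} (D : IneqDescription k) : List Γ' :=
  (List.finRange D.m).flatMap fun i => encVec encRatEntry (D.A i) ++ encRatEntry (D.b i)

theorem ineqStr_eq (I : IneqInput) :
    ineqStr I = dimStr I.1.1 I.1.2 ++ Γ'.bra :: (I.2.rowsStr ++ [Γ'.ket]) := by
  rw [ineqStr, encWithDims_eq]
  rfl

theorem PT.ineq_dims : PT fun I : IneqInput => dimStr I.1.1 I.1.2 := by
  have h : PT fun I : IneqInput => (parse (ineqStr I)).reverse.tail.reverse := by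
    have := PT.of_ineqStr
    fun_prop
  refine h.of_enc_eq fun I => ?_
  have hr : Parses I.2.rowsStr ((List.finRange I.2.m).flatMap fun i =>
      [enc ((List.ofFn (I.2.A i)).map fun q => enc (ratStr q))] ++ [enc (ratStr (I.2.b i))]) :=
    Parses.flatMap fun i => (Parses.encList parses_encRatEntry).append (parses_encRatEntry _)
  rw [ineqStr_eq, ((parses_dimStr _ _).append hr.node).parse_eq]
  simp only [List.reverse_append, List.reverse_cons, List.reverse_nil, List.nil_append,
    List.cons_append, List.tail_cons, List.reverse_reverse]
  exact (enc_map_enc _).symm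

theorem PT.ineq_dim : PT fun I : IneqInput => List.replicate (I.1.1 + I.1.2) () := by
  have h : PT fun I : IneqInput => (dimStr I.1.1 I.1.2).flatMap fun c =>
      bif MixedInteger.isComma c then [] else [()] :=
    PT.flatMap (h := fun _ c => bif MixedInteger.isComma c then [] else [()]) PT.ineq_dims
      (by fun_prop)
  refine h.of_enc_eq fun I => congrArg enc ?_
  have e : ∀ n, (List.replicate n (Γ'.bit true)).flatMap (fun c =>
      bif MixedInteger.isComma c then [] else [()]) = List.replicate n () := by
    intro n
    induction n with
    | zero => rfl
    | succ n ih => rw [List.replicate_succ, List.flatMap_cons, ih]; rfl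
  rw [dimStr, List.flatMap_append, e, List.flatMap_cons, List.flatMap_append, e]
  simp [MixedInteger.isComma]

/-! ### Writing the box inequalities -/

/-- The rows of `c` times the identity matrix. -/
def unitRows (c : ℚ) : ℕ → List (List ℚ)
  | 0 => []
  | k + 1 => (c :: List.replicate k 0) :: (unitRows c k).map (0 :: ·)

theorem unitRows_eq (c : ℚ) (k : ℕ) : unitRows c k =
    List.ofFn fun i : Fin k => List.ofFn fun j : Fin k => if i = j then c else 0 := by
  induction k with
  | zero => rfl
  | succ k ih =>
    rw [unitRows, ih, List.ofFn_succ, List.map_ofFn]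
    congr 1
    · rw [List.ofFn_succ, ← List.ofFn_const]
      simp [(Fin.succ_ne_zero _).symm]
    · congr 1
      funext i
      simp [List.ofFn_succ, Fin.succ_ne_zero]

theorem sz_unitRows_le (c : ℚ) (k : ℕ) :
    sz (unitRows c k) ≤ k * (k * (sz c + sz (0 : ℚ) + 1) + 2) + 1 := by
  rw [unitRows_eq]
  refine (sz_list_le (B := k * (sz c + sz (0 : ℚ) + 1) + 1) fun r hr => ?_).trans (by simp)
  obtain ⟨i, rfl⟩ := List.mem_ofFn.1 hr
  refine (sz_list_le (B := sz c + sz (0 : ℚ)) fun q hq => ?_).trans (by simp)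
  obtain ⟨j, rfl⟩ := List.mem_ofFn.1 hq
  split_ifs <;> omega

/-- The matrix grows by a new top row and left column, while the state also carries a row of zeros.
A step lengthens every existing row, so its increment depends on the state and an explicit quadratic
bound replaces the additive growth criterion. -/
theorem PT.unitRows (c : ℚ) {l : α → List Unit} (hl : PT l) :
    PT (fun x => unitRows c (l x).length) := by
  have key : ∀ l : List Unit, l.foldl (fun (s : List (List ℚ) × List ℚ) _ =>
      ((c :: s.2) :: s.1.map (0 :: ·), 0 :: s.2)) ([], []) =
        (MixedInteger.unitRows c l.length, List.replicate l.length 0) := by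
    intro l
    induction l using List.reverseRecOn with
    | nil => rfl
    | append_singleton l u ih =>
      rw [List.foldl_append, ih]
      simp [MixedInteger.unitRows, List.replicate_succ]
  have h := PT.foldl (f := fun _ => (([] : List (List ℚ)), ([] : List ℚ))) (l := l)
    (g := fun _ s _ => ((c :: s.2) :: s.1.map (0 :: ·), 0 :: s.2)) (PT.const _) hl (by
      have : PT fun y : α × (List (List ℚ) × List ℚ) × Unit => y.2.1.1.map (0 :: ·) :=
        PT.map (h := fun _ r => 0 :: r) (by fun_prop) (by fun_prop)
      fun_prop) (by
      obtain ⟨q, hq⟩ := hl.sz_le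
      refine ⟨q * (q * Polynomial.C (sz c + sz (0 : ℚ) + 1) + 2) +
        q * Polynomial.C (sz (0 : ℚ) + 1) + 3, fun x l' hl' => ?_⟩
      rw [key, sz_mk]
      have hlen : l'.length ≤ q.eval (sz x) :=
        hl'.length_le.trans ((length_le_sz _).trans (hq x))
      have h₁ := sz_unitRows_le c l'.length
      have h₂ : sz (List.replicate l'.length (0 : ℚ)) ≤ l'.length * (sz (0 : ℚ) + 1) + 1 := by
        refine (sz_list_le (B := sz (0 : ℚ)) fun q hq => ?_).trans (by simp)
        rw [List.eq_of_mem_replicate hq]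
      simp only [Polynomial.eval_add, Polynomial.eval_mul, Polynomial.eval_C,
        Polynomial.eval_ofNat]
      have h₃ := Nat.mul_le_mul_right (sz c + sz (0 : ℚ) + 1) hlen
      have h₄ := Nat.mul_le_mul_right (sz (0 : ℚ) + 1) hlen
      have h₅ := Nat.mul_le_mul hlen (Nat.add_le_add_right h₃ 2)
      omega)
  refine h.fst.of_enc_eq fun x => ?_
  rw [key]

/-- The list of all ordered pairs of entries, each replaced by its first component. -/
def sqList {ι : Type} (l : List ι) : List ι := l.flatMap fun a => l.map fun _ => a

theorem length_sqList {ι : Type} (l : List ι) : (sqList l).length = l.length ^ 2 := by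
  simp [sqList, sq]

theorem PT.sqList {l : α → List β} (hl : PT l) : PT (fun x => sqList (l x)) :=
  PT.flatMap (h := fun x a => (l x).map fun _ => a) hl
    (PT.map (h := fun (y : α × β) _ => y.2) (by fun_prop) (by fun_prop))

theorem PT.twoPow {l : α → List β} (hl : PT l) : PT (fun x => 2 ^ (l x).length) := by
  have h := PT.foldr_of_growth (f := fun _ => 1) (g := fun _ _ n => Nat.bit false n) (PT.const _) hl
    (by fun_prop) ⟨6, fun x s b _ => by simpa using sz_bit false s⟩
  refine h.of_enc_eq fun x => congrArg enc ?_
  induction l x with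
  | nil => rfl
  | cons b l ih => rw [List.foldr_cons, ← ih, List.length_cons, pow_succ, Nat.bit_val]; simp; ring

/-- The system with the additional inequalities `-R ≤ xᵢ ≤ R`. -/
def IneqDescription.addBox {k : ℕ} (D : IneqDescription k) (R : ℕ) : IneqDescription k where
  m := D.m + (k + k)
  A := Fin.append (α := Fin k → ℚ) D.A (Fin.append (fun i j => if i = j then 1 else 0)
    fun i j => if i = j then -1 else 0)
  b := Fin.append D.b fun _ => ((R : ℤ) : ℚ)

section

variable {k : ℕ} (D : IneqDescription k) (R : ℕ)

theorem addBox_A (i : Fin D.m) : (D.addBox R).A (Fin.castAdd (k + k) i) = D.A i :=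
  Fin.append_left (α := Fin k → ℚ) D.A _ i

theorem addBox_A_pos (i : Fin k) : (D.addBox R).A (Fin.natAdd D.m (Fin.castAdd k i)) =
    fun j => if i = j then 1 else 0 :=
  (Fin.append_right (α := Fin k → ℚ) D.A _ _).trans (Fin.append_left _ _ i)

theorem addBox_A_neg (i : Fin k) : (D.addBox R).A (Fin.natAdd D.m (Fin.natAdd k i)) =
    fun j => if i = j then -1 else 0 :=
  (Fin.append_right (α := Fin k → ℚ) D.A _ _).trans (Fin.append_right _ _ i)

theorem addBox_b (i : Fin D.m) : (D.addBox R).b (Fin.castAdd (k + k) i) = D.b i :=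
  Fin.append_left D.b (fun _ : Fin (k + k) => ((R : ℤ) : ℚ)) i

theorem addBox_b_box (i : Fin (k + k)) : (D.addBox R).b (Fin.natAdd D.m i) = ((R : ℤ) : ℚ) :=
  Fin.append_right D.b (fun _ : Fin (k + k) => ((R : ℤ) : ℚ)) i

end

theorem finRange_add_flatMap {ι : Type} (m n : ℕ) (g : Fin (m + n) → List ι) :
    (List.finRange (m + n)).flatMap g = ((List.finRange m).flatMap fun i => g (Fin.castAdd n i)) ++
      (List.finRange n).flatMap fun i => g (Fin.natAdd m i) := by
  have e : ∀ (k : ℕ) (g : Fin k → List ι), (List.finRange k).flatMap g = (List.ofFn g).flatten := by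
    intro k g
    rw [List.flatMap_def, List.ofFn_eq_map]
  rw [e, e, e, List.ofFn_add, List.flatten_append]
  rfl

theorem rowsStr_addBox {k : ℕ} (D : IneqDescription k) (R : ℕ) : (D.addBox R).rowsStr =
    D.rowsStr ++ (unitRows 1 k ++ unitRows (-1) k).flatMap fun r =>
      encList encRatEntry r ++ encRatEntry (R : ℤ) := by
  have e : ∀ c : ℚ, ((unitRows c k).flatMap fun r => encList encRatEntry r ++ encRatEntry (R : ℤ)) =
      (List.finRange k).flatMap fun i => encVec encRatEntry (fun j => if i = j then c else 0) ++
        encRatEntry (R : ℤ) := by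
    intro c
    rw [unitRows_eq, List.ofFn_eq_map, List.flatMap_map]
    rfl
  have h := finRange_add_flatMap D.m (k + k) fun i =>
    encVec encRatEntry ((D.addBox R).A i) ++ encRatEntry ((D.addBox R).b i)
  simp only [finRange_add_flatMap k k, addBox_A, addBox_A_pos, addBox_A_neg, addBox_b,
    addBox_b_box] at h
  rw [List.flatMap_append, e, e]
  exact h

/-- The size of the box of the algorithm. -/
def boxSize (I : IneqInput) : ℕ := 2 ^ (ineqStr I).length ^ 8

/-- Three squarings of the length of a list produce the exponent 8; a power of two is then written
by one doubling per list entry. -/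
theorem PT.boxSize : PT boxSize := by
  have h := PT.twoPow (PT.sqList (PT.sqList (PT.sqList PT.of_ineqStr)))
  refine h.of_enc_eq fun I => congrArg enc ?_
  rw [length_sqList, length_sqList, length_sqList, ← pow_mul, ← pow_mul]
  rfl

/-- The rows of the input are copied as they stand: the closing bracket is removed, the strings of
the new rows are appended and the bracket is put back. Only the dimensions have to be parsed. -/
theorem PT.ineq_addBox : PT fun I : IneqInput =>
    encWithDims @IneqDescription.encode I.1.1 I.1.2 (I.2.addBox (MixedInteger.boxSize I)) := by
  have hR : PT fun I : IneqInput => MixedInteger.encRatEntry ((MixedInteger.boxSize I : ℤ) : ℚ) := by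
    have := PT.boxSize
    fun_prop
  have hU := fun c => PT.unitRows c PT.ineq_dim
  have hN := PT.flatMap (h := fun I r => MixedInteger.encList MixedInteger.encRatEntry r ++
    MixedInteger.encRatEntry ((MixedInteger.boxSize I : ℤ) : ℚ)) (PT.append (hU 1) (hU (-1)))
    (PT.append (PT.encList PT.snd' (PT.encRatEntry PT.id)) (hR.comp PT.fst'))
  have hs := PT.of_ineqStr
  have h : PT fun I : IneqInput => (ineqStr I).reverse.tail.reverse ++
      ((MixedInteger.unitRows 1 (List.replicate (I.1.1 + I.1.2) ()).length ++
        MixedInteger.unitRows (-1) (List.replicate (I.1.1 + I.1.2) ()).length).flatMap fun r =>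
          MixedInteger.encList MixedInteger.encRatEntry r ++
            MixedInteger.encRatEntry ((MixedInteger.boxSize I : ℤ) : ℚ)) ++ [Γ'.ket] := by
    fun_prop
  refine h.of_enc_eq fun I => congrArg enc ?_
  have := ineqStr_eq ⟨I.1, I.2.addBox (MixedInteger.boxSize I)⟩
  rw [ineqStr] at this
  simp only at this
  rw [this, rowsStr_addBox, ineqStr_eq]
  simp

end MixedInteger

end

noncomputable section

namespace MixedInteger

/-! ### Finitely generated cones -/

theorem mem_hull_range {ι E : Type*} [Fintype ι] [AddCommGroup E] [Module ℝ E] {w : ι → E} {x : E} :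
    x ∈ PointedCone.hull ℝ (Set.range w) ↔ ∃ c : ι → ℝ, (∀ i, 0 ≤ c i) ∧ x = ∑ i, c i • w i := by
  rw [Submodule.mem_span_range_iff_exists_fun]
  constructor
  · rintro ⟨c, rfl⟩
    exact ⟨fun i => (c i : ℝ), fun i => (c i).2, rfl⟩
  · rintro ⟨c, hc, rfl⟩
    exact ⟨fun i => ⟨c i, hc i⟩, rfl⟩

/-- Carathéodory's theorem for cones. -/
theorem exists_linearIndependent_repr {ι E : Type*} [Fintype ι] [AddCommGroup E] [Module ℝ E]
    (w : ι → E) (c : ι → ℝ) (hc : ∀ i, 0 ≤ c i) :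
    ∃ (s : Finset ι) (c' : ι → ℝ), (∀ i, 0 ≤ c' i) ∧ ∑ i, c i • w i = ∑ i ∈ s, c' i • w i ∧
      LinearIndependent ℝ fun i : s => w i := by
  classical
  -- A representation of minimal support. A linear dependence among the vectors in its support would
  -- allow one of them to be removed.
  obtain ⟨s, ⟨c', hc', hs'⟩, hmin⟩ := (measure Finset.card).wf.has_min
    {s : Finset ι | ∃ c' : ι → ℝ, (∀ i, 0 ≤ c' i) ∧ ∑ i, c i • w i = ∑ i ∈ s, c' i • w i}
    ⟨Finset.univ, c, hc, rfl⟩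
  refine ⟨s, c', hc', hs', ?_⟩
  by_contra hli
  obtain ⟨g, hg, j, hj, hgj⟩ : ∃ g : ι → ℝ, ∑ i ∈ s, g i • w i = 0 ∧ ∃ j ∈ s, 0 < g j := by
    rw [linearIndependent_iff'] at hli
    push Not at hli
    obtain ⟨t, g, hg, ⟨i, hi⟩, hit, hgi⟩ := hli
    let g' : ι → ℝ := fun i => if h : ∃ hi : i ∈ s, (⟨i, hi⟩ : s) ∈ t then g ⟨i, h.1⟩ else 0
    have hg' : ∑ i ∈ s, g' i • w i = 0 := by
      rw [← hg, ← Finset.sum_coe_sort s, ← Finset.sum_subset (Finset.subset_univ t)]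
      · refine Finset.sum_congr rfl fun i hi => ?_
        simp [g', hi]
      · intro i _ hi
        simp [g', hi]
    have hgi' : g' i ≠ 0 := by simpa [g', hi, hit] using hgi
    rcases lt_or_gt_of_ne hgi' with h | h
    · refine ⟨fun i => - g' i, ?_, i, hi, by simpa using h⟩
      simp [neg_smul, hg']
    · exact ⟨g', hg', i, hi, h⟩
  -- Subtracting the dependence times the smallest ratio c'/g over positive g cancels the
  -- coefficient at `l` and keeps all others nonnegative.
  obtain ⟨l, hl, hlm⟩ := Finset.exists_min_image (s.filter fun i => 0 < g i) (fun i => c' i / g i)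
    ⟨j, by simp [hj, hgj]⟩
  simp only [Finset.mem_filter] at hl hlm
  refine hmin (s.erase l) ⟨fun i => if i ∈ s then c' i - c' l / g l * g i else 0, fun i => ?_, ?_⟩
    (Finset.card_erase_lt_of_mem hl.1)
  · beta_reduce
    split_ifs with hi
    · by_cases h : 0 < g i
      · have := hlm i ⟨hi, h⟩
        rw [le_div_iff₀ h] at this
        linarith
      · have : 0 ≤ c' l / g l := div_nonneg (hc' l) hl.2.le
        nlinarith [hc' i]
    · exact le_rfl
  · have h₁ : ∑ i ∈ s, (c' i - c' l / g l * g i) • w i = ∑ i ∈ s, c' i • w i := by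
      simp only [sub_smul, mul_smul, Finset.sum_sub_distrib, ← Finset.smul_sum, hg]
      simp
    rw [hs', ← h₁, ← Finset.add_sum_erase s _ hl.1]
    have h₂ : c' l - c' l / g l * g l = 0 := by
      rw [div_mul_cancel₀ _ hl.2.ne', sub_self]
    rw [h₂, zero_smul, zero_add]
    refine Finset.sum_congr rfl fun i hi => ?_
    simp only [if_pos (Finset.mem_of_mem_erase hi)]

/-- By Carathéodory's theorem the cone is a finite union of simplicial cones, each the image of a
closed orthant under an injective linear map, which is a closed embedding. -/
theorem isClosed_hull_range {ι : Type*} [Fintype ι] {k : ℕ} (w : ι → Fin k → ℝ) :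
    IsClosed (PointedCone.hull ℝ (Set.range w) : Set (Fin k → ℝ)) := by
  classical
  have h : (PointedCone.hull ℝ (Set.range w) : Set (Fin k → ℝ)) =
      ⋃ s ∈ {s : Finset ι | LinearIndependent ℝ fun i : s => w i},
        (Fintype.linearCombination ℝ fun i : s => w i) '' {c | ∀ i, 0 ≤ c i} := by
    ext x
    simp only [SetLike.mem_coe, mem_hull_range, Set.mem_iUnion, Set.mem_image, Set.mem_ofPred_eq]
    constructor
    · rintro ⟨c, hc, rfl⟩
      obtain ⟨s, c', hc', hs, hli⟩ := exists_linearIndependent_repr w c hc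
      refine ⟨s, hli, fun i => c' i, fun i => hc' i, ?_⟩
      rw [hs, Fintype.linearCombination_apply, ← Finset.sum_coe_sort s]
    · rintro ⟨s, -, c, hc, rfl⟩
      refine ⟨fun i => if h : i ∈ s then c ⟨i, h⟩ else 0, fun i => ?_, ?_⟩
      · beta_reduce
        split_ifs
        · exact hc _
        · exact le_rfl
      · rw [Fintype.linearCombination_apply, ← Finset.sum_subset (Finset.subset_univ s),
          ← Finset.sum_coe_sort s]
        · simp
        · intro i _ hi
          simp [hi]
  rw [h]
  refine Set.Finite.isClosed_biUnion (Set.toFinite _) fun s hs => ?_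
  refine (LinearMap.isClosedEmbedding_of_injective (f := Fintype.linearCombination ℝ
    fun i : s => w i) ?_).isClosedMap _ ?_
  · exact LinearMap.ker_eq_bot.2 hs.fintypeLinearCombination_injective
  · simp only [Set.ofPred_forall]
    exact isClosed_iInter fun i => isClosed_le continuous_const (continuous_apply i)

/-! ### Hulls of mixed-integer points -/

theorem convex_cone {k : ℕ} (S : Set (Fin k → ℝ)) : Convex ℝ (cone S) :=
  PointedCone.convex _

theorem recCone_add {k : ℕ} {P : Set (Fin k → ℝ)} {x y : Fin k → ℝ} (hx : x ∈ P)
    (hy : y ∈ recCone P) : x + y ∈ P := by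
  simpa using hy x hx 1 zero_le_one

theorem intVec_mem_mixedLattice {n d : ℕ} (w : Fin (n + d) → ℤ) : intVec w ∈ mixedLattice n d :=
  fun i => ⟨w (Fin.castAdd d i), rfl⟩

theorem mixedLattice_add {n d : ℕ} {x y : Fin (n + d) → ℝ} (hx : x ∈ mixedLattice n d)
    (hy : y ∈ mixedLattice n d) : x + y ∈ mixedLattice n d := by
  intro i
  obtain ⟨a, ha⟩ := hx i
  obtain ⟨b, hb⟩ := hy i
  exact ⟨a + b, by simp [ha, hb]⟩

theorem mixedLattice_sub {n d : ℕ} {x y : Fin (n + d) → ℝ} (hx : x ∈ mixedLattice n d)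
    (hy : y ∈ mixedLattice n d) : x - y ∈ mixedLattice n d := by
  intro i
  obtain ⟨a, ha⟩ := hx i
  obtain ⟨b, hb⟩ := hy i
  exact ⟨a - b, by simp [ha, hb]⟩

theorem smul_mem_recCone {k : ℕ} {P : Set (Fin k → ℝ)} {y : Fin k → ℝ} (hy : y ∈ recCone P)
    {c : ℝ} (hc : 0 ≤ c) : c • y ∈ recCone P := by
  intro x hx t ht
  rw [smul_smul]
  exact hy x hx _ (mul_nonneg ht hc)

/-- Integral recession directions may be added to the mixed-integer hull. -/
theorem mixedHull_add_smul {n d : ℕ} {P : Set (Fin (n + d) → ℝ)} {w : Fin (n + d) → ℤ}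
    (hw : intVec w ∈ recCone P) {c : ℝ} (hc : 0 ≤ c) {s : Fin (n + d) → ℝ}
    (hs : s ∈ mixedHull n d P) : s + c • intVec w ∈ mixedHull n d P := by
  have hconv : Convex ℝ {s | s + c • intVec w ∈ mixedHull n d P} := by
    have h := (convex_convexHull ℝ (P ∩ mixedLattice n d)).translate_preimage_left (c • intVec w)
    exact h
  refine convexHull_min ?_ hconv hs
  rintro p ⟨hp, hpL⟩
  -- The integral multiple N w leads to another lattice point of P, and p + c w divides the segment
  -- from p to p + N w in the ratio given by c/N.
  obtain ⟨N, hN⟩ := exists_nat_gt c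
  have hN₀ : (0 : ℝ) < N := hc.trans_lt hN
  have h₁ : p + (N : ℝ) • intVec w ∈ P ∩ mixedLattice n d := by
    refine ⟨hw p hp _ (Nat.cast_nonneg _), mixedLattice_add hpL ?_⟩
    have : (N : ℝ) • intVec w = intVec fun i => N * w i := by
      funext i
      simp [intVec]
    rw [this]
    exact intVec_mem_mixedLattice _
  have h₂ := (convex_convexHull ℝ (P ∩ mixedLattice n d)) (subset_convexHull ℝ _ ⟨hp, hpL⟩)
    (subset_convexHull ℝ _ h₁) (a := 1 - c / N) (b := c / N)
    (by rw [sub_nonneg, div_le_one hN₀]; exact hN.le) (by positivity) (by ring)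
  have h₃ : (1 - c / N) • p + (c / N) • (p + (N : ℝ) • intVec w) = p + c • intVec w := by
    rw [smul_add, smul_smul, div_mul_cancel₀ _ hN₀.ne', sub_smul, one_smul]
    abel
  rw [h₃] at h₂
  exact h₂

/-- If every point of `P` can be moved to `Q` by an integral direction of the recession cone, and
the recession cone is generated by integral vectors, then `Q` contains the relevant points. -/
theorem relevant_points {n d : ℕ} {P Q : Set (Fin (n + d) → ℝ)} {W : Set (Fin (n + d) → ℤ)}
    (hQP : Q ⊆ P) (hW : recCone P = cone (intVec '' W))
    (h : ∀ x ∈ P, ∃ y : Fin (n + d) → ℤ, intVec y ∈ recCone P ∧ x - intVec y ∈ Q) :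
    P = Q + recCone P ∧
      mixedHull n d P = convexHull ℝ (Q ∩ mixedLattice n d) + recCone P := by
  refine ⟨?_, ?_⟩
  · refine Set.Subset.antisymm (fun x hx => ?_) ?_
    · obtain ⟨y, hy, hxy⟩ := h x hx
      exact ⟨_, hxy, _, hy, sub_add_cancel _ _⟩
    · rintro _ ⟨x, hx, y, hy, rfl⟩
      exact recCone_add (hQP hx) hy
  · refine Set.Subset.antisymm (convexHull_min ?_ ?_) ?_
    · rintro x ⟨hx, hxL⟩
      obtain ⟨y, hy, hxy⟩ := h x hx
      exact ⟨_, subset_convexHull ℝ _ ⟨hxy, mixedLattice_sub hxL (intVec_mem_mixedLattice y)⟩, _, hy,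
        sub_add_cancel _ _⟩
    · rw [hW]
      exact (convex_convexHull ℝ _).add (convex_cone _)
    · rintro _ ⟨x, hx, y, hy, rfl⟩
      have hx' : x ∈ mixedHull n d P := convexHull_mono (by gcongr) hx
      rw [hW] at hy
      -- Quantifying over all base points and all nonnegative multiples makes the property stable
      -- under sums and scaling, so that only integral generators remain to be checked.
      have key : ∀ y ∈ PointedCone.hull ℝ (intVec '' W), ∀ c : ℝ, 0 ≤ c →
          ∀ s ∈ mixedHull n d P, s + c • y ∈ mixedHull n d P := by
        intro y hy
        induction hy using Submodule.span_induction with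
        | mem y hy =>
          obtain ⟨w, hw, rfl⟩ := hy
          intro c hc s hs
          refine mixedHull_add_smul ?_ hc hs
          rw [hW]
          exact PointedCone.subset_hull ⟨w, hw, rfl⟩
        | zero => intro c _ s hs; simpa using hs
        | add y z _ _ ihy ihz =>
          intro c hc s hs
          rw [smul_add, ← add_assoc]
          exact ihz c hc _ (ihy c hc s hs)
        | smul a y _ ih =>
          intro c hc s hs
          have := ih (c * a) (mul_nonneg hc a.2) s hs
          rwa [mul_smul] at this
      simpa using key y hy 1 zero_le_one x hx'

end MixedInteger

end

noncomputable section

namespace MixedInteger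

/-! ### Truncating an inner description -/

/-- If x + (N+1) y = v + c with v in K and c in C for each N, then c/(N+1) differs from y by (x -
v)/(N+1), which tends to 0 because K is bounded. Hence y is a limit of points of the closed cone. -/
theorem recCone_add_of_isBounded {k : ℕ} {K : Set (Fin k → ℝ)} (C : PointedCone ℝ (Fin k → ℝ))
    (hK : K.Nonempty) (hb : Bornology.IsBounded K) (hC : IsClosed (C : Set (Fin k → ℝ))) :
    recCone (K + (C : Set (Fin k → ℝ))) = C := by
  refine Set.Subset.antisymm (fun y hy => ?_) ?_
  · obtain ⟨x, hx⟩ := hK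
    have h : ∀ N : ℕ, ∃ v ∈ K, ∃ c ∈ C, v + c = x + ((N : ℝ) + 1) • y := fun N => by
      obtain ⟨v, hv, c, hc, h⟩ := hy x ⟨x, hx, 0, C.zero_mem, add_zero x⟩ ((N : ℝ) + 1)
        (by positivity)
      exact ⟨v, hv, c, hc, h⟩
    choose v hv c hc hvc using h
    obtain ⟨M, hM⟩ := hb.exists_norm_le
    have h₀ : Filter.Tendsto (fun N : ℕ => (1 / ((N : ℝ) + 1)) • (x - v N)) Filter.atTop
        (nhds 0) := by
      refine Filter.Tendsto.zero_smul_isBoundedUnder_le tendsto_one_div_add_atTop_nhds_zero_nat ?_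
      refine Filter.isBoundedUnder_of ⟨M + M, fun N => ?_⟩
      exact (norm_sub_le _ _).trans (add_le_add (hM _ hx) (hM _ (hv N)))
    have h₁ := h₀.add_const y
    rw [zero_add] at h₁
    refine hC.mem_of_tendsto h₁ (Filter.Eventually.of_forall fun N => ?_)
    have h₂ : (1 / ((N : ℝ) + 1)) • (x - v N) + y = (1 / ((N : ℝ) + 1)) • c N := by
      have h₃ : c N = (x - v N) + ((N : ℝ) + 1) • y := by
        rw [← add_sub_cancel_left (v N) (c N), hvc]
        abel
      rw [h₃, smul_add, smul_smul, one_div_mul_cancel (by positivity), one_smul]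
    rw [h₂]
    exact C.smul_mem (by positivity) (hc N)
  · rintro y hy _ ⟨v, hv, c, hc, rfl⟩ t ht
    exact ⟨v, hv, c + t • y, C.add_mem hc (C.smul_mem ht hy), by simp [add_assoc]⟩

theorem InnerDescription.directions_eq {k : ℕ} (D : InnerDescription k) :
    {x | ∃ w ∈ D.W, x = intVec w} = Set.range fun i : Fin D.W.length => intVec (D.W.get i) := by
  ext x
  simp only [Set.mem_ofPred_eq, Set.mem_range]
  constructor
  · rintro ⟨w, hw, rfl⟩
    obtain ⟨i, rfl⟩ := List.mem_iff_get.1 hw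
    exact ⟨i, rfl⟩
  · rintro ⟨i, rfl⟩
    exact ⟨_, List.get_mem _ _, rfl⟩

theorem isBounded_convexHull_ratVec {k : ℕ} (V : List (Fin k → ℚ)) :
    Bornology.IsBounded (convexHull ℝ {x | ∃ v ∈ V, x = ratVec v}) := by
  rw [isBounded_convexHull]
  refine Set.Finite.isBounded ?_
  refine (V.toFinset.finite_toSet.image ratVec).subset ?_
  rintro _ ⟨v, hv, rfl⟩
  exact ⟨v, by simpa using hv, rfl⟩

theorem InnerDescription.recCone_toSet {k : ℕ} (D : InnerDescription k) (h : D.toSet.Nonempty) :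
    recCone D.toSet = cone {x | ∃ w ∈ D.W, x = intVec w} := by
  refine recCone_add_of_isBounded _ (Set.Nonempty.of_add_left h)
    (isBounded_convexHull_ratVec _) ?_
  rw [D.directions_eq]
  exact isClosed_hull_range _

theorem InnerDescription.mem_truncate_iff {k : ℕ} (D : InnerDescription k) (v : Fin k → ℚ) :
    v ∈ D.truncate.V ↔ v ∈ D.V ∨ ∃ u ∈ D.V, ∃ w ∈ D.W,
      v = fun i => u i + ((D.W.length * w i : ℤ) : ℚ) := by
  simp only [truncate, List.mem_append, List.mem_flatMap, List.mem_map, eq_comm]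

theorem ratVec_add_intVec {k : ℕ} (u : Fin k → ℚ) (l : ℕ) (w : Fin k → ℤ) :
    ratVec (fun i => u i + ((l * w i : ℤ) : ℚ)) = ratVec u + (l : ℝ) • intVec w := by
  funext i
  simp [ratVec, intVec]

theorem InnerDescription.truncate_subset {k : ℕ} (D : InnerDescription k) :
    D.truncate.toSet ⊆ D.toSet := by
  refine convexHull_min ?_ ((convex_convexHull ℝ _).add (convex_cone _))
  rintro _ ⟨v, hv, rfl⟩
  rcases (D.mem_truncate_iff v).1 hv with hv | ⟨u, hu, w, hw, rfl⟩
  · exact ⟨_, subset_convexHull ℝ _ ⟨v, hv, rfl⟩, 0, Submodule.zero_mem _, add_zero _⟩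
  · rw [ratVec_add_intVec]
    exact ⟨_, subset_convexHull ℝ _ ⟨u, hu, rfl⟩, _, Submodule.smul_mem _
      (⟨(D.W.length : ℝ), Nat.cast_nonneg _⟩ : {c : ℝ // 0 ≤ c})
      (PointedCone.subset_hull ⟨w, hw, rfl⟩), rfl⟩

/-- The point is the average over i of (1 - f i) v + f i (v + |W| w_i). The factor |W| compensates
the weight 1/|W| of the average, which is why `truncate` uses this multiple; an empty list of
directions is treated apart. -/
theorem InnerDescription.add_sum_mem_truncate {k : ℕ} (D : InnerDescription k) {v : Fin k → ℝ}
    (hv : v ∈ convexHull ℝ {x | ∃ v ∈ D.V, x = ratVec v}) (f : Fin D.W.length → ℝ)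
    (hf₀ : ∀ i, 0 ≤ f i) (hf₁ : ∀ i, f i ≤ 1) :
    v + ∑ i, f i • intVec (D.W.get i) ∈ D.truncate.toSet := by
  have hconv : Convex ℝ D.truncate.toSet := convex_convexHull ℝ _
  have hV : v ∈ D.truncate.toSet := by
    refine convexHull_mono ?_ hv
    rintro _ ⟨u, hu, rfl⟩
    exact ⟨u, (D.mem_truncate_iff u).2 (Or.inl hu), rfl⟩
  have hW : ∀ w ∈ D.W, v + (D.W.length : ℝ) • intVec w ∈ D.truncate.toSet := by
    intro w hw
    refine convexHull_min (t := {v | v + (D.W.length : ℝ) • intVec w ∈ D.truncate.toSet}) ?_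
      (hconv.translate_preimage_left _) hv
    rintro _ ⟨u, hu, rfl⟩
    refine subset_convexHull ℝ _ ⟨_, (D.mem_truncate_iff _).2 (Or.inr ⟨u, hu, w, hw, rfl⟩), ?_⟩
    rw [ratVec_add_intVec]
  by_cases hl : D.W.length = 0
  · have : IsEmpty (Fin D.W.length) := by rw [hl]; infer_instance
    simpa using hV
  have hl' : (D.W.length : ℝ) ≠ 0 := by exact_mod_cast hl
  have hsum : v + ∑ i, f i • intVec (D.W.get i) = ∑ i : Fin D.W.length, (1 / (D.W.length : ℝ)) •
      ((1 - f i) • v + f i • (v + (D.W.length : ℝ) • intVec (D.W.get i))) := by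
    have : ∀ i : Fin D.W.length, (1 / (D.W.length : ℝ)) •
        ((1 - f i) • v + f i • (v + (D.W.length : ℝ) • intVec (D.W.get i))) =
        (1 / (D.W.length : ℝ)) • v + f i • intVec (D.W.get i) := fun i => by
      rw [smul_add (f i), ← add_assoc, ← add_smul, sub_add_cancel, one_smul, smul_add,
        smul_comm (f i), smul_smul (1 / (D.W.length : ℝ)), one_div_mul_cancel hl', one_smul]
    simp only [this, Finset.sum_add_distrib, Finset.sum_const, Finset.card_univ, Fintype.card_fin]
    rw [← Nat.cast_smul_eq_nsmul ℝ, smul_smul, mul_one_div_cancel hl', one_smul]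
  rw [hsum]
  refine hconv.sum_mem (fun _ _ => by positivity) ?_ fun i _ => ?_
  · simp [hl']
  · exact hconv hV (hW _ (List.get_mem _ _)) (sub_nonneg.2 (hf₁ i)) (hf₀ i) (by ring)

theorem isRationalPolytope_vertexDescription {k : ℕ} (D : VertexDescription k) :
    IsRationalPolytope D.toSet := by
  classical
  refine ⟨D.V.toFinset, ?_⟩
  rw [VertexDescription.toSet]
  congr 1
  ext x
  simp [eq_comm]

/-- The integer parts of the coefficients give the integral recession direction to subtract, and the
fractional parts are covered by `add_sum_mem_truncate`. -/
theorem InnerDescription.relevant_points_truncate {n d : ℕ} (D : InnerDescription (n + d))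
    (h : (D.toSet ∩ mixedLattice n d).Nonempty) :
    D.toSet = D.truncate.toSet + recCone D.toSet ∧
      mixedHull n d D.toSet =
        convexHull ℝ (D.truncate.toSet ∩ mixedLattice n d) + recCone D.toSet := by
  have hrec := D.recCone_toSet h.left
  have himg : {x | ∃ w ∈ D.W, x = intVec w} = intVec '' {w | w ∈ D.W} := by
    ext x
    simp [eq_comm]
  refine relevant_points D.truncate_subset (hrec.trans (congrArg cone himg)) ?_
  rintro _ ⟨v, hv, c, hc, rfl⟩
  have hc' := hc
  rw [D.directions_eq, cone, SetLike.mem_coe, mem_hull_range] at hc'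
  obtain ⟨c, hc₀, rfl⟩ := hc'
  have hint : intVec (fun j => ∑ i, ⌊c i⌋ * D.W.get i j) =
      ∑ i, (⌊c i⌋ : ℝ) • intVec (D.W.get i) := by
    funext j
    simp [intVec, Finset.sum_apply]
  refine ⟨fun j => ∑ i, ⌊c i⌋ * D.W.get i j, ?_, ?_⟩
  · rw [hrec, D.directions_eq, hint]
    exact mem_hull_range.2 ⟨fun i => ⌊c i⌋, fun i => Int.cast_nonneg (Int.floor_nonneg.2 (hc₀ i)),
      rfl⟩
  · have := D.add_sum_mem_truncate hv (fun i => Int.fract (c i)) (fun i => Int.fract_nonneg _)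
      fun i => (Int.fract_lt_one _).le
    rw [hint]
    convert this using 1
    rw [add_sub_assoc, ← Finset.sum_sub_distrib]
    simp only [← sub_smul, Int.self_sub_floor]

end MixedInteger

end

noncomputable section

namespace MixedInteger

/-! ### Generators of polyhedral cones -/

section Cone

variable {ι E : Type*} [Fintype ι] [AddCommGroup E] [Module ℝ E] (l : ι → E →ₗ[ℝ] ℝ)

/-- Moving from a point of a polyhedral cone until a new inequality becomes tight. -/
theorem exists_max_step {p u : E} (hp : ∀ i, l i p ≤ 0) (hu : ∃ i, 0 < l i u) :
    ∃ t : ℝ, 0 ≤ t ∧ (∀ i, l i (p + t • u) ≤ 0) ∧ ∃ i, 0 < l i u ∧ l i (p + t • u) = 0 := by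
  classical
  obtain ⟨j, hj⟩ := hu
  obtain ⟨i, hi, hmin⟩ := Finset.exists_min_image (Finset.univ.filter fun i => 0 < l i u)
    (fun i => -l i p / l i u) ⟨j, by simp [hj]⟩
  simp only [Finset.mem_filter, Finset.mem_univ, true_and] at hi hmin
  have ht : 0 ≤ -l i p / l i u := div_nonneg (neg_nonneg.2 (hp i)) hi.le
  refine ⟨-l i p / l i u, ht, fun k => ?_, i, hi, ?_⟩
  · rw [map_add, map_smul, smul_eq_mul]
    by_cases hk : 0 < l k u
    · have := hmin k hk
      rw [le_div_iff₀ hk] at this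
      linarith
    · have := mul_nonpos_of_nonneg_of_nonpos ht (not_lt.1 hk)
      linarith [hp k]
  · rw [map_add, map_smul, smul_eq_mul, div_mul_cancel₀ _ hi.ne', add_neg_cancel]

/-- A pointed polyhedral cone has extreme rays. -/
theorem exists_extreme_ray (hl : ∀ z, (∀ i, l i z = 0) → z = 0) {z : E} (hz : ∀ i, l i z ≤ 0)
    (hz₀ : z ≠ 0) : ∃ y ≠ 0, (∀ i, l i y ≤ 0) ∧ (∀ i, l i z = 0 → l i y = 0) ∧
      ∀ u, (∀ i, l i y = 0 → l i u = 0) → ∃ c : ℝ, u = c • y := by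
  classical
  -- Among the nonzero points of the cone for which all inequalities tight at z are tight, one with
  -- the fewest slack inequalities is taken.
  obtain ⟨y, ⟨hy₀, hy, hzy⟩, hmin⟩ :=
    (measure fun y : E => (Finset.univ.filter fun i => l i y ≠ 0).card).wf.has_min
      {y : E | y ≠ 0 ∧ (∀ i, l i y ≤ 0) ∧ ∀ i, l i z = 0 → l i y = 0} ⟨z, hz₀, hz, fun _ => id⟩
  refine ⟨y, hy₀, hy, hzy, ?_⟩
  -- Moving from y along u until a new inequality becomes tight would contradict minimality unless
  -- the point reached is 0, and then u is a multiple of y.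
  have key : ∀ u, (∀ i, l i y = 0 → l i u = 0) → (∃ i, 0 < l i u) → ∃ c : ℝ, u = c • y := by
    intro u hu hpos
    obtain ⟨t, ht, hle, i, hi, hti⟩ := exists_max_step l hy hpos
    have hyi : l i y ≠ 0 := fun h => hi.ne' (hu i h)
    have ht₀ : t ≠ 0 := by
      rintro rfl
      rw [zero_smul, add_zero] at hti
      exact hyi hti
    by_contra hc
    refine hmin (y + t • u) ⟨fun h => hc ⟨-t⁻¹, ?_⟩, hle, fun k hk => ?_⟩ ?_
    · have : t • u = -y := by rw [← sub_eq_zero, sub_neg_eq_add, add_comm, h]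
      rw [neg_smul, ← smul_neg, ← this, smul_smul, inv_mul_cancel₀ ht₀, one_smul]
    · simp [hzy k hk, hu k (hzy k hk)]
    · refine Finset.card_lt_card ⟨fun k => ?_, fun h => ?_⟩
      · simp only [Finset.mem_filter, Finset.mem_univ, true_and]
        intro hk hk'
        exact hk (by simp [hk', hu k hk'])
      · have : i ∈ Finset.univ.filter fun i => l i (y + t • u) ≠ 0 := h (by simpa using hyi)
        simp only [Finset.mem_filter] at this
        exact this.2 hti
  intro u hu
  by_cases hpos : ∃ i, 0 < l i u
  · exact key u hu hpos
  · by_cases hneg : ∃ i, 0 < l i (-u)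
    · obtain ⟨c, hc⟩ := key (-u) (fun i hi => by simp [hu i hi]) hneg
      exact ⟨-c, by rw [neg_smul, ← hc, neg_neg]⟩
    · push Not at hpos hneg
      refine ⟨0, ?_⟩
      rw [zero_smul]
      refine hl u fun i => le_antisymm (hpos i) ?_
      simpa using hneg i

/-- A pointed polyhedral cone is generated by any set that meets its extreme rays. -/
theorem mem_hull_of_extreme_rays (hl : ∀ z, (∀ i, l i z = 0) → z = 0) (G : Set E)
    (hG : ∀ y ≠ 0, (∀ i, l i y ≤ 0) → (∀ u, (∀ i, l i y = 0 → l i u = 0) → ∃ c : ℝ, u = c • y) →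
      ∃ c : ℝ, 0 < c ∧ c • y ∈ G) (z : E) (hz : ∀ i, l i z ≤ 0) : z ∈ PointedCone.hull ℝ G := by
  classical
  induction hn : (Finset.univ.filter fun i => l i z ≠ 0).card using Nat.strong_induction_on
    generalizing z with
  | _ n ih =>
    by_cases hz₀ : z = 0
    · rw [hz₀]
      exact Submodule.zero_mem _
    obtain ⟨y, hy₀, hy, hzy, hray⟩ := exists_extreme_ray l hl hz hz₀
    obtain ⟨c, hc, hcG⟩ := hG y hy₀ hy hray
    have hneg : ∃ i, 0 < l i (-y) := by
      by_contra h
      push Not at h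
      exact hy₀ (hl y fun i => le_antisymm (hy i) (by simpa using h i))
    -- The largest multiple of the ray is subtracted from z without leaving the cone. Inequalities
    -- tight at z stay tight and a new one becomes tight, so the induction applies to z - t y.
    obtain ⟨t, ht, hle, i, hi, hti⟩ := exists_max_step l hz hneg
    have hyi : l i y ≠ 0 := fun h => by simp [h] at hi
    have hmem := ih _ ?_ (z + t • -y) hle rfl
    · have hyG : y ∈ PointedCone.hull ℝ G := by
        have := Submodule.smul_mem (PointedCone.hull ℝ G)
          (⟨c⁻¹, inv_nonneg.2 hc.le⟩ : {c : ℝ // 0 ≤ c}) (PointedCone.subset_hull hcG)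
        have h' : c⁻¹ • c • y ∈ PointedCone.hull ℝ G := this
        rwa [smul_smul, inv_mul_cancel₀ hc.ne', one_smul] at h'
      have h' : t • y ∈ PointedCone.hull ℝ G :=
        Submodule.smul_mem (PointedCone.hull ℝ G) (⟨t, ht⟩ : {c : ℝ // 0 ≤ c}) hyG
      have := Submodule.add_mem _ hmem h'
      rwa [smul_neg, neg_add_cancel_right] at this
    · rw [← hn]
      refine Finset.card_lt_card ⟨fun k => ?_, fun h => ?_⟩
      · simp only [Finset.mem_filter, Finset.mem_univ, true_and]
        intro hk hk'
        exact hk (by simp [hk', hzy k hk'])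
      · have : i ∈ Finset.univ.filter fun i => l i (z + t • -y) ≠ 0 :=
          h (by simpa using fun h => hyi (hzy i h))
        simp only [Finset.mem_filter] at this
        exact this.2 hti

end Cone

/-! ### Small integral generators -/

/-- The linear form with the given integer coefficients. -/
def intForm {κ : Type*} [Fintype κ] (a : κ → ℤ) : (κ → ℝ) →ₗ[ℝ] ℝ :=
  ∑ j, (a j : ℝ) • LinearMap.proj j

theorem intForm_apply {κ : Type*} [Fintype κ] (a : κ → ℤ) (z : κ → ℝ) :
    intForm a z = ∑ j, (a j : ℝ) * z j := by
  simp [intForm]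

attribute [local instance] Matrix.seminormedAddCommGroup in
/-- A consequence of Siegel's lemma: integer linear forms with a common nonzero real zero have a
small integer one. -/
theorem exists_small_int_zero {ι κ : Type*} [Fintype κ] (M : ι → κ → ℤ) {B : ℕ} (hB : 1 ≤ B)
    (hM : ∀ i j, |M i j| ≤ B) {y : κ → ℝ} (hy : y ≠ 0) (hMy : ∀ i, intForm (M i) y = 0) :
    ∃ g : κ → ℤ, g ≠ 0 ∧ (∀ j, |g j| ≤ ((Fintype.card κ * B) ^ Fintype.card κ : ℕ)) ∧
      ∀ i, intForm (M i) (fun j => (g j : ℝ)) = 0 := by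
  classical
  obtain ⟨j₀, hj₀⟩ : ∃ j, y j ≠ 0 := by
    by_contra h
    push Not at h
    exact hy (funext h)
  have hcard : 1 ≤ Fintype.card κ := Fintype.card_pos_iff.2 ⟨j₀⟩
  -- Siegel's lemma needs fewer equations than unknowns, so the rows are thinned out to a linearly
  -- independent family with the same span and hence the same zeros.
  obtain ⟨α, a, -, hspan, hli⟩ := exists_linearIndependent' ℝ fun (i : ι) (j : κ) => (M i j : ℝ)
  have : Finite α := hli.finite
  have : Fintype α := Fintype.ofFinite α
  have key : ∀ g : κ → ℝ, (∀ r, intForm (M (a r)) g = 0) → ∀ i, intForm (M i) g = 0 := by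
    intro g hg i
    let φ : (κ → ℝ) →ₗ[ℝ] ℝ := ∑ j, g j • LinearMap.proj j
    have hφ : ∀ i, φ (fun j => (M i j : ℝ)) = intForm (M i) g := fun i => by
      simp [φ, intForm, mul_comm]
    have h₁ : Submodule.span ℝ (Set.range fun (i : ι) (j : κ) => (M i j : ℝ)) ≤ φ.ker := by
      rw [← hspan, Submodule.span_le]
      rintro _ ⟨r, rfl⟩
      simp only [SetLike.mem_coe, LinearMap.mem_ker, Function.comp_apply]
      rw [hφ, hg]
    have h₂ := h₁ (Submodule.subset_span ⟨i, rfl⟩)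
    rw [LinearMap.mem_ker] at h₂
    rw [← hφ, h₂]
  -- With as many independent rows as unknowns, pairing with y would vanish on the whole space,
  -- contrary to y ≠ 0.
  have hlt : Fintype.card α < Fintype.card κ := by
    refine lt_of_le_of_ne (by simpa using hli.fintype_card_le_finrank) fun h => hy ?_
    have htop := hli.span_eq_top_of_card_eq_finrank' (by simpa using h)
    let φ : (κ → ℝ) →ₗ[ℝ] ℝ := ∑ j, y j • LinearMap.proj j
    have h₁ : (⊤ : Submodule ℝ (κ → ℝ)) ≤ φ.ker := by
      rw [← htop, Submodule.span_le]
      rintro _ ⟨r, rfl⟩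
      have := hMy (a r)
      rw [intForm_apply] at this
      simpa [φ, mul_comm] using this
    funext j
    have h₂ := h₁ (Submodule.mem_top (x := Pi.single j 1))
    simpa [φ, Pi.single_apply] using h₂
  -- Siegel's lemma also needs at least one equation; without equations a unit vector serves.
  rcases Nat.eq_zero_or_pos (Fintype.card α) with hα | hα
  · have : IsEmpty α := Fintype.card_eq_zero_iff.1 hα
    refine ⟨Pi.single j₀ 1, by simp, fun j => ?_, key _ fun r => this.elim r⟩
    have h₁ : (1 : ℤ) ≤ ((Fintype.card κ * B) ^ Fintype.card κ : ℕ) := by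
      exact_mod_cast Nat.one_le_pow _ _ (Nat.mul_pos hcard hB)
    refine le_trans ?_ h₁
    rw [Pi.single_apply]
    split_ifs <;> simp
  · obtain ⟨g, hg₀, hg, hgn⟩ := Int.Matrix.exists_ne_zero_int_vec_norm_le
      (Matrix.of fun r j => M (a r) j) hlt hα
    refine ⟨g, hg₀, fun j => ?_, key _ fun r => ?_⟩
    · have h₁ := (norm_le_pi_norm g j).trans hgn
      rw [Int.norm_eq_abs] at h₁
      have h₂ : max 1 ‖(Matrix.of fun r j => M (a r) j : Matrix α κ ℤ)‖ ≤ (B : ℝ) := by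
        refine max_le (by exact_mod_cast hB) ((Matrix.norm_le_iff (Nat.cast_nonneg _)).2 ?_)
        intro r j
        rw [Int.norm_eq_abs, Matrix.of_apply]
        exact_mod_cast hM (a r) j
      have hκ : (1 : ℝ) ≤ Fintype.card κ := by exact_mod_cast hcard
      have hm : (1 : ℝ) ≤ max 1 ‖(Matrix.of fun r j => M (a r) j : Matrix α κ ℤ)‖ :=
        le_max_left _ _
      have hd : (1 : ℝ) ≤ (Fintype.card κ : ℝ) - Fintype.card α := by
        rw [le_sub_iff_add_le, add_comm]
        exact_mod_cast hlt
      -- The exponent m/(n - m) in Siegel's lemma is at most n, since n - m ≥ 1 and m < n.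
      have he : (Fintype.card α : ℝ) / ((Fintype.card κ : ℝ) - Fintype.card α) ≤
          Fintype.card κ := by
        refine (div_le_self (Nat.cast_nonneg _) hd).trans ?_
        exact_mod_cast hlt.le
      have h₃ := h₁.trans (Real.rpow_le_rpow_of_exponent_le
        (one_le_mul_of_one_le_of_one_le hκ hm) he)
      rw [Real.rpow_natCast] at h₃
      have h₄ : |(g j : ℝ)| ≤ ((Fintype.card κ : ℝ) * B) ^ Fintype.card κ := by
        refine h₃.trans (pow_le_pow_left₀ (by positivity) ?_ _)
        gcongr
      exact_mod_cast h₄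
    · have := congrFun hg r
      rw [intForm_apply]
      simp only [Matrix.mulVec, dotProduct, Matrix.of_apply, Pi.zero_apply] at this
      exact_mod_cast this

/-- The cone of solutions of homogeneous integer inequalities with small coefficients is generated
by small integer solutions. -/
theorem mem_hull_small_int {ι κ : Type*} [Fintype ι] [Fintype κ] (M : ι → κ → ℤ) {B : ℕ}
    (hB : 1 ≤ B) (hM : ∀ i j, |M i j| ≤ B) {z : κ → ℝ} (hz : ∀ i, intForm (M i) z ≤ 0) :
    z ∈ PointedCone.hull ℝ {x | ∃ g : κ → ℤ,
      (∀ j, |g j| ≤ ((Fintype.card κ * B) ^ Fintype.card κ : ℕ)) ∧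
      (∀ i, intForm (M i) (fun j => (g j : ℝ)) ≤ 0) ∧ x = fun j => (g j : ℝ)} := by
  classical
  -- The cone may contain lines. Adding the sign conditions of an orthant that contains z makes it
  -- pointed and keeps the coefficients bounded by B.
  let σ : κ → ℤ := fun j => if 0 ≤ z j then -1 else 1
  let M' : ι ⊕ κ → κ → ℤ := Sum.elim M fun j => Pi.single j (σ j)
  have hσ : ∀ j (y : κ → ℝ), intForm (M' (Sum.inr j)) y = σ j * y j := fun j y => by
    simp [M', intForm_apply, Pi.single_apply]
  have hσ₁ : ∀ j, |σ j| = 1 := fun j => by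
    by_cases h : 0 ≤ z j <;> simp [σ, h]
  have hσ₀ : ∀ j, (σ j : ℝ) ≠ 0 := fun j => by
    have := hσ₁ j
    intro h
    have h' : σ j = 0 := by exact_mod_cast h
    simp [h'] at this
  have hM' : ∀ i j, |M' i j| ≤ B := by
    rintro (i | i) j
    · exact hM i j
    · simp only [M', Sum.elim_inr, Pi.single_apply]
      split_ifs
      · rw [hσ₁]; exact_mod_cast hB
      · simp
  refine mem_hull_of_extreme_rays (fun i => intForm (M' i)) ?_ _ ?_ z ?_
  · intro y hy
    funext j
    have := hy (Sum.inr j)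
    rw [hσ] at this
    exact (mul_eq_zero.1 this).resolve_left (hσ₀ j)
  · intro y hy₀ hy hray
    -- The integer vector g annihilates every row tight at the extreme ray y, so g = c y with c ≠ 0,
    -- and g or -g lies on the ray according to the sign of c.
    obtain ⟨g, hg₀, hgB, hg⟩ := exists_small_int_zero
      (fun i : {i // intForm (M' i) y = 0} => M' i) hB (fun i j => hM' i j) hy₀ fun i => i.2
    obtain ⟨c, hc⟩ := hray _ fun i hi => hg ⟨i, hi⟩
    have hgR : (fun j => (g j : ℝ)) ≠ 0 := fun h => hg₀ <| funext fun j => by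
      have : (g j : ℝ) = 0 := congrFun h j
      exact Int.cast_eq_zero.1 this
    rcases lt_trichotomy c 0 with h | h | h
    · refine ⟨-c, neg_pos.2 h, -g, fun j => by simpa using hgB j, fun i => ?_, ?_⟩
      · have h₁ : (fun j => (((-g) j : ℤ) : ℝ)) = (-c) • y := by
          rw [neg_smul, ← hc]
          funext j
          simp
        rw [h₁, map_smul]
        exact mul_nonpos_of_nonneg_of_nonpos (neg_pos.2 h).le (hy (Sum.inl i))
      · rw [neg_smul, ← hc]
        funext j
        simp
    · rw [h, zero_smul] at hc
      exact (hgR hc).elim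
    · refine ⟨c, h, g, hgB, fun i => ?_, hc.symm⟩
      rw [hc, map_smul]
      exact mul_nonpos_of_nonneg_of_nonpos h.le (hy (Sum.inl i))
  · rintro (i | j)
    · exact hz i
    · rw [hσ]
      by_cases h : 0 ≤ z j
      · simp [σ, h]
      · simp only [σ, h, if_false, Int.cast_one, one_mul]
        exact (not_le.1 h).le

end MixedInteger

end

noncomputable section

namespace MixedInteger

/-! ### Homogenization of rational systems -/

/-- The integer row obtained from a rational one by multiplication with all denominators. -/
def clearRow {κ : Type*} [Fintype κ] [DecidableEq κ] (q : κ → ℚ) (j : κ) : ℤ :=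
  (q j).num * ∏ l ∈ Finset.univ.erase j, ((q l).den : ℤ)

theorem clearRow_cast {κ : Type*} [Fintype κ] [DecidableEq κ] (q : κ → ℚ) (j : κ) :
    (clearRow q j : ℝ) = (∏ l, ((q l).den : ℝ)) * q j := by
  have h : (clearRow q j : ℚ) = (∏ l, ((q l).den : ℚ)) * q j := by
    rw [← Finset.mul_prod_erase _ _ (Finset.mem_univ j), mul_right_comm, Rat.den_mul_eq_num]
    simp [clearRow]
  exact_mod_cast congrArg (Rat.cast : ℚ → ℝ) h

theorem intForm_clearRow {κ : Type*} [Fintype κ] [DecidableEq κ] (q : κ → ℚ) (z : κ → ℝ) :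
    intForm (clearRow q) z = (∏ l, ((q l).den : ℝ)) * ∑ j, (q j : ℝ) * z j := by
  simp only [intForm_apply, clearRow_cast, Finset.mul_sum, mul_assoc]

theorem abs_clearRow_le {κ : Type*} [Fintype κ] [DecidableEq κ] {q : κ → ℚ} {T : ℕ}
    (hnum : ∀ j, (q j).num.natAbs ≤ T) (hden : ∀ j, (q j).den ≤ T) (j : κ) :
    |clearRow q j| ≤ (T ^ Fintype.card κ : ℕ) := by
  have h : (clearRow q j).natAbs ≤ T ^ Fintype.card κ := by
    rw [clearRow, Int.natAbs_mul, ← Nat.cast_prod, Int.natAbs_natCast, ← Finset.card_univ,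
      ← Finset.card_erase_add_one (Finset.mem_univ j), pow_succ']
    exact Nat.mul_le_mul (hnum j) (Finset.prod_le_pow_card _ _ _ fun l _ => hden l)
  rw [Int.abs_eq_natAbs]
  exact_mod_cast h

namespace IneqDescription

variable {k : ℕ} (D : IneqDescription k)

/-- The rows of the homogenized system, with denominators cleared. -/
def homRow : Option (Fin D.m) → Option (Fin k) → ℤ
  | none => Pi.single none (-1)
  | some i => clearRow fun o => o.elim (-D.b i) (D.A i)

/-- The row `none` says that the homogenizing coordinate is nonnegative. Height 1 gives the points
of the polyhedron, height 0 the solutions of the homogeneous system. -/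
theorem homRow_nonpos_iff (z : Option (Fin k) → ℝ) : (∀ i, intForm (D.homRow i) z ≤ 0) ↔
    0 ≤ z none ∧ ∀ i, ∑ j, (D.A i j : ℝ) * z (some j) ≤ D.b i * z none := by
  have h₀ : intForm (D.homRow none) z = -z none := by
    simp [homRow, intForm_apply, Pi.single_apply]
  have h₁ : ∀ i, intForm (D.homRow (some i)) z ≤ 0 ↔
      ∑ j, (D.A i j : ℝ) * z (some j) ≤ D.b i * z none := fun i => by
    rw [homRow, intForm_clearRow]
    have hpos : (0 : ℝ) < ∏ l : Option (Fin k), ((l.elim (-D.b i) (D.A i)).den : ℝ) :=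
      Finset.prod_pos fun l _ => by exact_mod_cast Rat.den_pos _
    rw [← not_lt, mul_pos_iff_of_pos_left hpos, not_lt, Fintype.sum_option]
    simp only [Option.elim_none, Option.elim_some, Rat.cast_neg]
    constructor <;> intro h <;> linarith
  constructor
  · intro h
    exact ⟨by have := h none; linarith, fun i => (h₁ i).1 (h _)⟩
  · rintro ⟨h, h'⟩ (_ | i)
    · linarith
    · exact (h₁ i).2 (h' i)

/-- Integer solutions of bounded size of the homogenized system. -/
def homGens (Δ : ℕ) : Finset (Option (Fin k) → ℤ) :=
  open scoped Classical in
  (Finset.Icc (fun _ => -(Δ : ℤ)) fun _ => (Δ : ℤ)).filter fun g =>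
    (0 : ℝ) ≤ g none ∧ ∀ i, ∑ j, (D.A i j : ℝ) * g (some j) ≤ D.b i * g none

theorem mem_homGens {Δ : ℕ} {g : Option (Fin k) → ℤ} : g ∈ D.homGens Δ ↔ (∀ j, |g j| ≤ Δ) ∧
    (0 : ℝ) ≤ g none ∧ ∀ i, ∑ j, (D.A i j : ℝ) * g (some j) ≤ D.b i * g none := by
  simp only [homGens, Finset.mem_filter, Finset.mem_Icc, Pi.le_def, abs_le, forall_and]

theorem card_homGens_le (Δ : ℕ) : (D.homGens Δ).card ≤ (2 * Δ + 1) ^ (k + 1) := by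
  classical
  refine (Finset.card_filter_le _ _).trans (le_of_eq ?_)
  rw [Pi.card_Icc]
  simp only [Int.card_Icc, Finset.prod_const, Finset.card_univ, Fintype.card_option,
    Fintype.card_fin]
  congr 1
  omega

/-- With τ = 1 this decomposes points of the polyhedron, with τ = 0 recession directions. -/
theorem exists_repr_homGens {B Δ : ℕ} (hB : 1 ≤ B) (hM : ∀ i j, |D.homRow i j| ≤ B)
    (hΔ : Δ = ((k + 1) * B) ^ (k + 1)) {x : Fin k → ℝ} {τ : ℝ} (hτ : 0 ≤ τ) (hx : ∀ i, ∑ j, (D.A i j : ℝ) * x j ≤ D.b i * τ) :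
    ∃ c : D.homGens Δ → ℝ, (∀ g, 0 ≤ c g) ∧
      (∀ j, x j = ∑ g, c g * g.1 (some j)) ∧ τ = ∑ g, c g * g.1 none := by
  have h := mem_hull_small_int D.homRow hB hM (z := fun o => o.elim τ x)
    ((D.homRow_nonpos_iff _).2 ⟨hτ, hx⟩)
  have hsub : {x | ∃ g : Option (Fin k) → ℤ,
      (∀ j, |g j| ≤ ((Fintype.card (Option (Fin k)) * B) ^ Fintype.card (Option (Fin k)) : ℕ)) ∧
      (∀ i, intForm (D.homRow i) (fun j => (g j : ℝ)) ≤ 0) ∧ x = fun j => (g j : ℝ)} ⊆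
      Set.range fun (g : D.homGens Δ) j => (g.1 j : ℝ) := by
    rintro _ ⟨g, hg, hg', rfl⟩
    rw [Fintype.card_option, Fintype.card_fin, ← hΔ] at hg
    exact ⟨⟨g, D.mem_homGens.2 ⟨hg, (D.homRow_nonpos_iff _).1 hg'⟩⟩, rfl⟩
  obtain ⟨c, hc, hxc⟩ := mem_hull_range.1 (Submodule.span_mono hsub h)
  refine ⟨c, hc, fun j => ?_, ?_⟩
  · simpa using congrFun hxc (some j)
  · simpa using congrFun hxc none

/-! ### Recession cones of rational systems -/

theorem recCone_toSet (h : D.toSet.Nonempty) :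
    recCone D.toSet = {y | ∀ i, ∑ j, (D.A i j : ℝ) * y j ≤ 0} := by
  have hlin : ∀ i (x y : Fin k → ℝ) (t : ℝ), ∑ j, (D.A i j : ℝ) * (x + t • y) j =
      ∑ j, (D.A i j : ℝ) * x j + t * ∑ j, (D.A i j : ℝ) * y j := fun i x y t => by
    rw [Finset.mul_sum, ← Finset.sum_add_distrib]
    refine Finset.sum_congr rfl fun j _ => ?_
    simp only [Pi.add_apply, Pi.smul_apply, smul_eq_mul]
    ring
  ext y
  constructor
  · intro hy i
    by_contra! hpos
    obtain ⟨x, hx⟩ := h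
    have hx' := hx i
    -- At this t row i would be tight, so the step t + 1 violates it.
    have ht : 0 ≤ (D.b i - ∑ j, (D.A i j : ℝ) * x j) / ∑ j, (D.A i j : ℝ) * y j :=
      div_nonneg (sub_nonneg.2 hx') hpos.le
    have h₁ := hy x hx _ (add_nonneg ht zero_le_one) i
    rw [hlin, add_mul, div_mul_cancel₀ _ hpos.ne'] at h₁
    linarith
  · intro hy x hx t ht i
    rw [hlin]
    have := mul_nonpos_of_nonneg_of_nonpos ht (hy i)
    linarith [hx i]

theorem bounded_homRow : ∃ B : ℕ, 1 ≤ B ∧ ∀ i j, |D.homRow i j| ≤ B := by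
  obtain ⟨B, hB⟩ := (Set.finite_range fun p : Option (Fin D.m) × Option (Fin k) =>
    (D.homRow p.1 p.2).natAbs).bddAbove
  refine ⟨max 1 B, le_max_left _ _, fun i j => ?_⟩
  rw [Int.abs_eq_natAbs]
  exact_mod_cast (hB ⟨(i, j), rfl⟩).trans (le_max_right 1 B)

/-- At height 0 the nonnegative terms c_g g_none sum to zero. So every generator used with a
positive coefficient has height 0 and is itself an integral recession direction. -/
theorem recCone_toSet_eq_cone (h : D.toSet.Nonempty) :
    recCone D.toSet = cone (intVec '' {w | intVec w ∈ recCone D.toSet}) := by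
  refine Set.Subset.antisymm (fun y hy => ?_) fun y hy => ?_
  · have hrec := D.recCone_toSet h
    rw [hrec] at hy
    obtain ⟨B, hB, hM⟩ := D.bounded_homRow
    obtain ⟨c, hc, hyc, hτ⟩ := D.exists_repr_homGens hB hM rfl (x := y) (τ := 0) le_rfl
      (by simpa using hy)
    have hτ' := (Finset.sum_eq_zero_iff_of_nonneg fun g _ =>
      mul_nonneg (hc g) (D.mem_homGens.1 g.2).2.1).1 hτ.symm
    have hsum : y = ∑ g, c g • intVec fun j => g.1 (some j) := by
      funext j
      simp [hyc, intVec]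
    rw [hsum]
    refine Submodule.sum_mem _ fun g _ => ?_
    rcases mul_eq_zero.1 (hτ' g (Finset.mem_univ g)) with h₀ | h₀
    · rw [h₀, zero_smul]
      exact Submodule.zero_mem _
    · refine Submodule.smul_mem _ (⟨c g, hc g⟩ : {c : ℝ // 0 ≤ c}) (PointedCone.subset_hull ?_)
      refine ⟨_, ?_, rfl⟩
      rw [Set.mem_ofPred_eq, hrec]
      intro i
      have := (D.mem_homGens.1 g.2).2.2 i
      rw [h₀, mul_zero] at this
      exact this
  · refine Submodule.span_induction ?_ ?_ ?_ ?_ hy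
    · rintro _ ⟨w, hw, rfl⟩
      exact hw
    · intro x hx t _
      simpa using hx
    · intro y z _ _ hy hz x hx t ht
      rw [smul_add, ← add_assoc]
      exact hz _ (hy x hx t ht) t ht
    · intro a y _ hy
      exact smul_mem_recCone hy a.2

/-- Every point can be moved near the origin by an integral direction of the recession cone. -/
theorem exists_sub_intVec_mem {B Δ : ℕ} (hB : 1 ≤ B) (hM : ∀ i j, |D.homRow i j| ≤ B)
    (hΔ : Δ = ((k + 1) * B) ^ (k + 1)) {x : Fin k → ℝ} (hx : x ∈ D.toSet) :
    ∃ y : Fin k → ℤ, intVec y ∈ recCone D.toSet ∧ x - intVec y ∈ D.toSet ∧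
      ∀ j, |(x - intVec y) j| ≤ ((2 * Δ + 1) ^ (k + 1) * Δ : ℕ) := by
  obtain ⟨c, hc, hxc, hτ⟩ := D.exists_repr_homGens hB hM hΔ (x := x) (τ := 1) zero_le_one
    (fun i => by simpa using hx i)
  -- Integer parts are removed only at generators of height 0, so the remainder still has height 1
  -- and stays in the polyhedron.
  let a : D.homGens Δ → ℤ := fun g => if g.1 none = 0 then ⌊c g⌋ else 0
  have ha : ∀ g, 0 ≤ a g := fun g => by
    simp only [a]
    split_ifs
    · exact Int.floor_nonneg.2 (hc g)
    · exact le_rfl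
  have hnone : ∀ g : D.homGens Δ, g.1 none ≠ 0 → (1 : ℝ) ≤ g.1 none := fun g hg => by
    have := (D.mem_homGens.1 g.2).2.1
    have h' : 0 ≤ g.1 none := by exact_mod_cast this
    have : 1 ≤ g.1 none := by omega
    exact_mod_cast this
  have hca₀ : ∀ g, 0 ≤ c g - a g := fun g => by
    simp only [a]
    split_ifs
    · exact Int.fract_nonneg _
    · simpa using hc g
  -- A generator of positive height has integral height at least 1, and the heights weighted by c
  -- sum to 1, so its coefficient is already at most 1.
  have hca₁ : ∀ g, c g - a g ≤ 1 := fun g => by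
    simp only [a]
    split_ifs with hg
    · exact (Int.fract_lt_one _).le
    · rw [Int.cast_zero, sub_zero, hτ]
      refine (le_mul_of_one_le_right (hc g) (hnone g hg)).trans ?_
      exact Finset.single_le_sum (f := fun g => c g * (g.1 none : ℝ))
        (fun g _ => mul_nonneg (hc g) (D.mem_homGens.1 g.2).2.1) (Finset.mem_univ g)
  have ha_none : ∀ g : D.homGens Δ, (a g : ℝ) * g.1 none = 0 := fun g => by
    by_cases h : g.1 none = 0 <;> simp [a, h]
  have hy : ∀ j, intVec (fun j => ∑ g, a g * g.1 (some j)) j = ∑ g, (a g : ℝ) * g.1 (some j) :=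
    fun j => by simp [intVec]
  have hxy : ∀ j, (x - intVec (fun j => ∑ g, a g * g.1 (some j))) j =
      ∑ g, (c g - a g) * g.1 (some j) := fun j => by
    rw [Pi.sub_apply, hy, hxc]
    simp only [sub_mul, Finset.sum_sub_distrib]
  have hle : ∀ (e : D.homGens Δ → ℝ), (∀ g, 0 ≤ e g) → ∀ i,
      ∑ j, (D.A i j : ℝ) * ∑ g, e g * g.1 (some j) ≤ D.b i * ∑ g, e g * g.1 none := by
    intro e he i
    simp only [Finset.mul_sum]
    rw [Finset.sum_comm]
    refine Finset.sum_le_sum fun g _ => ?_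
    have := mul_le_mul_of_nonneg_left ((D.mem_homGens.1 g.2).2.2 i) (he g)
    rw [Finset.mul_sum] at this
    calc _ = ∑ j, e g * ((D.A i j : ℝ) * g.1 (some j)) :=
          Finset.sum_congr rfl fun j _ => by ring
      _ ≤ _ := this
      _ = _ := by ring
  refine ⟨fun j => ∑ g, a g * g.1 (some j), ?_, fun i => ?_, fun j => ?_⟩
  · rw [D.recCone_toSet ⟨x, hx⟩]
    intro i
    simp only [hy]
    have := hle (fun g => a g) (fun g => by exact_mod_cast ha g) i
    simpa only [ha_none, Finset.sum_const_zero, mul_zero] using this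
  · simp only [hxy]
    have := hle (fun g => c g - a g) hca₀ i
    have h₁ : ∑ g, (c g - a g) * (g.1 none : ℝ) = 1 := by
      simp only [sub_mul, ha_none, sub_zero, ← hτ]
    simpa only [h₁, mul_one] using this
  · rw [hxy]
    calc |∑ g, (c g - a g) * (g.1 (some j) : ℝ)|
        ≤ ∑ g, |(c g - a g) * (g.1 (some j) : ℝ)| := Finset.abs_sum_le_sum_abs _ _
      _ ≤ ∑ _g : D.homGens Δ, (Δ : ℝ) := by
          refine Finset.sum_le_sum fun g _ => ?_
          rw [abs_mul, abs_of_nonneg (hca₀ g)]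
          have h₁ : |(g.1 (some j) : ℝ)| ≤ Δ := by exact_mod_cast (D.mem_homGens.1 g.2).1 (some j)
          exact (mul_le_of_le_one_left (abs_nonneg _) (hca₁ g)).trans h₁
      _ = ((D.homGens Δ).card * Δ : ℕ) := by simp
      _ ≤ _ := by
          exact_mod_cast Nat.mul_le_mul_right Δ (D.card_homGens_le Δ)

/-- When 0 is the only recession direction, generators of height 0 contribute nothing to x. The
others, divided by their heights, are rational points of the polyhedron, and the weights c_g g_none
sum to 1. -/
theorem isRationalPolytope_toSet (h : ∀ y : Fin k → ℝ, (∀ i, ∑ j, (D.A i j : ℝ) * y j ≤ 0) → y = 0) :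
    IsRationalPolytope D.toSet := by
  classical
  obtain ⟨B, hB, hM⟩ := D.bounded_homRow
  obtain ⟨Δ, hΔ⟩ : ∃ Δ, Δ = ((k + 1) * B) ^ (k + 1) := ⟨_, rfl⟩
  have hnone : ∀ g ∈ D.homGens Δ, g none ≠ 0 → (0 : ℝ) < g none := fun g hg hg₀ =>
    lt_of_le_of_ne (D.mem_homGens.1 hg).2.1 fun h => hg₀ (by exact_mod_cast h.symm)
  refine ⟨((D.homGens Δ).filter fun g => g none ≠ 0).image fun g j => (g (some j) : ℚ) / g none,
    Set.Subset.antisymm (fun x hx => ?_) (convexHull_min ?_ ?_)⟩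
  · obtain ⟨c, hc, hxc, hτ⟩ := D.exists_repr_homGens hB hM hΔ (x := x) (τ := 1) zero_le_one
      (fun i => by simpa using hx i)
    have hsum : x = ∑ g ∈ Finset.univ.filter fun g : D.homGens Δ => g.1 none ≠ 0,
        (c g * g.1 none) • ratVec fun j => (g.1 (some j) : ℚ) / g.1 none := by
      funext j
      have h₁ : ∑ g, c g * (g.1 (some j) : ℝ) =
          ∑ g ∈ Finset.univ.filter fun g : D.homGens Δ => g.1 none ≠ 0, c g * g.1 (some j) := by
        refine (Finset.sum_filter_of_ne fun g _ => mt fun h₀ : g.1 none = 0 => ?_).symm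
        have hzero := h (fun j => (g.1 (some j) : ℝ)) fun i => by
          have := (D.mem_homGens.1 g.2).2.2 i
          rwa [h₀, Int.cast_zero, mul_zero] at this
        rw [show (g.1 (some j) : ℝ) = 0 from congrFun hzero j, mul_zero]
      rw [hxc, h₁, Finset.sum_apply]
      refine Finset.sum_congr rfl fun g hg => ?_
      have h₀ : (g.1 none : ℝ) ≠ 0 := by
        exact_mod_cast (Finset.mem_filter.1 hg).2
      simp only [ratVec, Pi.smul_apply, smul_eq_mul, Rat.cast_div, Rat.cast_intCast]
      rw [mul_assoc, mul_div_cancel₀ _ h₀]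
    rw [hsum]
    refine (convex_convexHull ℝ _).sum_mem
      (fun g _ => mul_nonneg (hc g) (D.mem_homGens.1 g.2).2.1) ?_ fun g hg =>
        subset_convexHull ℝ _ ⟨_, ?_, rfl⟩
    · rw [hτ]
      refine Finset.sum_filter_of_ne fun g _ => mt fun h₀ : g.1 none = 0 => ?_
      rw [h₀]
      simp
    · rw [Finset.mem_coe, Finset.mem_image]
      exact ⟨g.1, Finset.mem_filter.2 ⟨g.2, (Finset.mem_filter.1 hg).2⟩, rfl⟩
  · rintro _ ⟨v, hv, rfl⟩
    rw [Finset.mem_coe, Finset.mem_image] at hv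
    obtain ⟨g, hg, rfl⟩ := hv
    rw [Finset.mem_filter] at hg
    have hpos := hnone g hg.1 hg.2
    intro i
    have := (D.mem_homGens.1 hg.1).2.2 i
    simp only [ratVec, Rat.cast_div, Rat.cast_intCast]
    simp only [← mul_div_assoc, ← Finset.sum_div]
    rwa [div_le_iff₀ hpos]
  · intro x hx y hy a b ha hb hab i
    have h₁ : ∑ j, (D.A i j : ℝ) * (a • x + b • y) j =
        a * ∑ j, (D.A i j : ℝ) * x j + b * ∑ j, (D.A i j : ℝ) * y j := by
      rw [Finset.mul_sum, Finset.mul_sum, ← Finset.sum_add_distrib]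
      refine Finset.sum_congr rfl fun j _ => ?_
      simp only [Pi.add_apply, Pi.smul_apply, smul_eq_mul]
      ring
    rw [h₁]
    calc _ ≤ a * (D.b i : ℝ) + b * D.b i :=
          add_le_add (mul_le_mul_of_nonneg_left (hx i) ha) (mul_le_mul_of_nonneg_left (hy i) hb)
      _ = D.b i := by rw [← add_mul, hab, one_mul]

end IneqDescription

end MixedInteger

end

noncomputable section

namespace MixedInteger

open Computability (Γ')

/-! ### The size of the box -/

theorem lt_two_pow_length_encNat (a : ℕ) : a < 2 ^ (encNat a).length := by
  rw [encNat_eq, List.length_map, Nat.size_eq_bits_len]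
  exact Nat.lt_size_self a

theorem natAbs_num_le (q : ℚ) : q.num.natAbs ≤ 2 ^ (encRatEntry q).length := by
  refine (lt_two_pow_length_encNat _).le.trans (Nat.pow_le_pow_right two_pos ?_)
  simp only [encRatEntry, encInt, List.length_cons, List.length_append]
  omega

theorem den_le (q : ℚ) : q.den ≤ 2 ^ (encRatEntry q).length := by
  refine (lt_two_pow_length_encNat _).le.trans (Nat.pow_le_pow_right two_pos ?_)
  simp only [encRatEntry, encInt, List.length_cons, List.length_append]
  omega

theorem sublist_encList {α : Type} (e : α → List Γ') {a : α} {l : List α} (h : a ∈ l) :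
    (e a).Sublist (encList e l) := by
  rw [encList, List.flatMap_def]
  exact ((List.sublist_flatten_of_mem (List.mem_map_of_mem h)).trans
    (List.sublist_append_left _ _)).cons _

theorem sublist_encWithDims {E : ℕ → Type} (enc : ∀ k : ℕ, E k → List Γ') (n d : ℕ)
    (D : E (n + d)) : (enc (n + d) D).Sublist (encWithDims enc n d D) :=
  ((((List.Sublist.refl _).cons _).trans (List.sublist_append_right _ _)).cons _).trans
    (List.sublist_append_right _ _)

theorem length_encRatEntry_A_le {k : ℕ} (D : IneqDescription k) (i : Fin D.m) (j : Fin k) :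
    (encRatEntry (D.A i j)).length ≤ D.encode.length :=
  (((sublist_encList encRatEntry (List.mem_ofFn.2 ⟨j, rfl⟩)).trans
    (List.sublist_append_left _ _)).trans
    (sublist_encList (fun i : Fin D.m => encVec encRatEntry (D.A i) ++ encRatEntry (D.b i))
      (List.mem_finRange i))).length_le

theorem length_encRatEntry_b_le {k : ℕ} (D : IneqDescription k) (i : Fin D.m) :
    (encRatEntry (D.b i)).length ≤ D.encode.length :=
  ((List.sublist_append_right _ _).trans
    (sublist_encList (fun i : Fin D.m => encVec encRatEntry (D.A i) ++ encRatEntry (D.b i))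
      (List.mem_finRange i))).length_le

theorem add_four_le_length_ineqStr (I : IneqInput) : I.1.1 + I.1.2 + 4 ≤ (ineqStr I).length := by
  simp only [ineqStr, encWithDims, IneqDescription.encode, encList, List.length_append,
    List.length_cons, List.length_replicate, List.length_nil]
  omega

/-- Each numerator and denominator is at most 2^L for the input length L. A cleared entry is a
product of one numerator and n + d denominators. -/
theorem abs_homRow_le (I : IneqInput) (i : Option (Fin I.2.m)) (j : Option (Fin (I.1.1 + I.1.2))) :
    |I.2.homRow i j| ≤ (2 ^ ((ineqStr I).length * (I.1.1 + I.1.2 + 1)) : ℕ) := by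
  have hlen : I.2.encode.length ≤ (ineqStr I).length :=
    (sublist_encWithDims @IneqDescription.encode I.1.1 I.1.2 I.2).length_le
  have hT : ∀ q : ℚ, (encRatEntry q).length ≤ I.2.encode.length →
      q.num.natAbs ≤ 2 ^ (ineqStr I).length ∧ q.den ≤ 2 ^ (ineqStr I).length := fun q hq =>
    ⟨(natAbs_num_le q).trans (Nat.pow_le_pow_right two_pos (hq.trans hlen)),
      (den_le q).trans (Nat.pow_le_pow_right two_pos (hq.trans hlen))⟩
  rcases i with _ | i
  · have h₁ : (1 : ℤ) ≤ (2 ^ ((ineqStr I).length * (I.1.1 + I.1.2 + 1)) : ℕ) := by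
      exact_mod_cast Nat.one_le_two_pow
    refine le_trans ?_ h₁
    simp only [IneqDescription.homRow, Pi.single_apply]
    split_ifs <;> simp
  · have hb := hT _ (length_encRatEntry_b_le I.2 i)
    have hA := fun j => hT _ (length_encRatEntry_A_le I.2 i j)
    have := abs_clearRow_le (q := fun o : Option (Fin (I.1.1 + I.1.2)) =>
      o.elim (-I.2.b i) (I.2.A i)) (T := 2 ^ (ineqStr I).length)
      (by rintro (_ | j)
          · simpa using hb.1
          · exact (hA j).1)
      (by rintro (_ | j)
          · simpa using hb.2
          · exact (hA j).2) j
    rwa [Fintype.card_option, Fintype.card_fin, ← pow_mul] at this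

/-- Here Δ bounds the entries of the generators and (2Δ + 1)^N their number. Since N ≤ L, the
exponent of two is at most L^4 + 2L^3 + L^2 + 2L, which is below L^8 because L ≥ 4. -/
theorem le_boxSize (I : IneqInput) {N Δ : ℕ} (hN : N = I.1.1 + I.1.2 + 1)
    (hΔ : Δ = (N * 2 ^ ((ineqStr I).length * N)) ^ N) :
    (2 * Δ + 1) ^ N * Δ ≤ boxSize I := by
  have hL := add_four_le_length_ineqStr I
  rw [boxSize]
  generalize (ineqStr I).length = L at *
  have hNL : N ≤ L := by omega
  have hL4 : 4 ≤ L := by omega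
  have h₁ : Δ ≤ 2 ^ ((L + L * L) * L) := by
    rw [hΔ, pow_mul 2 (L + L * L), pow_add]
    have h₂ : N ≤ 2 ^ L := hNL.trans Nat.lt_two_pow_self.le
    have h₃ : 1 ≤ 2 ^ L * 2 ^ (L * L) := Nat.mul_pos (by positivity) (by positivity)
    refine (Nat.pow_le_pow_left (Nat.mul_le_mul h₂ ?_) _).trans (Nat.pow_le_pow_right h₃ hNL)
    exact Nat.pow_le_pow_right two_pos (Nat.mul_le_mul_left _ hNL)
  have h₂ : 2 * Δ + 1 ≤ 2 ^ ((L + L * L) * L + 2) := by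
    have : 1 ≤ 2 ^ ((L + L * L) * L) := Nat.one_le_two_pow
    rw [pow_add]
    omega
  calc (2 * Δ + 1) ^ N * Δ ≤ (2 ^ ((L + L * L) * L + 2)) ^ L * 2 ^ ((L + L * L) * L) :=
        Nat.mul_le_mul ((Nat.pow_le_pow_left h₂ _).trans
          (Nat.pow_le_pow_right (by positivity) hNL)) h₁
    _ = 2 ^ (((L + L * L) * L + 2) * L + (L + L * L) * L) := by rw [← pow_mul, ← pow_add]
    _ ≤ 2 ^ L ^ 8 := by
        refine Nat.pow_le_pow_right two_pos ?_
        have e₁ : 4 * 1 ≤ L * 1 := by omega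
        have e₂ : 4 * L ≤ L ^ 2 := by rw [pow_two]; exact Nat.mul_le_mul_right L hL4
        have e₃ : 4 * L ^ 2 ≤ L ^ 3 := by rw [pow_succ' L 2]; exact Nat.mul_le_mul_right _ hL4
        have e₄ : 4 * L ^ 3 ≤ L ^ 4 := by rw [pow_succ' L 3]; exact Nat.mul_le_mul_right _ hL4
        have e₅ : 4 * L ^ 4 ≤ L ^ 5 := by rw [pow_succ' L 4]; exact Nat.mul_le_mul_right _ hL4
        have e₈ : L ^ 5 ≤ L ^ 8 := Nat.pow_le_pow_right (by omega) (by norm_num)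
        have : ((L + L * L) * L + 2) * L + (L + L * L) * L = L ^ 4 + 2 * L ^ 3 + L ^ 2 + 2 * L := by
          ring
        omega

/-! ### Intersecting with a box -/

theorem sum_ite_cast_mul {k : ℕ} (c : ℚ) (j : Fin k) (x : Fin k → ℝ) :
    ∑ l, ((if j = l then c else 0 : ℚ) : ℝ) * x l = c * x j := by
  simp [apply_ite (Rat.cast : ℚ → ℝ), ite_mul]

theorem mem_addBox {k : ℕ} (D : IneqDescription k) (R : ℕ) (x : Fin k → ℝ) :
    x ∈ (D.addBox R).toSet ↔ x ∈ D.toSet ∧ ∀ j, |x j| ≤ R := by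
  have h : x ∈ (D.addBox R).toSet ↔ ∀ i : Fin (D.m + (k + k)),
    ∑ j, ((D.addBox R).A i j : ℝ) * x j ≤ ((D.addBox R).b i : ℝ) := Iff.rfl
  rw [h, Fin.forall_fin_add, Fin.forall_fin_add]
  simp only [addBox_A, addBox_A_pos, addBox_A_neg, addBox_b, addBox_b_box, abs_le]
  refine and_congr Iff.rfl ?_
  rw [and_comm, ← forall_and]
  refine forall_congr' fun j => and_congr ?_ ?_
  · rw [sum_ite_cast_mul, neg_le]
    simp
  · rw [sum_ite_cast_mul]
    simp

theorem isRationalPolytope_addBox {k : ℕ} (D : IneqDescription k) (R : ℕ) :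
    IsRationalPolytope (D.addBox R).toSet := by
  refine (D.addBox R).isRationalPolytope_toSet fun y hy => funext fun j => le_antisymm ?_ ?_
  · have := hy (Fin.natAdd D.m (Fin.castAdd k j))
    rw [addBox_A_pos, sum_ite_cast_mul] at this
    simpa using this
  · have := hy (Fin.natAdd D.m (Fin.natAdd k j))
    rw [addBox_A_neg, sum_ite_cast_mul] at this
    simpa using this

/-- The translate near the origin provided by `exists_sub_intVec_mem` lies in the box by
`le_boxSize`. -/
theorem relevant_points_addBox {n d : ℕ} (D : IneqDescription (n + d))
    (h : D.toSet.Nonempty) {R : ℕ} (hR : R = boxSize ⟨(n, d), D⟩) :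
    D.toSet = (D.addBox R).toSet + recCone D.toSet ∧
      mixedHull n d D.toSet =
        convexHull ℝ ((D.addBox R).toSet ∩ mixedLattice n d) + recCone D.toSet := by
  refine relevant_points (fun x hx => ((mem_addBox D R x).1 hx).1) (D.recCone_toSet_eq_cone h) ?_
  intro x hx
  obtain ⟨y, hy, hxy, hb⟩ := D.exists_sub_intVec_mem Nat.one_le_two_pow
    (abs_homRow_le ⟨(n, d), D⟩) rfl hx
  refine ⟨y, hy, (mem_addBox D R _).2 ⟨hxy, fun j => (hb j).trans ?_⟩⟩
  rw [hR]
  exact_mod_cast le_boxSize ⟨(n, d), D⟩ rfl rfl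

end MixedInteger

end

/-! ### Assembly of the two algorithms -/

theorem mainTheorem6 :
    (∃ f : ∀ n d : ℕ, InnerDescription (n + d) →
        VertexDescription (n + d),
      PolyTimeComputable @InnerDescription.encode
        @VertexDescription.encode f ∧
      ∃ p : Polynomial ℕ,
        ∀ (n d : ℕ) (D : InnerDescription (n + d)),
          (D.toSet ∩ mixedLattice n d).Nonempty →
            encSize @VertexDescription.encode n d (f n d D) ≤
              p.eval (encSize @InnerDescription.encode n d D) ∧
            IsRationalPolytope (f n d D).toSet ∧
            D.toSet = (f n d D).toSet + recCone D.toSet ∧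
            mixedHull n d D.toSet =
              convexHull ℝ ((f n d D).toSet ∩ mixedLattice n d) +
                recCone D.toSet) ∧
    (∃ f : ∀ n d : ℕ, IneqDescription (n + d) →
        IneqDescription (n + d),
      PolyTimeComputable @IneqDescription.encode
        @IneqDescription.encode f ∧
      ∃ p : Polynomial ℕ,
        ∀ (n d : ℕ) (D : IneqDescription (n + d)),
          (D.toSet ∩ mixedLattice n d).Nonempty →
            encSize @IneqDescription.encode n d (f n d D) ≤
              p.eval (encSize @IneqDescription.encode n d D) ∧
            IsRationalPolytope (f n d D).toSet ∧
            D.toSet = (f n d D).toSet + recCone D.toSet ∧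
            mixedHull n d D.toSet =
              convexHull ℝ ((f n d D).toSet ∩ mixedLattice n d) +
                recCone D.toSet) := by
  refine ⟨⟨fun n d D => D.truncate, ?_, ?_⟩, ⟨fun n d D => D.addBox (boxSize ⟨(n, d), D⟩), ?_, ?_⟩⟩
  · exact TM2ComputableInPolyTime_of_PT (ea := innerStr) (fun _ => rfl) PT.inner_truncate
  · obtain ⟨p, hp⟩ := length_le_of_PT (ea := innerStr) (fun _ => rfl) PT.inner_truncate
    exact ⟨p, fun n d D hD => ⟨hp ⟨(n, d), D⟩, isRationalPolytope_vertexDescription _,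
      D.relevant_points_truncate hD⟩⟩
  · exact TM2ComputableInPolyTime_of_PT (ea := ineqStr) (fun _ => rfl) PT.ineq_addBox
  · obtain ⟨p, hp⟩ := length_le_of_PT (ea := ineqStr) (fun _ => rfl) PT.ineq_addBox
    exact ⟨p, fun n d D hD => ⟨hp ⟨(n, d), D⟩, isRationalPolytope_addBox _ _,
      relevant_points_addBox D hD.left rfl⟩⟩
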